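/- **Setting.** Documents are numbered $1,2,3,\dots$ (infinitely many, of unit size). Let $\{J_t\}$ be a stationary semi-Markov process with finitely many states $\{1,\dots,M\}$: it has jump points $T_0\le 0<T_1<T_2<\cdots\to\infty$ and $J_t=J_{T_n}$ for $T_n\le t<T_{n+1}$; for $n\ge 1$, given the history up to $T_n$ with $J_{T_n}=r$, the next state $J_{T_{n+1}}$ is $s$ with probability $p_{rs}$, and then the sojourn time $T_{n+1}-T_n$ has a law $F_{rs}$ on $(0,\infty)$ with finite mean, where the stochastic matrix $(p_{rs})$ is irreducible. Let $\pi_r=\mathbb P[J_t=r]$ and assume $\min_r\pi_r>0$. Let $\tau_1<\tau_2<\cdots$ be the points in $(0,\infty)$ of a Poisson process of unit rate, independent of $J$ and its jump points. At time $\tau_n$ document $R_n$ is requested; given $J$ with its jump points and $\{\tau_n\}$, the requests are independent and $R_n=i$ with probability $q_i^{(J_{\tau_n})}$, where $(q^{(r)}_i)_{i\ge1}$ is a probability mass function for each $r$. Let $q_i=\sum_r\pi_r q_i^{(r)}$ and assume $q_i>0$ for all $i$. A caching policy $\pi\in\mathcal P_c(x)$ for a cache of size $x$ holds, at the arrival of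 request $R_n$, a set $\mathcal C^\pi_{\tau_n}$ of $x$ documents. The initial content $\mathcal C^\pi_{\tau_1}$ is a fixed set. If $R_n\in\mathcal C^\pi_{\tau_n}$, the content does not change; otherwise one document of $\mathcal C^\pi_{\tau_n}\cup\{R_n\}$ is left out and the others form the next content. This choice is a function of $R_1,\dots,R_n$ and the contents up to time $\tau_n$. Let $0<f(i)\le K<\infty$ be the cost of retrieving document $i$ when it is missed, and define the long-run average cost $$D(\pi,x)=\limsup_{t\to\infty}\frac1t\,\mathbb E\Big[\sum_{n:\,\tau_n\in[0,t]} f(R_n)\,\mathbf 1[R_n\notin\mathcal C^\pi_{\tau_n}]\Big].$$ **Theorem.** For every $x$ let $\mathcal S=\mathcal S(x)$ be a set of $x$ documents such that $q_if(i)\ge q_jf(j)$ for all $i\in\mathcal S$ and $j\notin\mathcal S$, and let $D_s(x)$ be the long-run average cost of the static policy $\mathcal C_{\tau_n}\equiv\mathcal S(x)$. Then $$\inf_{\pi\in\mathcal P_c(x)}D(\pi,x)\sim D_s(x)\quad\text{as }x\to\infty,$$ that is, the ratio of the two sides tends to $1$. -/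

import Mathlib

open MeasureTheory ProbabilityTheory Filter Topology
open scoped ENNReal

/-- The state at time `t ≥ 0` of the right-continuous jump path that equals `X n` on
`[T n, T (n + 1))`: if `T 0 ≤ 0` and `T` increases strictly to infinity, then
`sSup {n | T n ≤ t}` is the unique `n` with `T n ≤ t < T (n + 1)`. -/
noncomputable def jumpPath {S : Type*} (T : ℕ → ℝ) (X : ℕ → S) (t : ℝ) : S :=
  X (sSup {n : ℕ | T n ≤ t})

/-- The restriction to `t ≥ 0` of a stationary semi-Markov process with states `Fin M`, jump
points `T 0 ≤ 0 < T 1 < T 2 < ⋯`, visited states `X n` (the process equals `X n` on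
`[T n, T (n + 1))`), irreducible transition matrix `p`, and law `F r s` of the duration of a
sojourn in `r` that is followed by a jump to `s`.  From the first jump after time `0` on, the
evolution follows `p` and `F`; the law of the sojourn in progress at time `0` is that of the
stationary process, through `stationary`. -/
structure IsStationarySemiMarkov {Ω : Type*} [MeasurableSpace Ω] (μ : Measure Ω) {M : ℕ}
    (p : Matrix (Fin M) (Fin M) ℝ) (F : Fin M → Fin M → Measure ℝ)
    (T : ℕ → Ω → ℝ) (X : ℕ → Ω → Fin M) : Prop where
  measurable_T : ∀ n, Measurable (T n)
  measurable_X : ∀ n, Measurable (X n)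
  -- the transition matrix of the embedded chain
  stochastic : p ∈ Matrix.rowStochastic ℝ (Fin M)
  irreducible : p.IsIrreducible
  -- sojourn times are positive and have finite mean
  sojourn_prob : ∀ r s, IsProbabilityMeasure (F r s)
  sojourn_pos : ∀ r s, F r s (Set.Iic 0) = 0
  sojourn_mean : ∀ r s, Integrable (fun u : ℝ => u) (F r s)
  -- the jump points
  first_jump : ∀ᵐ ω ∂μ, T 0 ω ≤ 0 ∧ 0 < T 1 ω
  strictMono : ∀ᵐ ω ∂μ, StrictMono fun n => T n ω
  tendsto_T : ∀ᵐ ω ∂μ, Tendsto (fun n => T n ω) atTop atTop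
  -- given the history up to the `n`-th jump, the next state and the sojourn time until the next
  -- jump have the law `p r s * F r s` with `r` the current state
  markov : ∀ n, 1 ≤ n → ∀ A : Set (Fin (n + 1) → ℝ × Fin M), MeasurableSet A →
    ∀ (r s : Fin M) (B : Set ℝ), MeasurableSet B →
    μ {ω | (fun k : Fin (n + 1) => (T k ω, X k ω)) ∈ A ∧ X n ω = r ∧
        X (n + 1) ω = s ∧ T (n + 1) ω - T n ω ∈ B} =
      μ {ω | (fun k : Fin (n + 1) => (T k ω, X k ω)) ∈ A ∧ X n ω = r} *
        (ENNReal.ofReal (p r s) * F r s B)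
  -- the finite-dimensional distributions are invariant under time shifts
  stationary : ∀ h : ℝ, 0 ≤ h → ∀ (k : ℕ) (t : Fin k → ℝ), (∀ i, 0 ≤ t i) →
    ∀ x : Fin k → Fin M,
    μ {ω | ∀ i, jumpPath (fun n => T n ω) (fun n => X n ω) (t i + h) = x i} =
      μ {ω | ∀ i, jumpPath (fun n => T n ω) (fun n => X n ω) (t i) = x i}

/-- `τ 0 < τ 1 < ⋯` are the points in `(0, ∞)` of a Poisson process of unit rate: the first point
and the gaps between consecutive points are independent and exponential with mean `1`. -/
structure IsUnitPoisson {Ω : Type*} [MeasurableSpace Ω] (μ : Measure Ω) (τ : ℕ → Ω → ℝ) :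
    Prop where
  measurable : ∀ n, Measurable (τ n)
  gap_law : ∀ n, μ.map (fun ω => τ n ω - if n = 0 then 0 else τ (n - 1) ω) = expMeasure 1
  gap_indep : iIndepFun (fun n ω => τ n ω - if n = 0 then 0 else τ (n - 1) ω) μ

/-- Semi-Markov modulated requests: the document `R n` is requested at the Poisson point `τ n`.
The semi-Markov process is independent of the Poisson points; given both, the requests are
independent, and the request at time `τ n` has the distribution `q r` if the modulating process is
in state `r` at that time. -/
structure IsSemiMarkovModulated {Ω : Type*} [MeasurableSpace Ω] (μ : Measure Ω) {M : ℕ}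
    (p : Matrix (Fin M) (Fin M) ℝ) (F : Fin M → Fin M → Measure ℝ) (q : Fin M → PMF ℕ)
    (T : ℕ → Ω → ℝ) (X : ℕ → Ω → Fin M) (τ : ℕ → Ω → ℝ) (R : ℕ → Ω → ℕ) : Prop where
  semiMarkov : IsStationarySemiMarkov μ p F T X
  poisson : IsUnitPoisson μ τ
  indep : IndepFun (fun ω (n : ℕ) => (T n ω, X n ω)) (fun ω (n : ℕ) => τ n ω) μ
  measurable_R : ∀ n, Measurable (R n)
  requests : ∀ (n : ℕ) (i : ℕ → ℕ),
    μ⟦{ω | ∀ l < n, R l ω = i l} |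
        MeasurableSpace.comap
          (fun ω => ((fun n : ℕ => (T n ω, X n ω)), (fun n : ℕ => τ n ω))) inferInstance⟧
      =ᵐ[μ] fun ω => ∏ l ∈ Finset.range n,
        (q (jumpPath (fun n => T n ω) (fun n => X n ω) (τ l ω)) (i l)).toReal

/-- The stationary probability `π_r` that the modulating process is in state `r`. -/
noncomputable def statProb {Ω : Type*} [MeasurableSpace Ω] (μ : Measure Ω) {M : ℕ}
    (T : ℕ → Ω → ℝ) (X : ℕ → Ω → Fin M) (r : Fin M) : ℝ :=
  μ.real {ω | jumpPath (fun n => T n ω) (fun n => X n ω) 0 = r}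

/-- The marginal request probability `q_i = ∑ r, π_r q_i^{(r)}` of document `i`. -/
noncomputable def popularity {Ω : Type*} [MeasurableSpace Ω] (μ : Measure Ω) {M : ℕ}
    (q : Fin M → PMF ℕ) (T : ℕ → Ω → ℝ) (X : ℕ → Ω → Fin M) (i : ℕ) : ℝ :=
  ∑ r, statProb μ T X r * (q r i).toReal

/-- A caching policy for a cache of size `x`, with optional replacement.  For the request sequence
`r 0, r 1, …`, the set `content r n` is the cache content when request `r n` arrives; it is
determined by the initial content and by the decisions made at the requests `r 0, …, r (n - 1)`,
each of which uses only the requests and the contents up to and including that time. -/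
structure CachingPolicy (x : ℕ) where
  content : (ℕ → ℕ) → ℕ → Finset ℕ
  -- the initial content is fixed and has `x` documents
  initial : ∀ r r', content r 0 = content r' 0
  card_initial : ∀ r, (content r 0).card = x
  -- decisions do not depend on future requests
  adapted : ∀ n r r', (∀ k < n, r k = r' k) → content r n = content r' n
  -- nothing is replaced on a hit
  hit : ∀ r n, r n ∈ content r n → content r (n + 1) = content r n
  -- on a miss one of the cached documents or the requested one is left out
  miss : ∀ r n, r n ∉ content r n →
    ∃ e ∈ insert (r n) (content r n), content r (n + 1) = (insert (r n) (content r n)).erase e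

/-- The static policy, which always holds the documents of `C`. -/
def CachingPolicy.static {x : ℕ} (C : Finset ℕ) (hC : C.card = x) : CachingPolicy x where
  content _ _ := C
  initial _ _ := rfl
  card_initial _ := hC
  adapted _ _ _ _ := rfl
  hit _ _ _ := rfl
  miss r n h := ⟨r n, Finset.mem_insert_self _ _, (Finset.erase_insert h).symm⟩

open Classical in
/-- The long-run average cost
`limsup_{t → ∞} E[∑_{τ_n ∈ [0, t]} f(R_n) 1[R_n is not in the cache]] / t` of a policy. -/
noncomputable def longRunCost {Ω : Type*} [MeasurableSpace Ω] (μ : Measure Ω)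
    (τ : ℕ → Ω → ℝ) (R : ℕ → Ω → ℕ) (f : ℕ → ℝ) {x : ℕ} (π : CachingPolicy x) : ℝ≥0∞ :=
  limsup (fun t : ℝ =>
    (∫⁻ ω, ∑' n : ℕ,
      (if τ n ω ∈ Set.Icc 0 t ∧ R n ω ∉ π.content (fun k => R k ω) n
        then ENNReal.ofReal (f (R n ω)) else 0) ∂μ) / ENNReal.ofReal t) atTop

/-!
The static cost is at most the rate of cost `∑ i ∉ S x, q_i f i` of the documents that the cache
does not hold, because the expected number of requests up to time `t` is at most `t`
(`longRunCost_static_le`).  What remains is to show that no policy does asymptotically better.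

Cut the requests into windows of `N` consecutive requests, where `N` is large but does not depend
on the cache size `x`.  A document that is not in the cache at the start of a window and is
requested in it causes a miss at its first request there, whatever the policy does
(`CachingPolicy.exists_miss_of_request`).  Given the past, the expected number of requests for `i`
in the window is about `N q_i`, provided that the modulating process is seen in each state as often
as it should be.  If all the `q_i^{(r)}` are small compared with `1 / N`, then `i` is hardly ever
requested twice in the window, so that it causes a miss with a probability of about `N q_i`
(`le_measureReal_requestedIn_of_rare`).  All but finitely many documents are rare in this sense,
and each of the others still causes a miss with a probability of at least about `q_i > 0`.  As `x`
grows, the rate of cost left out by `S x` tends to zero, so that leaving out one of the finitely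
many frequent documents costs too much; and a content that holds all of them leaves out rare
documents only, whose total rate of cost is at least that left out by `S x`
(`eventually_mul_missedMass_le`). Hence every window costs at least about `N` times the rate of the
static policy, and `L` windows take a time of about `L N` (`le_longRunCost`).

That long windows see the states as often as they should is a law of large numbers
(`exists_window`).  The states at the requests form a stationary sequence (`map_requestState`), so
only the first window matters.  Sampling the path at the Poisson points differs from its occupation
time by a martingale with bounded second moments per point
(`IsUnitPoisson.lintegral_sum_sub_integral_sq_le`).  The occupation times are sums over the
sojourns, and a solution of the Poisson equation of the embedded chain (`exists_poissonEquation`)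
turns these sums into martingales, up to a bounded term, whose increments become square integrable
after a truncation of the sojourn times (`exists_lintegral_abs_sum_sub_le`).  The limit of the
occupation fractions is a constant, and by stationarity it is the stationary probability
(`tendsto_visits`).
-/

/-! ### Orthogonal sums and the Poisson equation of a finite Markov chain -/

/-- For pairwise orthogonal square integrable random variables, the second moment of the sum is
the sum of the second moments; here these are bounded by `C`. -/
theorem integral_sq_sum_le_of_orthogonal {Ω : Type*} [MeasurableSpace Ω] {μ : Measure Ω}
    {D : ℕ → Ω → ℝ} {C : ℝ} (hD : ∀ k, MemLp (D k) 2 μ)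
    (horth : ∀ j k, j < k → ∫ ω, D j ω * D k ω ∂μ = 0) (hC : ∀ k, ∫ ω, D k ω ^ 2 ∂μ ≤ C)
    (n : ℕ) : ∫ ω, (∑ k ∈ Finset.range n, D k ω) ^ 2 ∂μ ≤ n * C := by
  induction n with
  | zero => simp
  | succ n ih =>
    have hS : MemLp (fun ω => ∑ k ∈ Finset.range n, D k ω) 2 μ :=
      memLp_finsetSum _ fun k _ => hD k
    have hmul : ∀ j, Integrable (fun ω => D j ω * D n ω) μ := fun j => (hD j).integrable_mul (hD n)
    have h1 : ∀ ω, (∑ k ∈ Finset.range (n + 1), D k ω) ^ 2 =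
        (∑ k ∈ Finset.range n, D k ω) ^ 2 + D n ω ^ 2
          + 2 * ∑ k ∈ Finset.range n, D k ω * D n ω := by
      intro ω
      rw [Finset.sum_range_succ, ← Finset.sum_mul]
      ring
    simp_rw [h1]
    have h2 : Integrable (fun ω => (∑ k ∈ Finset.range n, D k ω) ^ 2 + D n ω ^ 2) μ :=
      hS.integrable_sq.add (hD n).integrable_sq
    rw [integral_add h2 ((integrable_finsetSum _ fun k _ => hmul k).const_mul 2),
      integral_add hS.integrable_sq (hD n).integrable_sq, integral_const_mul,
      integral_finsetSum _ fun k _ => hmul k,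
      Finset.sum_eq_zero fun j hj => horth j n (Finset.mem_range.1 hj)]
    push_cast
    linarith [hC n]

open Matrix in
/-- A harmonic function of an irreducible stochastic matrix is constant. -/
theorem eq_of_mulVec_eq_self {ι : Type*} [Fintype ι] [DecidableEq ι] {p : Matrix ι ι ℝ}
    (hp : p ∈ Matrix.rowStochastic ℝ ι) (hirr : p.IsIrreducible) {h : ι → ℝ} (hh : p *ᵥ h = h)
    (i j : ι) : h i = h j := by
  have hne : Nonempty ι := ⟨i⟩
  -- at a maximum `b` of `h`, every power of `p` averages `h` to its maximum
  obtain ⟨b, hb⟩ := Finite.exists_max h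
  suffices H : ∀ j, h j = h b by rw [H, H j]
  intro j
  obtain ⟨k, -, hk⟩ := (Matrix.isIrreducible_iff_exists_pow_pos hirr.nonneg).1 hirr b j
  have hpk : p ^ k ∈ Matrix.rowStochastic ℝ ι := pow_mem hp k
  have hhk : ∀ k : ℕ, (p ^ k) *ᵥ h = h := by
    intro k
    induction k with
    | zero => simp
    | succ k ih => rw [pow_succ, ← Matrix.mulVec_mulVec, hh, ih]
  have h1 : ∑ l, (p ^ k) b l * (h b - h l) = 0 := by
    have h2 : ∑ l, (p ^ k) b l * h l = h b := congrFun (hhk k) b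
    simp_rw [mul_sub]
    rw [Finset.sum_sub_distrib, ← Finset.sum_mul, Matrix.sum_row_of_mem_rowStochastic hpk, h2]
    ring
  have h2 := (Finset.sum_eq_zero_iff_of_nonneg fun l _ =>
    mul_nonneg (Matrix.nonneg_of_mem_rowStochastic hpk) (sub_nonneg.2 (hb l))).1 h1 j
      (Finset.mem_univ j)
  rcases mul_eq_zero.1 h2 with h3 | h3
  · exact absurd h3 hk.ne'
  · linarith

open Matrix in
/-- The Poisson equation `φ = c + h - p h` of an irreducible finite Markov chain is solvable: the
range of `1 - p` has codimension one, and it does not contain the constants. -/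
theorem exists_poissonEquation {ι : Type*} [Fintype ι] [DecidableEq ι] [Nonempty ι]
    {p : Matrix ι ι ℝ} (hp : p ∈ Matrix.rowStochastic ℝ ι) (hirr : p.IsIrreducible)
    (φ : ι → ℝ) : ∃ (c : ℝ) (h : ι → ℝ), ∀ r, φ r = c + h r - ∑ s, p r s * h s := by
  obtain ⟨i₀⟩ := ‹Nonempty ι›
  -- `(c, h) ↦ c + h - p h` on the functions `h` vanishing at `i₀`; `h i₀` encodes `c`
  let A : (ι → ℝ) →ₗ[ℝ] (ι → ℝ) :=
    { toFun := fun g r => g i₀ + Function.update g i₀ 0 r - (p *ᵥ Function.update g i₀ 0) r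
      map_add' := by
        intro g g'
        have : Function.update (g + g') i₀ 0 =
            Function.update g i₀ 0 + Function.update g' i₀ 0 := by
          ext r; by_cases hr : r = i₀ <;> simp [hr]
        ext r
        simp only [this, Matrix.mulVec_add, Pi.add_apply]
        ring
      map_smul' := by
        intro a g
        have : Function.update (a • g) i₀ 0 = a • Function.update g i₀ 0 := by
          ext r; by_cases hr : r = i₀ <;> simp [hr]
        ext r
        simp only [this, Matrix.mulVec_smul, Pi.smul_apply, smul_eq_mul, RingHom.id_apply]
        ring }
  have hinj : Function.Injective A := by
    rw [← LinearMap.ker_eq_bot, LinearMap.ker_eq_bot']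
    intro g hg
    set h := Function.update g i₀ 0 with hh
    have h1 : ∀ r, g i₀ + h r - ∑ s, p r s * h s = 0 := fun r => congrFun hg r
    have hsum : ∀ r b, ∑ s, p r s * (h b - h s) = h b - ∑ s, p r s * h s := by
      intro r b
      simp_rw [mul_sub]
      rw [Finset.sum_sub_distrib, ← Finset.sum_mul, Matrix.sum_row_of_mem_rowStochastic hp, one_mul]
    have hne : Nonempty ι := ⟨i₀⟩
    obtain ⟨b, hb⟩ := Finite.exists_max h
    obtain ⟨a, ha⟩ := Finite.exists_min h
    have hb' : 0 ≤ ∑ s, p b s * (h b - h s) := Finset.sum_nonneg fun s _ =>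
      mul_nonneg (Matrix.nonneg_of_mem_rowStochastic hp) (sub_nonneg.2 (hb s))
    have ha' : ∑ s, p a s * (h a - h s) ≤ 0 := Finset.sum_nonpos fun s _ =>
      mul_nonpos_of_nonneg_of_nonpos (Matrix.nonneg_of_mem_rowStochastic hp) (sub_nonpos.2 (ha s))
    rw [hsum] at hb' ha'
    -- the constant equals `p h - h`, which is `≤ 0` at a maximum of `h` and `≥ 0` at a minimum
    have hg0 : g i₀ = 0 := by linarith [h1 a, h1 b]
    have hharm : p *ᵥ h = h := by
      ext r
      have := h1 r
      rw [hg0] at this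
      change ∑ s, p r s * h s = h r
      linarith
    ext r
    by_cases hr : r = i₀
    · rw [hr, hg0]; rfl
    · have h3 : h r = h i₀ := eq_of_mulVec_eq_self hp hirr hharm r i₀
      simpa [hh, Function.update_apply, hr] using h3
  obtain ⟨g, hg⟩ := LinearMap.injective_iff_surjective.1 hinj φ
  exact ⟨g i₀, Function.update g i₀ 0, fun r => (congrFun hg r).symm⟩

/-! ### Sampling at the points of a Poisson process -/

/-- The survival function of the unit exponential law. -/
theorem expMeasure_one_lt {t : ℝ} (ht : 0 < t) :
    expMeasure 1 {e | t < e} = ENNReal.ofReal (Real.exp (-t)) := by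
  have := isProbabilityMeasure_expMeasure one_pos
  have h1 : {e : ℝ | t < e} = (Set.Iic t)ᶜ := by ext; simp
  rw [h1, prob_compl_eq_one_sub measurableSet_Iic, ← ofReal_cdf, cdf_expMeasure_eq one_pos,
    if_pos ht.le, ← ENNReal.ofReal_one, ← ENNReal.ofReal_sub _ (by simp [ht.le])]
  simp

theorem expMeasure_one_Iic_zero : expMeasure 1 (Set.Iic 0) = 0 := by
  have := isProbabilityMeasure_expMeasure one_pos
  rw [← ofReal_cdf, cdf_expMeasure_eq one_pos]
  simp

theorem ae_pos_expMeasure_one : ∀ᵐ e ∂expMeasure 1, 0 < e := by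
  rw [ae_iff]; simpa [Set.Iic] using expMeasure_one_Iic_zero

/-- For a unit exponential variable `E`, the expectations of `k E` and of `∫ u in 0..E, k u`
agree: the compensator of a unit rate point is time itself. -/
theorem lintegral_integral_expMeasure_one {k : ℝ → ℝ} (hk : Measurable k)
    (hk0 : ∀ t, 0 < t → 0 ≤ k t) (hki : ∀ t > 0, IntervalIntegrable k volume 0 t) :
    ∫⁻ e, ENNReal.ofReal (∫ u in (0 : ℝ)..e, k u) ∂expMeasure 1 =
      ∫⁻ e, ENNReal.ofReal (k e) ∂expMeasure 1 := by
  -- the survival function of the unit exponential law equals its density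
  have h1 := lintegral_comp_eq_lintegral_meas_lt_mul (expMeasure 1) (f := fun e : ℝ => e) (g := k)
    (by filter_upwards [ae_pos_expMeasure_one] with e he using he.le) aemeasurable_id hki
    (by filter_upwards [ae_restrict_mem measurableSet_Ioi] with t ht using hk0 t ht)
  rw [h1]
  have h2 : expMeasure 1 = volume.withDensity (exponentialPDF 1) := rfl
  have h3 : Measurable (exponentialPDF 1) := (measurable_exponentialPDFReal 1).ennreal_ofReal
  rw [← lintegral_add_compl (μ := expMeasure 1) _ (measurableSet_Ioi (a := (0 : ℝ))), Set.compl_Ioi,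
    Measure.restrict_eq_zero.2 expMeasure_one_Iic_zero, lintegral_zero_measure, add_zero]
  conv_rhs => rw [h2, setLIntegral_withDensity_eq_setLIntegral_mul _ h3 hk.ennreal_ofReal
    measurableSet_Ioi]
  refine setLIntegral_congr_fun measurableSet_Ioi fun t ht => ?_
  simp only [Pi.mul_apply]
  rw [expMeasure_one_lt ht, exponentialPDF_of_nonneg (le_of_lt ht)]
  simp

theorem lintegral_id_expMeasure_one : ∫⁻ e, ENNReal.ofReal e ∂expMeasure 1 = 1 := by
  have := isProbabilityMeasure_expMeasure one_pos
  have h := lintegral_integral_expMeasure_one (k := fun _ => 1) measurable_const (by simp) (by simp)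
  simpa using h

theorem lintegral_sq_expMeasure_one : ∫⁻ e, ENNReal.ofReal (e ^ 2) ∂expMeasure 1 = 2 := by
  have h := lintegral_integral_expMeasure_one (k := fun t => 2 * t) (by fun_prop)
    (fun t ht => by positivity)
    (fun t _ => (by fun_prop : Continuous fun t : ℝ => 2 * t).intervalIntegrable _ _)
  have h1 : ∀ e : ℝ, ∫ u in (0 : ℝ)..e, 2 * u = e ^ 2 := by
    intro e; rw [intervalIntegral.integral_const_mul, integral_id]; ring
  simp_rw [h1, ENNReal.ofReal_mul (zero_le_two (α := ℝ))] at h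
  rw [h, lintegral_const_mul _ (by fun_prop), lintegral_id_expMeasure_one]
  simp

theorem memLp_id_expMeasure_one : MemLp (fun e : ℝ => e) 2 (expMeasure 1) := by
  rw [memLp_two_iff_integrable_sq (by fun_prop)]
  refine ⟨by fun_prop, ?_⟩
  rw [hasFiniteIntegral_iff_ofReal (by filter_upwards with e using sq_nonneg e),
    lintegral_sq_expMeasure_one]
  simp

theorem integral_sq_expMeasure_one : ∫ e, e ^ 2 ∂expMeasure 1 = 2 := by
  rw [integral_eq_lintegral_of_nonneg_ae (by filter_upwards with e using sq_nonneg e)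
    (by fun_prop), lintegral_sq_expMeasure_one]
  simp

theorem integral_integral_expMeasure_one {k : ℝ → ℝ} (hk : Measurable k) (hk0 : ∀ t, 0 ≤ k t)
    (hki : ∀ a b, IntervalIntegrable k volume a b) :
    ∫ e, (∫ u in (0 : ℝ)..e, k u) ∂expMeasure 1 = ∫ e, k e ∂expMeasure 1 := by
  have hc : Continuous fun e => ∫ u in (0 : ℝ)..e, k u :=
    intervalIntegral.continuous_primitive hki 0
  rw [integral_eq_lintegral_of_nonneg_ae _ hc.aestronglyMeasurable,
    integral_eq_lintegral_of_nonneg_ae (by filter_upwards with e using hk0 e)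
      hk.aestronglyMeasurable,
    lintegral_integral_expMeasure_one hk (fun t _ => hk0 t) (fun t _ => hki 0 t)]
  filter_upwards [ae_pos_expMeasure_one] with e he
  exact intervalIntegral.integral_nonneg he.le fun u _ => hk0 u

/-- A measurable function with values in `[0, 1]` is integrable on intervals. -/
theorem intervalIntegrable_of_mem_Icc {g : ℝ → ℝ} (hg : Measurable g)
    (h01 : ∀ t, g t ∈ Set.Icc (0 : ℝ) 1) (a b : ℝ) : IntervalIntegrable g volume a b := by
  refine (intervalIntegrable_const (c := (1 : ℝ))).mono_fun hg.aestronglyMeasurable ?_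
  filter_upwards with t
  simpa [abs_of_nonneg (h01 t).1] using (h01 t).2

theorem abs_integral_le_of_mem_Icc {g : ℝ → ℝ}
    (h01 : ∀ t, g t ∈ Set.Icc (0 : ℝ) 1) (a b : ℝ) : |∫ u in a..b, g u| ≤ |b - a| := by
  have := intervalIntegral.norm_integral_le_of_norm_le_const (f := g) (C := 1) (a := a) (b := b)
    fun t _ => by simpa [abs_of_nonneg (h01 t).1] using (h01 t).2
  simpa using this

section Poisson

set_option linter.unusedSectionVars false

variable {Ω : Type*} [MeasurableSpace Ω] {μ : Measure Ω} [IsProbabilityMeasure μ]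
  {τ : ℕ → Ω → ℝ}

/-- The time between the point number `n - 1` (time `0` if `n = 0`) and the point number `n`. -/
def pointGap (τ : ℕ → Ω → ℝ) (n : ℕ) (ω : Ω) : ℝ := τ n ω - if n = 0 then 0 else τ (n - 1) ω

theorem sum_pointGap (τ : ℕ → Ω → ℝ) (n : ℕ) (ω : Ω) :
    ∑ i ∈ Finset.range (n + 1), pointGap τ i ω = τ n ω := by
  induction n with
  | zero => simp [pointGap]
  | succ n ih => rw [Finset.sum_range_succ, ih]; simp [pointGap]

/-- The point preceding the point number `n`, which is time `0` if `n = 0`. -/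
def prevPoint (τ : ℕ → Ω → ℝ) (n : ℕ) (ω : Ω) : ℝ := ∑ i ∈ Finset.range n, pointGap τ i ω

theorem prevPoint_succ (τ : ℕ → Ω → ℝ) (n : ℕ) (ω : Ω) : prevPoint τ (n + 1) ω = τ n ω :=
  sum_pointGap τ n ω

theorem prevPoint_add_pointGap (τ : ℕ → Ω → ℝ) (n : ℕ) (ω : Ω) :
    prevPoint τ n ω + pointGap τ n ω = τ n ω := by
  rw [← sum_pointGap τ, Finset.sum_range_succ, prevPoint]

/-- The value of `g` at the point number `n`, minus its compensator, the integral of `g` from the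
preceding point to this one.  These are the differences of a martingale. -/
noncomputable def compensatedPoint (τ : ℕ → Ω → ℝ) (g : ℝ → ℝ) (n : ℕ) (ω : Ω) : ℝ :=
  g (τ n ω) - ∫ u in prevPoint τ n ω..τ n ω, g u

theorem sum_compensatedPoint {g : ℝ → ℝ} (hg : ∀ a b, IntervalIntegrable g volume a b) (n : ℕ)
    (ω : Ω) : ∑ i ∈ Finset.range n, compensatedPoint τ g i ω =
      ∑ i ∈ Finset.range n, g (τ i ω) - ∫ u in (0 : ℝ)..prevPoint τ n ω, g u := by
  induction n with
  | zero => simp [prevPoint]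
  | succ n ih =>
    rw [Finset.sum_range_succ, ih, Finset.sum_range_succ, compensatedPoint, prevPoint_succ,
      ← intervalIntegral.integral_add_adjacent_intervals (hg 0 (prevPoint τ n ω)) (hg _ (τ n ω))]
    ring

namespace IsUnitPoisson

theorem measurable_pointGap (h : IsUnitPoisson μ τ) (n : ℕ) : Measurable (pointGap τ n) := by
  unfold pointGap
  have := h.measurable
  by_cases hn : n = 0 <;> simp only [hn, if_true, if_false] <;> fun_prop

theorem map_pointGap (h : IsUnitPoisson μ τ) (n : ℕ) : μ.map (pointGap τ n) = expMeasure 1 :=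
  h.gap_law n

theorem iIndepFun_pointGap (h : IsUnitPoisson μ τ) : iIndepFun (pointGap τ) μ := h.gap_indep

theorem measurable_prevPoint (h : IsUnitPoisson μ τ) (n : ℕ) : Measurable (prevPoint τ n) := by
  unfold prevPoint
  have := h.measurable_pointGap
  fun_prop

theorem ae_pointGap_pos (h : IsUnitPoisson μ τ) : ∀ᵐ ω ∂μ, ∀ n, 0 < pointGap τ n ω := by
  rw [ae_all_iff]
  intro n
  have := ae_pos_expMeasure_one
  rw [← h.map_pointGap n] at this
  exact ae_of_ae_map (h.measurable_pointGap n).aemeasurable this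

theorem ae_pos_strictMono (h : IsUnitPoisson μ τ) :
    ∀ᵐ ω ∂μ, (∀ n, 0 < τ n ω) ∧ StrictMono fun n => τ n ω := by
  filter_upwards [h.ae_pointGap_pos] with ω hω
  refine ⟨fun n => ?_, strictMono_nat_of_lt_succ fun n => ?_⟩
  · rw [← sum_pointGap τ]
    exact Finset.sum_pos (fun i _ => hω i) (by simp)
  · have := hω (n + 1)
    simp only [pointGap, Nat.add_eq_zero_iff, one_ne_zero, and_false, if_false,
      Nat.add_sub_cancel] at this
    linarith

theorem memLp_pointGap (h : IsUnitPoisson μ τ) (n : ℕ) : MemLp (pointGap τ n) 2 μ := by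
  have := memLp_id_expMeasure_one
  rw [← h.map_pointGap n] at this
  exact this.comp_of_map (h.measurable_pointGap n).aemeasurable

theorem integral_pointGap_sq (h : IsUnitPoisson μ τ) (n : ℕ) : ∫ ω, pointGap τ n ω ^ 2 ∂μ = 2 := by
  rw [← integral_sq_expMeasure_one, ← h.map_pointGap n,
    integral_map (h.measurable_pointGap n).aemeasurable (by fun_prop)]

variable {g : ℝ → ℝ}

theorem measurable_compensatedPoint (h : IsUnitPoisson μ τ) (hg : Measurable g)
    (h01 : ∀ t, g t ∈ Set.Icc (0 : ℝ) 1) (n : ℕ) : Measurable (compensatedPoint τ g n) := by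
  have hi := intervalIntegrable_of_mem_Icc hg h01
  have hG : Measurable fun e => ∫ u in (0 : ℝ)..e, g u :=
    (intervalIntegral.continuous_primitive hi 0).measurable
  have : compensatedPoint τ g n = fun ω => g (τ n ω) -
      ((∫ u in (0 : ℝ)..τ n ω, g u) - ∫ u in (0 : ℝ)..prevPoint τ n ω, g u) := by
    ext ω
    rw [intervalIntegral.integral_interval_sub_left (hi _ _) (hi _ _), compensatedPoint]
  rw [this]
  exact (hg.comp (h.measurable n)).sub
    ((hG.comp (h.measurable n)).sub (hG.comp (h.measurable_prevPoint n)))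

theorem abs_compensatedPoint_le (h01 : ∀ t, g t ∈ Set.Icc (0 : ℝ) 1) (n : ℕ) (ω : Ω) :
    |compensatedPoint τ g n ω| ≤ 1 + |pointGap τ n ω| := by
  have h1 := abs_integral_le_of_mem_Icc h01 (prevPoint τ n ω) (τ n ω)
  rw [← eq_sub_of_add_eq' (prevPoint_add_pointGap τ n ω)] at h1
  have h2 : |g (τ n ω)| ≤ 1 := by rw [abs_of_nonneg (h01 _).1]; exact (h01 _).2
  exact (abs_sub _ _).trans (add_le_add h2 h1)

theorem memLp_compensatedPoint (h : IsUnitPoisson μ τ) (hg : Measurable g)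
    (h01 : ∀ t, g t ∈ Set.Icc (0 : ℝ) 1) (n : ℕ) : MemLp (compensatedPoint τ g n) 2 μ := by
  refine ((memLp_const (1 : ℝ)).add (h.memLp_pointGap n).abs).of_le
    (h.measurable_compensatedPoint hg h01 n).aestronglyMeasurable ?_
  filter_upwards with ω
  have := abs_compensatedPoint_le (τ := τ) h01 n ω
  simp only [Pi.add_apply, Real.norm_eq_abs]
  exact this.trans (le_abs_self _)

theorem integral_compensatedPoint_sq_le (h : IsUnitPoisson μ τ) (hg : Measurable g)
    (h01 : ∀ t, g t ∈ Set.Icc (0 : ℝ) 1) (n : ℕ) :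
    ∫ ω, compensatedPoint τ g n ω ^ 2 ∂μ ≤ 6 := by
  -- `(1 + gap) ^ 2 ≤ 2 + 2 * gap ^ 2`, and the gap has second moment `2`
  have h1 : ∫ ω, compensatedPoint τ g n ω ^ 2 ∂μ ≤ ∫ ω, (2 + 2 * pointGap τ n ω ^ 2) ∂μ := by
    refine integral_mono (h.memLp_compensatedPoint hg h01 n).integrable_sq
      ((integrable_const _).add ((h.memLp_pointGap n).integrable_sq.const_mul 2)) fun ω => ?_
    have h2 := pow_le_pow_left₀ (abs_nonneg _) (abs_compensatedPoint_le (τ := τ) h01 n ω) 2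
    have h3 := sq_abs (pointGap τ n ω)
    rw [sq_abs] at h2
    change compensatedPoint τ g n ω ^ 2 ≤ 2 + 2 * pointGap τ n ω ^ 2
    nlinarith [sq_nonneg (1 - |pointGap τ n ω|)]
  rw [integral_add (integrable_const _) ((h.memLp_pointGap n).integrable_sq.const_mul 2),
    integral_const_mul, h.integral_pointGap_sq] at h1
  refine h1.trans ?_
  norm_num

/-- The compensated point is centered given any variable `u` that, jointly with the preceding
point, is independent of the next gap. -/
theorem integral_mul_compensatedPoint (h : IsUnitPoisson μ τ) (hg : Measurable g)
    (h01 : ∀ t, g t ∈ Set.Icc (0 : ℝ) 1) (n : ℕ) {u : Ω → ℝ} (hu : Measurable u)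
    (hind : IndepFun (fun ω => (u ω, prevPoint τ n ω)) (pointGap τ n) μ)
    (hint : Integrable (fun ω => u ω * compensatedPoint τ g n ω) μ) :
    ∫ ω, u ω * compensatedPoint τ g n ω ∂μ = 0 := by
  have hi := intervalIntegrable_of_mem_Icc hg h01
  have hG : Measurable fun e => ∫ u in (0 : ℝ)..e, g u :=
    (intervalIntegral.continuous_primitive hi 0).measurable
  -- the product as a function of `((u, preceding point), gap)`; for fixed `u` and preceding point
  -- `a`, the gap compensates `g (a + ·)`
  let Φ : (ℝ × ℝ) × ℝ → ℝ := fun x => x.1.1 * (g (x.1.2 + x.2) -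
    ((∫ u in (0 : ℝ)..(x.1.2 + x.2), g u) - ∫ u in (0 : ℝ)..x.1.2, g u))
  have hΦ : Measurable Φ := by
    have h1 : Measurable fun x : (ℝ × ℝ) × ℝ => x.1.2 + x.2 := by fun_prop
    have h2 : Measurable fun x : (ℝ × ℝ) × ℝ => x.1.2 := by fun_prop
    exact (measurable_fst.comp measurable_fst).mul
      ((hg.comp h1).sub ((hG.comp h1).sub (hG.comp h2)))
  have hpair : Measurable fun ω => (u ω, prevPoint τ n ω) := hu.prodMk (h.measurable_prevPoint n)
  have heq : (fun ω => u ω * compensatedPoint τ g n ω) =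
      fun ω => Φ ((u ω, prevPoint τ n ω), pointGap τ n ω) := by
    ext ω
    simp only [Φ, prevPoint_add_pointGap,
      intervalIntegral.integral_interval_sub_left (hi _ _) (hi _ _), compensatedPoint]
  have := isProbabilityMeasure_expMeasure one_pos
  have hmap := (indepFun_iff_map_prod_eq_prod_map_map hpair.aemeasurable
    (h.measurable_pointGap n).aemeasurable).1 hind
  rw [h.map_pointGap] at hmap
  have hprod : Measurable fun ω => ((u ω, prevPoint τ n ω), pointGap τ n ω) :=
    hpair.prodMk (h.measurable_pointGap n)
  have : IsProbabilityMeasure (μ.map fun ω => (u ω, prevPoint τ n ω)) :=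
    Measure.isProbabilityMeasure_map hpair.aemeasurable
  have hΦi : Integrable Φ ((μ.map fun ω => (u ω, prevPoint τ n ω)).prod (expMeasure 1)) := by
    rw [← hmap, integrable_map_measure hΦ.aestronglyMeasurable hprod.aemeasurable]
    rw [heq] at hint
    exact hint
  rw [heq, ← integral_map (φ := fun ω => ((u ω, prevPoint τ n ω), pointGap τ n ω))
    hprod.aemeasurable hΦ.aestronglyMeasurable, hmap, integral_prod _ hΦi]
  refine integral_eq_zero_of_ae (Eventually.of_forall fun x => ?_)
  obtain ⟨y, a⟩ := x
  have hga : Measurable fun e => g (a + e) := hg.comp (measurable_const.add measurable_id)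
  have hia := intervalIntegrable_of_mem_Icc hga fun t => h01 (a + t)
  have hga_int : Integrable (fun e => g (a + e)) (expMeasure 1) :=
    Integrable.of_bound hga.aestronglyMeasurable 1 (Eventually.of_forall fun e => by
      simpa [abs_of_nonneg (h01 (a + e)).1] using (h01 (a + e)).2)
  have hGa : ∀ e, (∫ u in (0 : ℝ)..(a + e), g u) - ∫ u in (0 : ℝ)..a, g u =
      ∫ u in (0 : ℝ)..e, g (a + u) := by
    intro e
    rw [intervalIntegral.integral_interval_sub_left (hi _ _) (hi _ _),
      intervalIntegral.integral_comp_add_left]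
    simp
  have hGa_int : Integrable (fun e => ∫ u in (0 : ℝ)..e, g (a + u)) (expMeasure 1) := by
    refine (memLp_id_expMeasure_one.integrable (by norm_num)).mono
      (intervalIntegral.continuous_primitive hia 0).aestronglyMeasurable
      (Eventually.of_forall fun e => ?_)
    simpa using abs_integral_le_of_mem_Icc (fun t => h01 (a + t)) 0 e
  simp only [Φ, hGa, Pi.zero_apply]
  rw [integral_const_mul, integral_sub hga_int hGa_int,
    integral_integral_expMeasure_one hga (fun t => (h01 _).1) hia, sub_self, mul_zero]

/-- Anything computed from the first `n` gaps is independent of the gap number `n`. -/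
theorem indepFun_pointGap (h : IsUnitPoisson μ τ) (n : ℕ) {E : Type*} [MeasurableSpace E]
    {ψ : (ℕ → ℝ) → E} (hψ : Measurable ψ) :
    IndepFun (fun ω => ψ fun i => if i < n then pointGap τ i ω else 0) (pointGap τ n) μ := by
  have h1 := h.iIndepFun_pointGap.indepFun_finset (Finset.range n) {n} (by simp)
    h.measurable_pointGap
  let e : (Finset.range n → ℝ) → ℕ → ℝ := fun v i =>
    if hi : i ∈ Finset.range n then v ⟨i, hi⟩ else 0
  have he : Measurable e := by
    refine measurable_pi_iff.2 fun i => ?_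
    by_cases hi : i ∈ Finset.range n
    · simp only [e, hi, dite_true]; fun_prop
    · simp only [e, hi, dite_false]; fun_prop
  have h2 := h1.comp (hψ.comp he)
    (measurable_pi_apply (⟨n, Finset.mem_singleton_self n⟩ : ({n} : Finset ℕ)))
  convert h2 using 1
  · ext ω
    simp [e, Function.comp_def]
  · rfl

theorem integral_compensatedPoint (h : IsUnitPoisson μ τ) (hg : Measurable g)
    (h01 : ∀ t, g t ∈ Set.Icc (0 : ℝ) 1) (n : ℕ) : ∫ ω, compensatedPoint τ g n ω ∂μ = 0 := by
  have hind := h.indepFun_pointGap n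
    (ψ := fun v => ((1 : ℝ), ∑ i ∈ Finset.range n, v i)) (by fun_prop)
  have h1 := h.integral_mul_compensatedPoint hg h01 n (u := fun _ => 1) measurable_const
    (by
      convert hind using 3 with ω
      exact Finset.sum_congr rfl fun i hi => by simp [Finset.mem_range.1 hi])
    (by simpa using (h.memLp_compensatedPoint hg h01 n).integrable (by norm_num))
  simpa using h1

theorem integral_compensatedPoint_mul (h : IsUnitPoisson μ τ) (hg : Measurable g)
    (h01 : ∀ t, g t ∈ Set.Icc (0 : ℝ) 1) {j n : ℕ} (hjn : j < n) :
    ∫ ω, compensatedPoint τ g j ω * compensatedPoint τ g n ω ∂μ = 0 := by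
  -- the factor number `j` is a function of the gaps up to `j`
  have hi := intervalIntegrable_of_mem_Icc hg h01
  have hG : Measurable fun e => ∫ u in (0 : ℝ)..e, g u :=
    (intervalIntegral.continuous_primitive hi 0).measurable
  have hs : ∀ j, Measurable fun v : ℕ → ℝ => ∑ i ∈ Finset.range j, v i := fun j => by fun_prop
  have hind := h.indepFun_pointGap n
    (ψ := fun v => (g (∑ i ∈ Finset.range (j + 1), v i) -
      ((∫ u in (0 : ℝ)..(∑ i ∈ Finset.range (j + 1), v i), g u) -
        ∫ u in (0 : ℝ)..(∑ i ∈ Finset.range j, v i), g u), ∑ i ∈ Finset.range n, v i))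
    (((hg.comp (hs _)).sub ((hG.comp (hs _)).sub (hG.comp (hs _)))).prodMk (hs n))
  refine h.integral_mul_compensatedPoint hg h01 n (h.measurable_compensatedPoint hg h01 j) ?_
    ((h.memLp_compensatedPoint hg h01 j).integrable_mul (h.memLp_compensatedPoint hg h01 n))
  have hsum : ∀ ω, ∀ k ≤ n, ∑ i ∈ Finset.range k, (if i < n then pointGap τ i ω else 0) =
      prevPoint τ k ω := fun ω k hk => Finset.sum_congr rfl fun i hi => by
        simp [(Finset.mem_range.1 hi).trans_le hk]
  convert hind using 2 with ω
  rw [hsum ω _ le_rfl, hsum ω _ hjn, hsum ω _ hjn.le, prevPoint_succ, compensatedPoint,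
    intervalIntegral.integral_interval_sub_left (hi _ _) (hi _ _)]

theorem integral_sum_compensatedPoint_sq_le (h : IsUnitPoisson μ τ) (hg : Measurable g)
    (h01 : ∀ t, g t ∈ Set.Icc (0 : ℝ) 1) (n : ℕ) :
    ∫ ω, (∑ i ∈ Finset.range n, compensatedPoint τ g i ω) ^ 2 ∂μ ≤ n * 6 :=
  integral_sq_sum_le_of_orthogonal (h.memLp_compensatedPoint hg h01)
    (fun _ _ hjk => h.integral_compensatedPoint_mul hg h01 hjk)
    (h.integral_compensatedPoint_sq_le hg h01) n

/-- Sampling a `[0, 1]`-valued function at the first `n` Poisson points approximates its integral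
over `[0, n]`, uniformly over all such functions: the error is a martingale, apart from the integral
between the last point and `n`.  That is at most the distance of the two, which is the martingale of
the constant function `1`. -/
theorem lintegral_sum_sub_integral_sq_le (h : IsUnitPoisson μ τ) (hg : Measurable g)
    (h01 : ∀ t, g t ∈ Set.Icc (0 : ℝ) 1) (n : ℕ) :
    ∫⁻ ω, ENNReal.ofReal ((∑ i ∈ Finset.range n, g (τ i ω) - ∫ u in (0 : ℝ)..n, g u) ^ 2) ∂μ ≤
      ENNReal.ofReal (n * 24) := by
  have hi := intervalIntegrable_of_mem_Icc hg h01
  have h1g : ∀ t : ℝ, (fun _ : ℝ => (1 : ℝ)) t ∈ Set.Icc (0 : ℝ) 1 := by simp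
  have hm : ∀ {g : ℝ → ℝ}, Measurable g → (∀ t, g t ∈ Set.Icc (0 : ℝ) 1) →
      MemLp (fun ω => ∑ i ∈ Finset.range n, compensatedPoint τ g i ω) 2 μ :=
    fun hg h01 => memLp_finsetSum _ fun k _ => h.memLp_compensatedPoint hg h01 k
  have hb : ∀ ω, (∑ i ∈ Finset.range n, g (τ i ω) - ∫ u in (0 : ℝ)..n, g u) ^ 2 ≤
      2 * (∑ i ∈ Finset.range n, compensatedPoint τ g i ω) ^ 2 +
      2 * (∑ i ∈ Finset.range n, compensatedPoint τ (fun _ => 1) i ω) ^ 2 := by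
    intro ω
    rw [sum_compensatedPoint hi, sum_compensatedPoint (by simp)]
    have h3 := abs_integral_le_of_mem_Icc h01 n (prevPoint τ n ω)
    rw [← intervalIntegral.integral_interval_sub_left (hi 0 _) (hi 0 _)] at h3
    simp only [Finset.sum_const, Finset.card_range, nsmul_eq_mul, mul_one,
      intervalIntegral.integral_const, sub_zero, smul_eq_mul]
    have h4 := sq_le_sq.2 h3
    nlinarith [sq_nonneg ((∑ i ∈ Finset.range n, g (τ i ω) -
      ∫ u in (0 : ℝ)..prevPoint τ n ω, g u) -
      ((∫ u in (0 : ℝ)..prevPoint τ n ω, g u) - ∫ u in (0 : ℝ)..n, g u))]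
  have hI : Integrable (fun ω => 2 * (∑ i ∈ Finset.range n, compensatedPoint τ g i ω) ^ 2 +
      2 * (∑ i ∈ Finset.range n, compensatedPoint τ (fun _ => 1) i ω) ^ 2) μ :=
    ((hm hg h01).integrable_sq.const_mul 2).add
      ((hm measurable_const h1g).integrable_sq.const_mul 2)
  refine (lintegral_mono fun ω => ENNReal.ofReal_le_ofReal (hb ω)).trans ?_
  rw [← ofReal_integral_eq_lintegral_ofReal hI (Eventually.of_forall fun ω => by positivity)]
  refine ENNReal.ofReal_le_ofReal ?_
  rw [integral_add ((hm hg h01).integrable_sq.const_mul 2)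
    ((hm measurable_const h1g).integrable_sq.const_mul 2), integral_const_mul, integral_const_mul]
  linarith [h.integral_sum_compensatedPoint_sq_le hg h01 n,
    h.integral_sum_compensatedPoint_sq_le measurable_const h1g n]

/-- The expected number of points up to time `t` is at most `t`: this is the compensation of the
indicator of `(-∞, t]`. -/
theorem sum_measureReal_le (h : IsUnitPoisson μ τ) {t : ℝ} (ht : 0 ≤ t) (n : ℕ) :
    ∑ i ∈ Finset.range n, μ.real {ω | τ i ω ≤ t} ≤ t := by
  let g : ℝ → ℝ := (Set.Iic t).indicator fun _ => 1
  have hg : Measurable g := measurable_const.indicator measurableSet_Iic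
  have h01 : ∀ s, g s ∈ Set.Icc (0 : ℝ) 1 := by
    intro s; by_cases hs : s ≤ t <;> simp [g, hs]
  have hi := intervalIntegrable_of_mem_Icc hg h01
  have hgi : ∀ i, Integrable (fun ω => g (τ i ω)) μ := fun i =>
    Integrable.of_bound (hg.comp (h.measurable i)).aestronglyMeasurable 1
      (Eventually.of_forall fun e => by
        simpa [abs_of_nonneg (h01 (τ i e)).1] using (h01 (τ i e)).2)
  have h1 : ∀ i, μ.real {ω | τ i ω ≤ t} = ∫ ω, g (τ i ω) ∂μ := by
    intro i
    rw [← integral_indicator_one (measurableSet_le (h.measurable i) measurable_const)]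
    rfl
  have hc : Integrable (fun ω => ∑ i ∈ Finset.range n, compensatedPoint τ g i ω) μ :=
    integrable_finsetSum _ fun i _ => (h.memLp_compensatedPoint hg h01 i).integrable (by norm_num)
  have hle : ∀ ω, ∑ i ∈ Finset.range n, g (τ i ω) ≤
      ∑ i ∈ Finset.range n, compensatedPoint τ g i ω + t := by
    intro ω
    rw [sum_compensatedPoint hi]
    suffices H : ∫ u in (0 : ℝ)..prevPoint τ n ω, g u ≤ t by linarith
    by_cases hp : prevPoint τ n ω ≤ t
    · rcases le_total 0 (prevPoint τ n ω) with h0 | h0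
      · refine ((le_abs_self _).trans (abs_integral_le_of_mem_Icc h01 _ _)).trans ?_
        rwa [sub_zero, abs_of_nonneg h0]
      · rw [intervalIntegral.integral_symm]
        linarith [intervalIntegral.integral_nonneg (μ := volume) h0 fun u _ => (h01 u).1]
    · have hz : ∫ u in t..prevPoint τ n ω, g u = 0 := by
        refine intervalIntegral.integral_zero_ae (Eventually.of_forall fun u hu => ?_)
        rw [Set.uIoc_of_le (not_le.1 hp).le] at hu
        simp [g, hu.1]
      rw [← intervalIntegral.integral_add_adjacent_intervals (hi 0 t) (hi t _), hz, add_zero]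
      refine ((le_abs_self _).trans (abs_integral_le_of_mem_Icc h01 _ _)).trans ?_
      rw [sub_zero, abs_of_nonneg ht]
  rw [Finset.sum_congr rfl fun i _ => h1 i, ← integral_finsetSum _ fun i _ => hgi i]
  refine (integral_mono (integrable_finsetSum _ fun i _ => hgi i)
    (hc.add (integrable_const t)) hle).trans ?_
  simp only [Pi.add_apply]
  rw [integral_add hc (integrable_const t),
    integral_finsetSum _ fun i _ => (h.memLp_compensatedPoint hg h01 i).integrable (by norm_num),
    Finset.sum_eq_zero fun i _ => h.integral_compensatedPoint hg h01 i]
  simp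

/-- The increments of the points after the point number `m` have the same joint law for all
`m`. -/
theorem map_increments_eq (h : IsUnitPoisson μ τ) (m : ℕ) :
    μ.map (fun ω j => τ (m + j) ω - τ m ω) = μ.map (fun ω j => τ j ω - τ 0 ω) := by
  have := isProbabilityMeasure_expMeasure one_pos
  have hlaw : ∀ m, μ.map (fun ω j => pointGap τ (m + 1 + j) ω) =
      Measure.infinitePi fun _ : ℕ => expMeasure 1 := by
    intro m
    rw [(iIndepFun_iff_map_fun_eq_infinitePi_map fun j => h.measurable_pointGap (m + 1 + j)).1
      (h.iIndepFun_pointGap.precomp (add_right_injective (m + 1)))]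
    simp_rw [h.map_pointGap]
  let ψ : (ℕ → ℝ) → ℕ → ℝ := fun v j => ∑ i ∈ Finset.range j, v i
  have hψ : Measurable ψ := by
    refine measurable_pi_iff.2 fun j => ?_
    simp only [ψ]; fun_prop
  have heq : ∀ m, (fun ω j => τ (m + j) ω - τ m ω) = ψ ∘ fun ω j => pointGap τ (m + 1 + j) ω := by
    intro m
    ext ω j
    simp only [ψ, Function.comp]
    rw [← sum_pointGap τ, ← sum_pointGap τ, show m + j + 1 = (m + 1) + j by ring,
      Finset.sum_range_add]
    ring
  have hmeas : ∀ m, Measurable fun ω j => pointGap τ (m + 1 + j) ω := fun m =>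
    measurable_pi_iff.2 fun j => h.measurable_pointGap _
  have key : ∀ m, μ.map (fun ω j => τ (m + j) ω - τ m ω) =
      (Measure.infinitePi fun _ : ℕ => expMeasure 1).map ψ := by
    intro m
    rw [heq, ← Measure.map_map hψ (hmeas m), hlaw]
  have h0 := key 0
  simp only [zero_add] at h0
  rw [key m, h0]

end IsUnitPoisson

end Poisson

/-! ### Jump paths and the transitions of a semi-Markov process -/

/-- A measure is the sum of its restrictions to the fibres of a variable with finitely many
values. -/
theorem sum_restrict_fiber {Ω ι : Type*} [MeasurableSpace Ω] (μ : Measure Ω) [Fintype ι]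
    [MeasurableSpace ι] [MeasurableSingletonClass ι] {Y : Ω → ι} (hY : Measurable Y) :
    ∑ y, μ.restrict {ω | Y ω = y} = μ := by
  ext s hs
  rw [Measure.finsetSum_apply]
  have h1 : ∀ y, μ.restrict {ω | Y ω = y} s = μ (s ∩ Y ⁻¹' {y}) := fun y =>
    Measure.restrict_apply hs
  simp_rw [h1]
  have h2 := measure_biUnion_finset (μ := μ) (s := Finset.univ) (f := fun y => s ∩ Y ⁻¹' {y})
    (fun y _ z _ hyz => by
      refine Set.disjoint_left.2 fun ω h1 h2 => hyz ?_
      exact h1.2.symm.trans h2.2)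
    (fun y _ => hs.inter (hY (measurableSet_singleton y)))
  rw [← h2]
  congr 1
  ext ω
  simp

section JumpPath

variable {S : Type*}

theorem jumpPath_eq {T : ℕ → ℝ} {X : ℕ → S} (hT : StrictMono T) {n : ℕ} {t : ℝ} (h1 : T n ≤ t)
    (h2 : t < T (n + 1)) : jumpPath T X t = X n := by
  have : IsGreatest {k : ℕ | T k ≤ t} n :=
    ⟨h1, fun k hk => Nat.lt_succ_iff.1 (hT.lt_iff_lt.1 (lt_of_le_of_lt hk h2))⟩
  rw [jumpPath, this.csSup_eq]

/-- The supremum of a set of natural numbers is a maximum or, for empty or unbounded sets, the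
default value `0`. -/
theorem Nat.sSup_eq_iff (A : Set ℕ) (n : ℕ) : sSup A = n ↔
    (n ∈ A ∧ ∀ m, m ∈ A → m ≤ n) ∨ (n = 0 ∧ ((∀ m, m ∉ A) ∨ ∀ k, ∃ m, m ∈ A ∧ k < m)) := by
  by_cases hb : BddAbove A
  · rcases Set.eq_empty_or_nonempty A with rfl | hne
    · simp [eq_comm]
    · constructor
      · rintro rfl
        exact Or.inl ⟨Nat.sSup_mem hne hb, fun m hm => le_csSup hb hm⟩
      · rintro (⟨h1, h2⟩ | ⟨-, h | h⟩)
        · exact IsGreatest.csSup_eq ⟨h1, h2⟩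
        · exact absurd hne.some_mem (h _)
        · obtain ⟨b, hb⟩ := hb
          obtain ⟨m, hm, hlt⟩ := h b
          exact absurd (hb hm) (not_le.2 hlt)
  · rw [Nat.sSup_of_not_bddAbove hb]
    constructor
    · rintro rfl
      refine Or.inr ⟨rfl, Or.inr fun k => ?_⟩
      by_contra! h
      exact hb ⟨k, fun m hm => h m hm⟩
    · rintro (⟨-, h2⟩ | ⟨h, -⟩)
      · exact absurd ⟨n, fun m hm => h2 m hm⟩ hb
      · exact h.symm

/-- The value of a jump path is a measurable function of the path and of time. -/
theorem measurable_jumpPath [MeasurableSpace S] :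
    Measurable fun x : (ℕ → ℝ × S) × ℝ =>
      jumpPath (fun n => (x.1 n).1) (fun n => (x.1 n).2) x.2 := by
  have hN : Measurable fun x : (ℕ → ℝ × S) × ℝ => sSup {n : ℕ | (x.1 n).1 ≤ x.2} := by
    refine measurable_to_countable' fun n => ?_
    have hmem : ∀ m, MeasurableSet {x : (ℕ → ℝ × S) × ℝ | (x.1 m).1 ≤ x.2} := fun m =>
      measurableSet_le (by fun_prop) (by fun_prop)
    let A : ℕ → Set ((ℕ → ℝ × S) × ℝ) := fun m => {x | (x.1 m).1 ≤ x.2}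
    have h1 : (fun x : (ℕ → ℝ × S) × ℝ => sSup {n : ℕ | (x.1 n).1 ≤ x.2}) ⁻¹' {n} =
        (A n ∩ ⋂ m, (A m)ᶜ ∪ {_x | m ≤ n}) ∪
          ({_x | n = 0} ∩ ((⋂ m, (A m)ᶜ) ∪ ⋂ k, ⋃ m, A m ∩ {_x | k < m})) := by
      ext x
      refine (Nat.sSup_eq_iff {n : ℕ | (x.1 n).1 ≤ x.2} n).trans ?_
      simp only [A, Set.mem_union, Set.mem_inter_iff, Set.mem_iInter, Set.mem_iUnion,
        Set.mem_compl_iff, Set.mem_ofPred_eq, imp_iff_not_or]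
    rw [h1]
    have hA : ∀ m, MeasurableSet (A m) := hmem
    exact ((hA n).inter (.iInter fun m => (hA m).compl.union (.const _))).union
      ((MeasurableSet.const _).inter ((MeasurableSet.iInter fun m => (hA m).compl).union
        (.iInter fun k => .iUnion fun m => (hA m).inter (.const _))))
  have hf : Measurable fun y : ((ℕ → ℝ × S) × ℝ) × ℕ => (y.1.1 y.2).2 :=
    measurable_from_prod_countable_left fun n =>
      ((measurable_pi_apply n).comp measurable_fst).snd
  exact hf.comp (measurable_id.prodMk hN)

end JumpPath

namespace IsStationarySemiMarkov

variable {Ω : Type*} [MeasurableSpace Ω] {μ : Measure Ω} [IsProbabilityMeasure μ] {M : ℕ}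
  {p : Matrix (Fin M) (Fin M) ℝ} {F : Fin M → Fin M → Measure ℝ}
  {T : ℕ → Ω → ℝ} {X : ℕ → Ω → Fin M}

/-- Given the history up to the jump number `k` and the current state `r`, the next state and the
sojourn time have the law `p r s * F r s`. -/
theorem map_restrict (h : IsStationarySemiMarkov μ p F T X) {k : ℕ} (hk : 1 ≤ k) (r s : Fin M) :
    (μ.restrict {ω | X k ω = r ∧ X (k + 1) ω = s}).map
      (fun ω => ((fun i : Fin (k + 1) => (T i ω, X i ω)), T (k + 1) ω - T k ω)) =
    ((μ.restrict {ω | X k ω = r}).map fun ω (i : Fin (k + 1)) => (T i ω, X i ω)).prod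
      (ENNReal.ofReal (p r s) • F r s) := by
  have := h.sojourn_prob r s
  have hT := h.measurable_T
  have hX := h.measurable_X
  have hH : Measurable fun ω (i : Fin (k + 1)) => (T i ω, X i ω) :=
    measurable_pi_iff.2 fun i => (hT i).prodMk (hX i)
  have hU : Measurable fun ω => T (k + 1) ω - T k ω := (hT _).sub (hT _)
  have hr : ∀ j r, MeasurableSet {ω | X j ω = r} := fun j r => hX j (measurableSet_singleton r)
  have : SigmaFinite (ENNReal.ofReal (p r s) • F r s) := by
    have : IsFiniteMeasure (ENNReal.ofReal (p r s) • F r s) :=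
      Measure.smul_finite _ ENNReal.ofReal_ne_top
    infer_instance
  symm
  refine Measure.prod_eq fun A B hA hB => ?_
  rw [Measure.map_apply (hH.prodMk hU) (hA.prod hB), Measure.map_apply hH hA,
    Measure.restrict_apply ((hH.prodMk hU) (hA.prod hB)), Measure.restrict_apply (hH hA),
    Measure.smul_apply, smul_eq_mul]
  convert h.markov k hk A hA r s B hB using 2
  · ext ω
    simp only [Set.mem_inter_iff, Set.mem_preimage, Set.mem_prod, Set.mem_ofPred_eq]
    tauto
  · rfl

theorem integral_restrict_mul (h : IsStationarySemiMarkov μ p F T X) {k : ℕ} (hk : 1 ≤ k)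
    (r s : Fin M) {z : (Fin (k + 1) → ℝ × Fin M) → ℝ} (hz : Measurable z) {g : ℝ → ℝ}
    (hg : Measurable g) :
    ∫ ω in {ω | X k ω = r ∧ X (k + 1) ω = s},
        z (fun i => (T i ω, X i ω)) * g (T (k + 1) ω - T k ω) ∂μ =
      (∫ ω in {ω | X k ω = r}, z (fun i => (T i ω, X i ω)) ∂μ) * (p r s * ∫ u, g u ∂F r s) := by
  have := h.sojourn_prob r s
  have hT := h.measurable_T
  have hX := h.measurable_X
  have hH : Measurable fun ω (i : Fin (k + 1)) => (T i ω, X i ω) :=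
    measurable_pi_iff.2 fun i => (hT i).prodMk (hX i)
  have hU : Measurable fun ω => T (k + 1) ω - T k ω := (hT _).sub (hT _)
  have : SigmaFinite (ENNReal.ofReal (p r s) • F r s) := by
    have : IsFiniteMeasure (ENNReal.ofReal (p r s) • F r s) :=
      Measure.smul_finite _ ENNReal.ofReal_ne_top
    infer_instance
  have hm : Measurable fun x : (Fin (k + 1) → ℝ × Fin M) × ℝ => z x.1 * g x.2 :=
    (hz.comp measurable_fst).mul (hg.comp measurable_snd)
  have h1 := integral_map (μ := μ.restrict {ω | X k ω = r ∧ X (k + 1) ω = s})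
    (φ := fun ω => ((fun i : Fin (k + 1) => (T i ω, X i ω)), T (k + 1) ω - T k ω))
    (hH.prodMk hU).aemeasurable hm.aestronglyMeasurable
  rw [← h1, h.map_restrict hk, integral_prod_mul, integral_map hH.aemeasurable
    hz.aestronglyMeasurable, integral_smul_measure,
    ENNReal.toReal_ofReal (Matrix.nonneg_of_mem_rowStochastic h.stochastic), smul_eq_mul]

theorem lintegral_restrict (h : IsStationarySemiMarkov μ p F T X) {k : ℕ} (hk : 1 ≤ k)
    (r s : Fin M) {g : ℝ → ℝ≥0∞} (hg : Measurable g) :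
    ∫⁻ ω in {ω | X k ω = r ∧ X (k + 1) ω = s}, g (T (k + 1) ω - T k ω) ∂μ =
      μ {ω | X k ω = r} * (ENNReal.ofReal (p r s) * ∫⁻ u, g u ∂F r s) := by
  have := h.sojourn_prob r s
  have hT := h.measurable_T
  have hX := h.measurable_X
  have hH : Measurable fun ω (i : Fin (k + 1)) => (T i ω, X i ω) :=
    measurable_pi_iff.2 fun i => (hT i).prodMk (hX i)
  have hU : Measurable fun ω => T (k + 1) ω - T k ω := (hT _).sub (hT _)
  have h1 := lintegral_map (μ := μ.restrict {ω | X k ω = r ∧ X (k + 1) ω = s})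
    (f := fun x : (Fin (k + 1) → ℝ × Fin M) × ℝ => g x.2)
    (g := fun ω => ((fun i : Fin (k + 1) => (T i ω, X i ω)), T (k + 1) ω - T k ω))
    (hg.comp measurable_snd) (hH.prodMk hU)
  have : SFinite (ENNReal.ofReal (p r s) • F r s) := by
    have : IsFiniteMeasure (ENNReal.ofReal (p r s) • F r s) :=
      Measure.smul_finite _ ENNReal.ofReal_ne_top
    infer_instance
  rw [← h1, h.map_restrict hk, lintegral_prod _ (by fun_prop)]
  simp only [lintegral_const, lintegral_smul_measure, smul_eq_mul]
  rw [Measure.map_apply hH .univ, Set.preimage_univ, Measure.restrict_apply .univ, Set.univ_inter,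
    mul_comm]

/-- A function of a sojourn time has a mean bounded by the sum of its means over all sojourn
laws. -/
theorem lintegral_sojourn_le (h : IsStationarySemiMarkov μ p F T X) {k : ℕ} (hk : 1 ≤ k)
    {g : ℝ → ℝ≥0∞} (hg : Measurable g) :
    ∫⁻ ω, g (T (k + 1) ω - T k ω) ∂μ ≤ ∑ r, ∑ s, ∫⁻ u, g u ∂F r s := by
  have hX := h.measurable_X
  rw [← sum_restrict_fiber μ ((hX k).prodMk (hX (k + 1))), lintegral_finsetSum_measure,
    Fintype.sum_prod_type]
  refine Finset.sum_le_sum fun r _ => Finset.sum_le_sum fun s _ => ?_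
  have h2 := h.lintegral_restrict hk r s hg
  simp only [Prod.mk.injEq]
  rw [h2]
  have h3 : ENNReal.ofReal (p r s) ≤ 1 := by
    simpa using Matrix.le_one_of_mem_rowStochastic h.stochastic
  calc _ ≤ 1 * (1 * ∫⁻ u, g u ∂F r s) := by gcongr; exact prob_le_one
    _ = _ := by simp

/-- The mean of `G r s U` over the next state `s` and the sojourn time `U`, from the state `r`. -/
noncomputable def stepMean (p : Matrix (Fin M) (Fin M) ℝ) (F : Fin M → Fin M → Measure ℝ)
    (G : Fin M → Fin M → ℝ → ℝ) (r : Fin M) : ℝ := ∑ s, p r s * ∫ u, G r s u ∂F r s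

/-- Given the history up to the jump number `k`, the mean of a function of the transition number
`k` is its `stepMean` at the current state. -/
theorem integral_mul_step (h : IsStationarySemiMarkov μ p F T X) {k : ℕ} (hk : 1 ≤ k)
    {z : (Fin (k + 1) → ℝ × Fin M) → ℝ} (hz : Measurable z) {B C : ℝ} (hzB : ∀ v, |z v| ≤ B)
    {G : Fin M → Fin M → ℝ → ℝ} (hG : ∀ r s, Measurable (G r s)) (hGC : ∀ r s u, |G r s u| ≤ C) :
    ∫ ω, z (fun i => (T i ω, X i ω)) * G (X k ω) (X (k + 1) ω) (T (k + 1) ω - T k ω) ∂μ =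
      ∫ ω, z (fun i => (T i ω, X i ω)) * stepMean p F G (X k ω) ∂μ := by
  have hT := h.measurable_T
  have hX := h.measurable_X
  have hH : Measurable fun ω (i : Fin (k + 1)) => (T i ω, X i ω) :=
    measurable_pi_iff.2 fun i => (hT i).prodMk (hX i)
  have hU : Measurable fun ω => T (k + 1) ω - T k ω := (hT _).sub (hT _)
  have hr : ∀ j r, MeasurableSet {ω | X j ω = r} := fun j r => hX j (measurableSet_singleton r)
  have hGm : Measurable fun y : ℝ × (Fin M × Fin M) => G y.2.1 y.2.2 y.1 :=
    measurable_from_prod_countable_left fun rs => hG rs.1 rs.2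
  have hGω : Measurable fun ω => G (X k ω) (X (k + 1) ω) (T (k + 1) ω - T k ω) :=
    hGm.comp (hU.prodMk ((hX k).prodMk (hX (k + 1))))
  have hzω : Measurable fun ω => z (fun i => (T i ω, X i ω)) := hz.comp hH
  have hB : 0 ≤ B := by
    have : Nonempty Ω := μ.nonempty_of_neZero
    exact (abs_nonneg _).trans
      (hzB fun i => (T i (Classical.arbitrary Ω), X i (Classical.arbitrary Ω)))
  have hmulm : Measurable fun ω => z (fun i => (T i ω, X i ω)) *
      G (X k ω) (X (k + 1) ω) (T (k + 1) ω - T k ω) := hzω.mul hGω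
  have hint1 : Integrable (fun ω => z (fun i => (T i ω, X i ω)) *
      G (X k ω) (X (k + 1) ω) (T (k + 1) ω - T k ω)) μ :=
    Integrable.of_bound hmulm.aestronglyMeasurable (B * C) (Eventually.of_forall fun ω => by
      rw [norm_mul]
      exact mul_le_mul (hzB _) (hGC _ _ _) (norm_nonneg _) hB)
  have hint2 : Integrable (fun ω => z (fun i => (T i ω, X i ω)) * stepMean p F G (X k ω)) μ := by
    obtain ⟨C', hC'⟩ := (Set.finite_range fun r => |stepMean p F G r|).bddAbove
    have hm : Measurable fun ω => stepMean p F G (X k ω) :=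
      (measurable_of_countable (stepMean p F G)).comp (hX k)
    refine Integrable.of_bound (hzω.mul hm).aestronglyMeasurable (B * C')
      (Eventually.of_forall fun ω => ?_)
    refine (norm_mul _ _).trans_le ?_
    exact mul_le_mul (hzB _) (hC' ⟨X k ω, rfl⟩) (norm_nonneg _) hB
  -- split according to the current and the next state
  conv_lhs => rw [← sum_restrict_fiber μ ((hX k).prodMk (hX (k + 1)))]
  rw [integral_finsetSum_measure fun i _ => hint1.restrict, Fintype.sum_prod_type]
  conv_rhs => rw [← sum_restrict_fiber μ (hX k)]
  rw [integral_finsetSum_measure fun i _ => hint2.restrict]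
  refine Finset.sum_congr rfl fun r _ => ?_
  have h1 : ∫ ω in {ω | X k ω = r}, z (fun i => (T i ω, X i ω)) * stepMean p F G (X k ω) ∂μ =
      ∫ ω in {ω | X k ω = r}, z (fun i => (T i ω, X i ω)) * stepMean p F G r ∂μ :=
    setIntegral_congr_fun (hr k r) fun ω (hω : X k ω = r) => by simp only [hω]
  rw [h1, integral_mul_const, stepMean, Finset.mul_sum]
  refine Finset.sum_congr rfl fun s _ => ?_
  rw [← h.integral_restrict_mul hk r s hz (hG r s)]
  simp only [Prod.mk.injEq]
  exact setIntegral_congr_fun ((hr k r).inter (hr (k + 1) s))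
    fun ω (hω : X k ω = r ∧ X (k + 1) ω = s) => by simp only [hω.1, hω.2]

end IsStationarySemiMarkov

/-! ### The law of large numbers for sojourn times -/

/-- Truncation of a sojourn time at the level `L`.  Negative arguments, which have probability zero,
are sent to `0`, so that the values are bounded. -/
noncomputable def trunc (L u : ℝ) : ℝ := max 0 (min u L)

theorem measurable_trunc (L : ℝ) : Measurable (trunc L) := by
  unfold trunc; fun_prop

theorem abs_trunc_le {L : ℝ} (hL : 0 ≤ L) (u : ℝ) : |trunc L u| ≤ L := by
  rw [trunc, abs_of_nonneg (le_max_left _ _)]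
  exact max_le hL (min_le_right _ _)

theorem abs_sub_trunc_le {L : ℝ} (hL : 0 ≤ L) (u : ℝ) : |u - trunc L u| ≤ |u| := by
  unfold trunc
  rcases le_total u L with h | h
  · rw [min_eq_left h]
    rcases le_total 0 u with h0 | h0
    · simp [max_eq_right h0]
    · simp [max_eq_left h0]
  · rw [min_eq_right h, max_eq_right hL, abs_of_nonneg (by linarith), abs_of_nonneg (by linarith)]
    linarith

namespace IsStationarySemiMarkov

variable {Ω : Type*} [MeasurableSpace Ω] {μ : Measure Ω} {M : ℕ}
  {p : Matrix (Fin M) (Fin M) ℝ} {F : Fin M → Fin M → Measure ℝ}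
  {T : ℕ → Ω → ℝ} {X : ℕ → Ω → Fin M}

/-- The total mean mass that truncation at `L` removes from the sojourn laws. -/
noncomputable def truncError (F : Fin M → Fin M → Measure ℝ) (L : ℕ) : ℝ :=
  ∑ r, ∑ s, ∫ u, |u - trunc L u| ∂F r s

theorem integrable_sub_trunc (h : IsStationarySemiMarkov μ p F T X) (r s : Fin M) (L : ℕ) :
    Integrable (fun u => u - trunc L u) (F r s) :=
  (h.sojourn_mean r s).mono (measurable_id.sub (measurable_trunc L)).aestronglyMeasurable
    (Eventually.of_forall fun u => abs_sub_trunc_le (Nat.cast_nonneg L) u)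

theorem integrable_trunc (h : IsStationarySemiMarkov μ p F T X) (r s : Fin M) (L : ℕ) :
    Integrable (fun u => trunc L u) (F r s) := by
  have := (h.sojourn_mean r s).sub (h.integrable_sub_trunc r s L)
  refine this.congr (Eventually.of_forall fun u => ?_)
  simp

theorem tendsto_truncError (h : IsStationarySemiMarkov μ p F T X) :
    Tendsto (truncError F) atTop (𝓝 0) := by
  have h0 : (0 : ℝ) = ∑ _r : Fin M, ∑ _s : Fin M, 0 := by simp
  rw [h0]
  refine tendsto_finsetSum _ fun r _ => tendsto_finsetSum _ fun s _ => ?_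
  rw [← integral_zero ℝ ℝ (μ := F r s)]
  refine tendsto_integral_of_dominated_convergence (fun u => |u|)
    (fun L => ((h.integrable_sub_trunc r s L).abs).aestronglyMeasurable) (h.sojourn_mean r s).abs
    (fun L => Eventually.of_forall fun u => ?_) ?_
  · simpa using abs_sub_trunc_le (Nat.cast_nonneg L) u
  · have hpos : ∀ᵐ u ∂F r s, 0 < u := by
      rw [ae_iff]; simpa [Set.Iic] using h.sojourn_pos r s
    filter_upwards [hpos] with u hu
    refine tendsto_const_nhds.congr' ?_
    filter_upwards [eventually_ge_atTop ⌈u⌉₊] with L hL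
    have h1 : u ≤ L := (Nat.le_ceil u).trans (by exact_mod_cast hL)
    simp [trunc, min_eq_left h1, max_eq_right hu.le]

theorem abs_sum_mul_le (h : IsStationarySemiMarkov μ p F T X) (r : Fin M) {b : Fin M → ℝ} {C : ℝ}
    (hb : ∀ s, |b s| ≤ C) : |∑ s, p r s * b s| ≤ C := by
  have hp : ∀ s, 0 ≤ p r s := fun s => Matrix.nonneg_of_mem_rowStochastic h.stochastic
  calc |∑ s, p r s * b s| ≤ ∑ s, |p r s * b s| := Finset.abs_sum_le_sum_abs _ _
    _ ≤ ∑ s, p r s * C := Finset.sum_le_sum fun s _ => by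
        rw [abs_mul, abs_of_nonneg (hp s)]; exact mul_le_mul_of_nonneg_left (hb s) (hp s)
    _ = C := by
        rw [← Finset.sum_mul, Matrix.sum_row_of_mem_rowStochastic h.stochastic, one_mul]

theorem abs_stepMean_le (h : IsStationarySemiMarkov μ p F T X) {G : Fin M → Fin M → ℝ → ℝ} {C : ℝ}
    (hGC : ∀ r s u, |G r s u| ≤ C) (r : Fin M) : |stepMean p F G r| ≤ C := by
  refine h.abs_sum_mul_le r fun s => ?_
  have := h.sojourn_prob r s
  simpa using norm_integral_le_of_norm_le_const (μ := F r s) (f := G r s) (C := C)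
    (Eventually.of_forall fun u => hGC r s u)

/-- A function `G` of the transition number `k`, that is, of the states before and after it and of
the sojourn time, centered by its mean given the history. -/
noncomputable def stepDiff (p : Matrix (Fin M) (Fin M) ℝ) (F : Fin M → Fin M → Measure ℝ)
    (T : ℕ → Ω → ℝ) (X : ℕ → Ω → Fin M) (G : Fin M → Fin M → ℝ → ℝ) (k : ℕ) (ω : Ω) : ℝ :=
  G (X k ω) (X (k + 1) ω) (T (k + 1) ω - T k ω) - stepMean p F G (X k ω)

theorem abs_stepDiff_le (h : IsStationarySemiMarkov μ p F T X) {G : Fin M → Fin M → ℝ → ℝ} {C : ℝ}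
    (hGC : ∀ r s u, |G r s u| ≤ C) (k : ℕ) (ω : Ω) : |stepDiff p F T X G k ω| ≤ 2 * C := by
  refine (abs_sub _ _).trans ?_
  linarith [hGC (X k ω) (X (k + 1) ω) (T (k + 1) ω - T k ω), h.abs_stepMean_le hGC (X k ω)]

theorem measurable_step (h : IsStationarySemiMarkov μ p F T X) {G : Fin M → Fin M → ℝ → ℝ}
    (hG : ∀ r s, Measurable (G r s)) (k : ℕ) :
    Measurable fun ω => G (X k ω) (X (k + 1) ω) (T (k + 1) ω - T k ω) := by
  have hGm : Measurable fun y : ℝ × (Fin M × Fin M) => G y.2.1 y.2.2 y.1 :=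
    measurable_from_prod_countable_left fun rs => hG rs.1 rs.2
  exact hGm.comp (((h.measurable_T _).sub (h.measurable_T _)).prodMk
    ((h.measurable_X k).prodMk (h.measurable_X (k + 1))))

theorem measurable_stepMean (h : IsStationarySemiMarkov μ p F T X) (G : Fin M → Fin M → ℝ → ℝ)
    (k : ℕ) : Measurable fun ω => stepMean p F G (X k ω) :=
  (measurable_of_countable (stepMean p F G)).comp (h.measurable_X k)

variable [IsProbabilityMeasure μ]

theorem memLp_stepDiff (h : IsStationarySemiMarkov μ p F T X) {G : Fin M → Fin M → ℝ → ℝ} {C : ℝ}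
    (hG : ∀ r s, Measurable (G r s)) (hGC : ∀ r s u, |G r s u| ≤ C) (k : ℕ) :
    MemLp (stepDiff p F T X G k) 2 μ :=
  MemLp.of_bound ((h.measurable_step hG k).sub (h.measurable_stepMean G k)).aestronglyMeasurable
    (2 * C) (Eventually.of_forall fun ω => h.abs_stepDiff_le hGC k ω)

/-- The centered functions of the transitions are orthogonal, as differences of a martingale. -/
theorem integral_stepDiff_mul (h : IsStationarySemiMarkov μ p F T X) {G : Fin M → Fin M → ℝ → ℝ}
    {C : ℝ} (hG : ∀ r s, Measurable (G r s)) (hGC : ∀ r s u, |G r s u| ≤ C) {j k : ℕ}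
    (hjk : j < k) : ∫ ω, stepDiff p F T X G j ω * stepDiff p F T X G k ω ∂μ = 0 := by
  -- `stepDiff j` as a function of the history up to the jump number `k`
  let z : (Fin (k + 1) → ℝ × Fin M) → ℝ := fun v =>
    G (v ⟨j, by omega⟩).2 (v ⟨j + 1, by omega⟩).2 ((v ⟨j + 1, by omega⟩).1 - (v ⟨j, by omega⟩).1) -
      stepMean p F G (v ⟨j, by omega⟩).2
  have hz : Measurable z := by
    have hGm : Measurable fun y : ℝ × (Fin M × Fin M) => G y.2.1 y.2.2 y.1 :=
      measurable_from_prod_countable_left fun rs => hG rs.1 rs.2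
    have hm := measurable_of_countable (stepMean p F G)
    have hv : ∀ i : Fin (k + 1), Measurable fun v : Fin (k + 1) → ℝ × Fin M => v i :=
      measurable_pi_apply
    exact (hGm.comp (((hv _).fst.sub (hv _).fst).prodMk ((hv _).snd.prodMk (hv _).snd))).sub
      (hm.comp (hv _).snd)
  have hzB : ∀ v, |z v| ≤ 2 * C := fun v => by
    refine (abs_sub _ _).trans ?_
    linarith [hGC (v ⟨j, by omega⟩).2 (v ⟨j + 1, by omega⟩).2
      ((v ⟨j + 1, by omega⟩).1 - (v ⟨j, by omega⟩).1), h.abs_stepMean_le hGC (v ⟨j, by omega⟩).2]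
  have h1 := h.integral_mul_step (by omega : 1 ≤ k) hz hzB hG hGC
  have hD := h.memLp_stepDiff hG hGC j
  have hGk : MemLp (fun ω => G (X k ω) (X (k + 1) ω) (T (k + 1) ω - T k ω)) 2 μ :=
    MemLp.of_bound (h.measurable_step hG k).aestronglyMeasurable C
      (Eventually.of_forall fun ω => hGC _ _ _)
  have hMk : MemLp (fun ω => stepMean p F G (X k ω)) 2 μ :=
    MemLp.of_bound (h.measurable_stepMean G k).aestronglyMeasurable C
      (Eventually.of_forall fun ω => h.abs_stepMean_le hGC _)
  have h2 : ∀ ω, stepDiff p F T X G j ω * stepDiff p F T X G k ω =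
      stepDiff p F T X G j ω * G (X k ω) (X (k + 1) ω) (T (k + 1) ω - T k ω) -
        stepDiff p F T X G j ω * stepMean p F G (X k ω) := fun ω => mul_sub _ _ _
  simp_rw [h2]
  have hI1 : Integrable (fun ω => stepDiff p F T X G j ω *
      G (X k ω) (X (k + 1) ω) (T (k + 1) ω - T k ω)) μ := hD.integrable_mul hGk
  have hI2 : Integrable (fun ω => stepDiff p F T X G j ω * stepMean p F G (X k ω)) μ :=
    hD.integrable_mul hMk
  rw [integral_sub hI1 hI2, sub_eq_zero]
  exact h1

theorem integral_sum_stepDiff_sq_le (h : IsStationarySemiMarkov μ p F T X)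
    {G : Fin M → Fin M → ℝ → ℝ} {C : ℝ} (hG : ∀ r s, Measurable (G r s))
    (hGC : ∀ r s u, |G r s u| ≤ C) (n : ℕ) :
    ∫ ω, (∑ k ∈ Finset.range n, stepDiff p F T X G (k + 1) ω) ^ 2 ∂μ ≤ n * (2 * C) ^ 2 := by
  refine integral_sq_sum_le_of_orthogonal (fun k => h.memLp_stepDiff hG hGC (k + 1))
    (fun j k hjk => h.integral_stepDiff_mul hG hGC (by omega)) (fun k => ?_) n
  have h1 : ∫ ω, stepDiff p F T X G (k + 1) ω ^ 2 ∂μ ≤ ∫ _, (2 * C) ^ 2 ∂μ :=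
    integral_mono (h.memLp_stepDiff hG hGC (k + 1)).integrable_sq (integrable_const _) fun ω =>
      sq_le_sq' (abs_le.1 (h.abs_stepDiff_le hGC _ ω)).1 (abs_le.1 (h.abs_stepDiff_le hGC _ ω)).2
  simpa using h1

/-- The law of large numbers for sojourn times weighted by a function `a` of the state: the
centered sum is sublinear in mean.  The Poisson equation for the mean weighted sojourn time turns
the sum into a martingale and a bounded term; truncating the sojourn times makes the martingale
square integrable. -/
theorem exists_lintegral_abs_sum_sub_le (h : IsStationarySemiMarkov μ p F T X) (a : Fin M → ℝ) :
    ∃ c : ℝ, ((∀ r, 0 < a r) → 0 < c) ∧ ∀ ε > 0, ∃ B, 0 ≤ B ∧ ∀ n : ℕ,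
      ∫⁻ ω, ENNReal.ofReal |∑ k ∈ Finset.range n,
        (a (X (k + 1) ω) * (T (k + 2) ω - T (k + 1) ω) - c)| ∂μ ≤ ENNReal.ofReal (ε * n + B) := by
  have hΩ : Nonempty Ω := μ.nonempty_of_neZero
  have hM : Nonempty (Fin M) := ⟨X 0 (Classical.arbitrary Ω)⟩
  let m : Fin M → ℝ := fun r => ∑ s, p r s * ∫ u, u ∂F r s
  obtain ⟨c, g, hcg⟩ := exists_poissonEquation h.stochastic h.irreducible fun r => a r * m r
  have hp : ∀ r s, 0 ≤ p r s := fun r s => Matrix.nonneg_of_mem_rowStochastic h.stochastic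
  refine ⟨c, fun ha => ?_, fun ε hε => ?_⟩
  · -- the Poisson equation at a minimum of `g` gives `a r * m r ≤ c`
    obtain ⟨r, hr⟩ := Finite.exists_min g
    have hmean : ∀ s, 0 < ∫ u, u ∂F r s := by
      intro s
      have := h.sojourn_prob r s
      have hpos : ∀ᵐ u ∂F r s, 0 < u := by
        rw [ae_iff]; simpa [Set.Iic] using h.sojourn_pos r s
      rw [integral_pos_iff_support_of_nonneg_ae (hpos.mono fun u hu => hu.le) (h.sojourn_mean r s)]
      have h1 : F r s (Function.support fun u : ℝ => u) = 1 :=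
        (mem_ae_iff_prob_eq_one (measurableSet_support measurable_id)).1 <| by
          filter_upwards [hpos] with u hu using hu.ne'
      rw [h1]; exact one_pos
    have hsum := Matrix.sum_row_of_mem_rowStochastic h.stochastic r
    have hm : 0 < m r := by
      obtain ⟨s, -, hs⟩ : ∃ s ∈ Finset.univ, 0 < p r s :=
        (Finset.sum_pos_iff_of_nonneg fun s _ => hp r s).1 (by rw [hsum]; exact one_pos)
      exact Finset.sum_pos' (fun s _ => mul_nonneg (hp r s) (hmean s).le)
        ⟨s, Finset.mem_univ s, mul_pos hs (hmean s)⟩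
    have hmin : g r ≤ ∑ s, p r s * g s := by
      calc g r = ∑ s, p r s * g r := by rw [← Finset.sum_mul, hsum, one_mul]
        _ ≤ _ := Finset.sum_le_sum fun s _ => mul_le_mul_of_nonneg_left (hr s) (hp r s)
    have := hcg r
    have := mul_pos (ha r) hm
    linarith
  · obtain ⟨A, hA⟩ := (Set.finite_range fun r => |a r|).bddAbove
    obtain ⟨H, hH⟩ := (Set.finite_range fun r => |g r|).bddAbove
    replace hA : ∀ r, |a r| ≤ A := fun r => hA ⟨r, rfl⟩
    replace hH : ∀ r, |g r| ≤ H := fun r => hH ⟨r, rfl⟩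
    have hA0 : 0 ≤ A := (abs_nonneg _).trans (hA (Classical.arbitrary _))
    have hH0 : 0 ≤ H := (abs_nonneg _).trans (hH (Classical.arbitrary _))
    obtain ⟨L, hL⟩ : ∃ L, truncError F L * (2 * A) < ε / 2 := by
      have h1 := h.tendsto_truncError.mul_const (2 * A)
      rw [zero_mul] at h1
      exact (h1.eventually (gt_mem_nhds (half_pos hε))).exists
    have hint0 : ∀ r s, 0 ≤ ∫ u, |u - trunc L u| ∂F r s := fun r s =>
      integral_nonneg fun u => abs_nonneg _
    have ht0 : 0 ≤ truncError F L :=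
      Finset.sum_nonneg fun r _ => Finset.sum_nonneg fun s _ => hint0 r s
    -- the martingale takes the weighted truncated sojourn time with the correction `g` at the next
    -- state
    let G : Fin M → Fin M → ℝ → ℝ := fun r s u => a r * trunc L u + g s
    have hG : ∀ r s, Measurable (G r s) := fun r s =>
      ((measurable_trunc L).const_mul _).add_const _
    have hGC : ∀ r s u, |G r s u| ≤ A * L + H := fun r s u => by
      refine (abs_add_le _ _).trans (add_le_add ?_ (hH s))
      rw [abs_mul]
      exact mul_le_mul (hA r) (abs_trunc_le (Nat.cast_nonneg L) u) (abs_nonneg _) hA0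
    have hmeanG : ∀ r, stepMean p F G r =
        a r * (∑ s, p r s * ∫ u, trunc L u ∂F r s) + ∑ s, p r s * g s := by
      intro r
      rw [stepMean, Finset.mul_sum, ← Finset.sum_add_distrib]
      refine Finset.sum_congr rfl fun s _ => ?_
      have := h.sojourn_prob r s
      simp only [G]
      rw [integral_add ((h.integrable_trunc r s L).const_mul _) (integrable_const _),
        integral_const_mul]
      simp
      ring
    have hmm : ∀ r, |(∑ s, p r s * ∫ u, trunc L u ∂F r s) - m r| ≤ truncError F L := by
      intro r
      simp only [m]
      rw [← Finset.sum_sub_distrib]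
      simp_rw [← mul_sub]
      refine h.abs_sum_mul_le r fun s => ?_
      rw [← integral_sub (h.integrable_trunc r s L) (h.sojourn_mean r s)]
      refine (abs_integral_le_integral_abs).trans ?_
      simp_rw [abs_sub_comm (trunc (L : ℝ) _)]
      exact (Finset.single_le_sum (fun s _ => hint0 r s) (Finset.mem_univ s)).trans
        (Finset.single_le_sum (f := fun r => ∑ s, ∫ u, |u - trunc L u| ∂F r s)
          (fun r _ => Finset.sum_nonneg fun s _ => hint0 r s) (Finset.mem_univ r))
    set C := A * L + H with hC
    -- `|x| ≤ η x ^ 2 + 1 / (4 η)` makes the martingale term sublinear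
    let η : ℝ := ε / (2 * ((2 * C) ^ 2 + 1))
    have hη : 0 < η := by positivity
    have hηC : η * (2 * C) ^ 2 ≤ ε / 2 := by
      simp only [η]
      rw [div_mul_eq_mul_div, div_le_div_iff₀ (by positivity) two_pos]
      nlinarith
    refine ⟨1 / (4 * η) + 2 * H, by positivity, fun n => ?_⟩
    let U : ℕ → Ω → ℝ := fun k ω => T (k + 2) ω - T (k + 1) ω
    let D : Ω → ℝ := fun ω => ∑ k ∈ Finset.range n, stepDiff p F T X G (k + 1) ω
    have hpt : ∀ ω, |∑ k ∈ Finset.range n, (a (X (k + 1) ω) * U k ω - c)| ≤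
        η * D ω ^ 2 + ((∑ k ∈ Finset.range n, A * |U k ω - trunc L (U k ω)|) +
          (1 / (4 * η) + 2 * H + n * (A * truncError F L))) := by
      intro ω
      -- martingale, truncation of the sojourns, truncation of their means, telescoping remainder
      have hdecomp : ∑ k ∈ Finset.range n, (a (X (k + 1) ω) * U k ω - c) =
          D ω + ((∑ k ∈ Finset.range n, a (X (k + 1) ω) * (U k ω - trunc L (U k ω))) +
          ((∑ k ∈ Finset.range n, a (X (k + 1) ω) *
            ((∑ s, p (X (k + 1) ω) s * ∫ u, trunc L u ∂F (X (k + 1) ω) s) - m (X (k + 1) ω))) +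
          (g (X 1 ω) - g (X (n + 1) ω)))) := by
        have htel := Finset.sum_range_sub' (fun k => g (X (k + 1) ω)) n
        simp only [zero_add] at htel
        rw [← htel]
        simp only [D, ← Finset.sum_add_distrib]
        refine Finset.sum_congr rfl fun k _ => ?_
        rw [stepDiff, hmeanG]
        have := hcg (X (k + 1) ω)
        simp only [G, U]
        linarith
      rw [hdecomp]
      have hx : |D ω| ≤ η * D ω ^ 2 + 1 / (4 * η) := by
        have h1 : η * D ω ^ 2 + 1 / (4 * η) - |D ω| = η * (|D ω| - 1 / (2 * η)) ^ 2 := by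
          have := sq_abs (D ω)
          field_simp
          rw [← this]; ring
        have h2 : 0 ≤ η * (|D ω| - 1 / (2 * η)) ^ 2 := by positivity
        linarith
      have hs1 : |∑ k ∈ Finset.range n, a (X (k + 1) ω) * (U k ω - trunc L (U k ω))| ≤
          ∑ k ∈ Finset.range n, A * |U k ω - trunc L (U k ω)| :=
        (Finset.abs_sum_le_sum_abs _ _).trans (Finset.sum_le_sum fun k _ => by
          rw [abs_mul]; exact mul_le_mul_of_nonneg_right (hA _) (abs_nonneg _))
      have hs2 : |∑ k ∈ Finset.range n, a (X (k + 1) ω) *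
            ((∑ s, p (X (k + 1) ω) s * ∫ u, trunc L u ∂F (X (k + 1) ω) s) - m (X (k + 1) ω))| ≤
          n * (A * truncError F L) := by
        refine (Finset.abs_sum_le_sum_abs _ _).trans ?_
        refine (Finset.sum_le_sum (g := fun _ => A * truncError F L) fun k _ => ?_).trans (by simp)
        rw [abs_mul]
        exact mul_le_mul (hA _) (hmm _) (abs_nonneg _) hA0
      have hs3 : |g (X 1 ω) - g (X (n + 1) ω)| ≤ 2 * H := by
        refine (abs_sub _ _).trans ?_
        linarith [hH (X 1 ω), hH (X (n + 1) ω)]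
      refine (abs_add_le _ _).trans ?_
      have := abs_add_le (∑ k ∈ Finset.range n, a (X (k + 1) ω) * (U k ω - trunc L (U k ω)))
        ((∑ k ∈ Finset.range n, a (X (k + 1) ω) *
            ((∑ s, p (X (k + 1) ω) s * ∫ u, trunc L u ∂F (X (k + 1) ω) s) - m (X (k + 1) ω))) +
          (g (X 1 ω) - g (X (n + 1) ω)))
      have := abs_add_le (∑ k ∈ Finset.range n, a (X (k + 1) ω) *
            ((∑ s, p (X (k + 1) ω) s * ∫ u, trunc L u ∂F (X (k + 1) ω) s) - m (X (k + 1) ω)))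
          (g (X 1 ω) - g (X (n + 1) ω))
      linarith
    have hDL : MemLp D 2 μ := memLp_finsetSum _ fun k _ => h.memLp_stepDiff hG hGC (k + 1)
    have hUm : ∀ k, Measurable (U k) := fun k => (h.measurable_T _).sub (h.measurable_T _)
    have hterm : ∀ k, ∫⁻ ω, ENNReal.ofReal (A * |U k ω - trunc L (U k ω)|) ∂μ ≤
        ENNReal.ofReal (A * truncError F L) := by
      intro k
      simp_rw [ENNReal.ofReal_mul hA0]
      have hgm : Measurable fun u : ℝ => ENNReal.ofReal |u - trunc L u| := by
        have := measurable_trunc L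
        fun_prop
      have hgU : Measurable fun ω => ENNReal.ofReal |U k ω - trunc L (U k ω)| := hgm.comp (hUm k)
      rw [lintegral_const_mul _ hgU]
      gcongr
      refine (h.lintegral_sojourn_le (by omega : 1 ≤ k + 1) hgm).trans (le_of_eq ?_)
      rw [truncError,
        ENNReal.ofReal_sum_of_nonneg fun r _ => Finset.sum_nonneg fun s _ => hint0 r s]
      refine Finset.sum_congr rfl fun r _ => ?_
      rw [ENNReal.ofReal_sum_of_nonneg fun s _ => hint0 r s]
      exact Finset.sum_congr rfl fun s _ => (ofReal_integral_eq_lintegral_ofReal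
        (h.integrable_sub_trunc r s L).abs (Eventually.of_forall fun u => abs_nonneg _)).symm
    have hB0 : 0 ≤ 1 / (4 * η) + 2 * H + n * (A * truncError F L) := by positivity
    have hm1 : ∀ k, Measurable fun ω => A * |U k ω - trunc L (U k ω)| := fun k => by
      have := (measurable_trunc L).comp (hUm k)
      exact (((hUm k).sub this).abs).const_mul A
    calc ∫⁻ ω, ENNReal.ofReal |∑ k ∈ Finset.range n, (a (X (k + 1) ω) * U k ω - c)| ∂μ
        ≤ ∫⁻ ω, (ENNReal.ofReal (η * D ω ^ 2) +
          ((∑ k ∈ Finset.range n, ENNReal.ofReal (A * |U k ω - trunc L (U k ω)|)) +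
          ENNReal.ofReal (1 / (4 * η) + 2 * H + n * (A * truncError F L)))) ∂μ := by
          refine lintegral_mono fun ω => (ENNReal.ofReal_le_ofReal (hpt ω)).trans ?_
          rw [← ENNReal.ofReal_sum_of_nonneg fun k _ => by positivity]
          exact ENNReal.ofReal_add_le.trans (by gcongr; exact ENNReal.ofReal_add_le)
      _ = ∫⁻ ω, ENNReal.ofReal (η * D ω ^ 2) ∂μ +
          ((∑ k ∈ Finset.range n, ∫⁻ ω, ENNReal.ofReal (A * |U k ω - trunc L (U k ω)|) ∂μ) +
          ENNReal.ofReal (1 / (4 * η) + 2 * H + n * (A * truncError F L))) := by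
          rw [lintegral_add_left' (by
              have := hDL.aestronglyMeasurable.aemeasurable
              fun_prop),
            lintegral_add_right _ measurable_const,
            lintegral_finsetSum _ fun k _ => (hm1 k).ennreal_ofReal]
          simp
      _ ≤ ENNReal.ofReal (η * (n * (2 * C) ^ 2)) +
          ((∑ k ∈ Finset.range n, ENNReal.ofReal (A * truncError F L)) +
          ENNReal.ofReal (1 / (4 * η) + 2 * H + n * (A * truncError F L))) := by
          gcongr with k hk
          · rw [← ofReal_integral_eq_lintegral_ofReal (hDL.integrable_sq.const_mul η)
              (Eventually.of_forall fun ω => by positivity), integral_const_mul]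
            exact ENNReal.ofReal_le_ofReal (mul_le_mul_of_nonneg_left
              (h.integral_sum_stepDiff_sq_le hG hGC n) hη.le)
          · exact hterm k
      _ = ENNReal.ofReal (η * (n * (2 * C) ^ 2) + (n * (A * truncError F L) +
          (1 / (4 * η) + 2 * H + n * (A * truncError F L)))) := by
          rw [← ENNReal.ofReal_sum_of_nonneg fun k _ => by positivity, Finset.sum_const,
            Finset.card_range, nsmul_eq_mul, ← ENNReal.ofReal_add (by positivity) hB0,
            ← ENNReal.ofReal_add (by positivity) (by positivity)]
      _ ≤ ENNReal.ofReal (ε * n + (1 / (4 * η) + 2 * H)) := by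
          refine ENNReal.ofReal_le_ofReal ?_
          have hn : (0 : ℝ) ≤ n := Nat.cast_nonneg n
          nlinarith [mul_le_mul_of_nonneg_left hηC hn, mul_le_mul_of_nonneg_left hL.le hn]

end IsStationarySemiMarkov

/-! ### Occupation times -/

/-- A fixed random variable is negligible with respect to `n` in probability. -/
theorem tendsto_measure_mul_natCast_le {Ω : Type*} [MeasurableSpace Ω] (μ : Measure Ω)
    [IsFiniteMeasure μ] {V : Ω → ℝ} (hV : Measurable V) {δ : ℝ} (hδ : 0 < δ) :
    Tendsto (fun n : ℕ => μ {ω | δ * n ≤ V ω}) atTop (𝓝 0) := by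
  have h1 := tendsto_measure_iInter_atTop (μ := μ) (s := fun n : ℕ => {ω | δ * n ≤ V ω})
    (fun n => (measurableSet_le measurable_const hV).nullMeasurableSet)
    (fun m n hmn ω (hω : δ * n ≤ V ω) => by
      have : (m : ℝ) ≤ n := by exact_mod_cast hmn
      exact (mul_le_mul_of_nonneg_left this hδ.le).trans hω)
    ⟨0, measure_ne_top _ _⟩
  have h2 : ⋂ n : ℕ, {ω | δ * n ≤ V ω} = ∅ := by
    refine Set.eq_empty_of_forall_notMem fun ω hω => ?_
    obtain ⟨n, hn⟩ := exists_nat_gt (V ω / δ)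
    rw [div_lt_iff₀ hδ] at hn
    have h3 : δ * n ≤ V ω := Set.mem_iInter.1 hω n
    linarith
  rwa [h2, measure_empty] at h1

/-- The indicator that a jump path is in the state `r` at time `u`. -/
noncomputable def visit {S : Type*} [DecidableEq S] (T : ℕ → ℝ) (X : ℕ → S) (r : S) (u : ℝ) : ℝ :=
  if jumpPath T X u = r then 1 else 0

section Visit

variable {S : Type*} [DecidableEq S] [MeasurableSpace S] [MeasurableSingletonClass S]

theorem measurable_visit_prod (r : S) : Measurable fun x : (ℕ → ℝ × S) × ℝ =>
    visit (fun n => (x.1 n).1) (fun n => (x.1 n).2) r x.2 :=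
  Measurable.ite (measurable_jumpPath (measurableSet_singleton r)) measurable_const measurable_const

theorem measurable_visit (T : ℕ → ℝ) (X : ℕ → S) (r : S) : Measurable (visit T X r) :=
  (measurable_visit_prod r).comp (measurable_const.prodMk measurable_id :
    Measurable fun u : ℝ => ((fun n => (T n, X n) : ℕ → ℝ × S), u))

omit [MeasurableSpace S] [MeasurableSingletonClass S] in
theorem visit_mem_Icc (T : ℕ → ℝ) (X : ℕ → S) (r : S) (u : ℝ) :
    visit T X r u ∈ Set.Icc (0 : ℝ) 1 := by
  unfold visit; split_ifs <;> simp

/-- The time spent in the state `r` between two jumps is the sum of the sojourns in `r`. -/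
theorem integral_visit_jumps {T : ℕ → ℝ} (X : ℕ → S) (hT : StrictMono T) (r : S) (n : ℕ) :
    ∫ u in T 1..T (n + 1), visit T X r u =
      ∑ k ∈ Finset.range n, (if X (k + 1) = r then 1 else 0) * (T (k + 2) - T (k + 1)) := by
  have hi := intervalIntegrable_of_mem_Icc (measurable_visit T X r) (visit_mem_Icc T X r)
  rw [← intervalIntegral.sum_integral_adjacent_intervals (a := fun k => T (k + 1))
    fun k _ => hi _ _]
  refine Finset.sum_congr rfl fun k _ => ?_
  have h1 : ∫ u in T (k + 1)..T (k + 1 + 1), visit T X r u =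
      ∫ u in T (k + 1)..T (k + 1 + 1), (if X (k + 1) = r then (1 : ℝ) else 0) := by
    refine intervalIntegral.integral_congr_ae ?_
    -- at the right end point the path is in the next state already
    filter_upwards [compl_mem_ae_iff.2 (measure_singleton (T (k + 1 + 1)))] with u hu hmem
    rw [Set.uIoc_of_le (hT (by omega)).le] at hmem
    rw [visit, jumpPath_eq hT hmem.1.le (lt_of_le_of_ne hmem.2 hu)]
  rw [h1, intervalIntegral.integral_const, smul_eq_mul, mul_comm]

/-- The time spent in `r` up to `t`, compared with the multiple `c` of `t`, in terms of the first
`n` complete sojourns, if their total length is about `m n` and their total length in `r` is about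
`b n`. -/
theorem abs_integral_visit_sub_le {T : ℕ → ℝ} (X : ℕ → S) (hT : StrictMono T) (h1 : 0 < T 1)
    (r : S) (n : ℕ) (t b c m : ℝ) :
    |(∫ u in (0 : ℝ)..t, visit T X r u) - c * t| ≤ 2 * T 1 +
      |∑ k ∈ Finset.range n, ((if X (k + 1) = r then 1 else 0) * (T (k + 2) - T (k + 1)) - b)| +
      |∑ k ∈ Finset.range n, (1 * (T (k + 2) - T (k + 1)) - m)| + |t - n * m| +
      |n * b - c * t| := by
  have hg := visit_mem_Icc T X r
  have hi := intervalIntegrable_of_mem_Icc (measurable_visit T X r) hg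
  have e1 := abs_integral_le_of_mem_Icc hg 0 (T 1)
  have e2 := abs_integral_le_of_mem_Icc hg (T (n + 1)) t
  have e3 := integral_visit_jumps X hT r n
  have e4 : ∑ k ∈ Finset.range n, (T (k + 2) - T (k + 1)) = T (n + 1) - T 1 :=
    Finset.sum_range_sub (fun k => T (k + 1)) n
  simp only [one_mul, Finset.sum_sub_distrib, Finset.sum_const, Finset.card_range, nsmul_eq_mul]
  rw [← Finset.sum_sub_distrib, e4, ← e3]
  have hsplit : ∫ u in (0 : ℝ)..t, visit T X r u = (∫ u in (0 : ℝ)..T 1, visit T X r u) +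
      (∫ u in T 1..T (n + 1), visit T X r u) + ∫ u in T (n + 1)..t, visit T X r u := by
    rw [intervalIntegral.integral_add_adjacent_intervals (hi _ _) (hi _ _),
      intervalIntegral.integral_add_adjacent_intervals (hi _ _) (hi _ _)]
  rw [sub_zero, abs_of_pos h1] at e1
  have e5 : |t - T (n + 1)| ≤ |t - n * m| + (|T (n + 1) - T 1 - n * m| + T 1) := by
    have := abs_add_le (t - n * m) (-(T (n + 1) - T 1 - n * m) - T 1)
    have h2 := abs_sub (-(T (n + 1) - T 1 - n * m)) (T 1)
    rw [abs_neg, abs_of_pos h1] at h2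
    rw [show t - n * m + (-(T (n + 1) - T 1 - n * m) - T 1) = t - T (n + 1) by ring] at this
    linarith
  have e6 : (∫ u in (0 : ℝ)..t, visit T X r u) - c * t =
      (∫ u in (0 : ℝ)..T 1, visit T X r u) + ((∫ u in T 1..T (n + 1), visit T X r u) - n * b) +
      (∫ u in T (n + 1)..t, visit T X r u) + (n * b - c * t) := by rw [hsplit]; ring
  rw [e6]
  have f1 := abs_add_le ((∫ u in (0 : ℝ)..T 1, visit T X r u) +
    ((∫ u in T 1..T (n + 1), visit T X r u) - n * b) + (∫ u in T (n + 1)..t, visit T X r u))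
    (n * b - c * t)
  have f2 := abs_add_le ((∫ u in (0 : ℝ)..T 1, visit T X r u) +
    ((∫ u in T 1..T (n + 1), visit T X r u) - n * b)) (∫ u in T (n + 1)..t, visit T X r u)
  have f3 := abs_add_le (∫ u in (0 : ℝ)..T 1, visit T X r u)
    ((∫ u in T 1..T (n + 1), visit T X r u) - n * b)
  linarith

end Visit

namespace IsStationarySemiMarkov

variable {Ω : Type*} [MeasurableSpace Ω] {μ : Measure Ω} [IsProbabilityMeasure μ] {M : ℕ}
  {p : Matrix (Fin M) (Fin M) ℝ} {F : Fin M → Fin M → Measure ℝ}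
  {T : ℕ → Ω → ℝ} {X : ℕ → Ω → Fin M}

/-- The fraction of time spent in a state converges in probability to a constant: the ratio of the
limits of the mean time in the state and of the mean time per sojourn. -/
theorem exists_tendsto_occupation (h : IsStationarySemiMarkov μ p F T X) (r : Fin M) :
    ∃ c : ℝ, ∀ δ > 0, Tendsto (fun N : ℕ => μ {ω | δ * N ≤
      |(∫ u in (0 : ℝ)..N, visit (fun n => T n ω) (fun n => X n ω) r u) - c * N|})
      atTop (𝓝 0) := by
  obtain ⟨b, -, hb⟩ := h.exists_lintegral_abs_sum_sub_le fun s => if s = r then 1 else 0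
  obtain ⟨m, hm, hm'⟩ := h.exists_lintegral_abs_sum_sub_le fun _ => 1
  replace hm : 0 < m := hm fun _ => one_pos
  refine ⟨b / m, fun δ hδ => ?_⟩
  -- about the number of sojourns completed up to time `N`
  let n : ℕ → ℕ := fun N => ⌊N / m⌋₊
  have hn : ∀ N : ℕ, (n N : ℝ) * m ≤ N ∧ (N : ℝ) ≤ n N * m + m := by
    intro N
    have h1 := Nat.floor_le (div_nonneg (Nat.cast_nonneg N) hm.le : (0 : ℝ) ≤ N / m)
    have h2 := (Nat.lt_floor_add_one ((N : ℝ) / m)).le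
    rw [le_div_iff₀ hm] at h1
    rw [div_le_iff₀ hm] at h2
    exact ⟨h1, by linarith⟩
  let W : ℕ → Ω → ℝ := fun n ω =>
    |∑ k ∈ Finset.range n, ((if X (k + 1) ω = r then 1 else 0) * (T (k + 2) ω - T (k + 1) ω) - b)| +
      |∑ k ∈ Finset.range n, (1 * (T (k + 2) ω - T (k + 1) ω) - m)|
  have hT := h.measurable_T
  have hX := h.measurable_X
  have hs1 : ∀ k, Measurable fun ω => |∑ k ∈ Finset.range k,
      ((if X (k + 1) ω = r then 1 else 0) * (T (k + 2) ω - T (k + 1) ω) - b)| := fun k => by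
    have : ∀ k, Measurable fun ω => if X (k + 1) ω = r then (1 : ℝ) else 0 := fun k =>
      Measurable.ite (hX (k + 1) (measurableSet_singleton r)) measurable_const measurable_const
    fun_prop
  have hs2 : ∀ k, Measurable fun ω => |∑ k ∈ Finset.range k,
      (1 * (T (k + 2) ω - T (k + 1) ω) - m)| := fun k => by fun_prop
  have hW : ∀ ε > 0, ∃ B, 0 ≤ B ∧ ∀ k : ℕ,
      ∫⁻ ω, ENNReal.ofReal (W k ω) ∂μ ≤ ENNReal.ofReal (ε * k + B) := by
    intro ε hε
    obtain ⟨B1, hB1, h1⟩ := hb (ε / 2) (half_pos hε)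
    obtain ⟨B2, hB2, h2⟩ := hm' (ε / 2) (half_pos hε)
    refine ⟨B1 + B2, by positivity, fun k => ?_⟩
    simp only [W]
    simp_rw [ENNReal.ofReal_add (abs_nonneg _) (abs_nonneg _)]
    rw [lintegral_add_left (hs1 k).ennreal_ofReal]
    refine (add_le_add (h1 k) (h2 k)).trans ?_
    rw [← ENNReal.ofReal_add (by positivity) (by positivity)]
    exact ENNReal.ofReal_le_ofReal (by linarith)
  -- the part of the error that does not grow with `N`
  let V : Ω → ℝ := fun ω => 2 * T 1 ω + (m + |b|)
  have hV : Measurable V := by simp only [V]; fun_prop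
  have hsub : ∀ N : ℕ, μ {ω | δ * N ≤ |(∫ u in (0 : ℝ)..N, visit (fun n => T n ω) (fun n => X n ω)
      r u) - b / m * N|} ≤ μ {ω | δ / 2 * N ≤ V ω} + μ {ω | δ / 2 * N ≤ W (n N) ω} := by
    intro N
    refine (measure_mono_ae ?_).trans (measure_union_le _ _)
    filter_upwards [h.first_jump, h.strictMono] with ω hω1 hω2 (hω : δ * N ≤ _)
    have h1 := abs_integral_visit_sub_le (fun n => X n ω) hω2 hω1.2 r (n N) N b (b / m) m
    have h2 : |(N : ℝ) - n N * m| ≤ m := abs_le.2 ⟨by linarith [(hn N).1], by linarith [(hn N).2]⟩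
    have h3 : |n N * b - b / m * N| ≤ |b| := by
      have : n N * b - b / m * N = b * ((n N * m - N) / m) := by field_simp
      rw [this, abs_mul, abs_div, abs_of_pos hm, abs_sub_comm]
      exact mul_le_of_le_one_right (abs_nonneg b) ((div_le_one hm).2 h2)
    by_cases hc : δ / 2 * N ≤ V ω
    · exact Or.inl hc
    · refine Or.inr (?_ : δ / 2 * N ≤ W (n N) ω)
      simp only [V, W] at hc ⊢
      linarith
  have hWlim : Tendsto (fun N : ℕ => μ {ω | δ / 2 * N ≤ W (n N) ω}) atTop (𝓝 0) := by
    rw [ENNReal.tendsto_nhds_zero]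
    intro ε hε
    obtain ⟨e, he, hee⟩ : ∃ e : ℝ, 0 < e ∧ ENNReal.ofReal e ≤ ε := by
      rcases eq_or_ne ε ∞ with rfl | hne
      · exact ⟨1, one_pos, le_top⟩
      · exact ⟨ε.toReal, ENNReal.toReal_pos hε.ne' hne, ENNReal.ofReal_toReal_le⟩
    -- Markov's inequality; the slope `e * m * δ / 4` contributes at most `e / 2`, and so does `B`
    obtain ⟨B, hB0, hB⟩ := hW (e * m * δ / 4) (by positivity)
    filter_upwards [eventually_ge_atTop (max 1 ⌈4 * B / (e * δ)⌉₊)] with N hN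
    have hN1 : (1 : ℝ) ≤ N := by exact_mod_cast (le_max_left _ _).trans hN
    have hN2 : 4 * B / (e * δ) ≤ N :=
      (Nat.le_ceil _).trans (by exact_mod_cast (le_max_right _ _).trans hN)
    have hpos : 0 < δ / 2 * N := by positivity
    have h1 := meas_ge_le_lintegral_div (μ := μ) (f := fun ω => ENNReal.ofReal (W (n N) ω))
      ((hs1 _).add (hs2 _)).ennreal_ofReal.aemeasurable (ε := ENNReal.ofReal (δ / 2 * N))
      (by simpa using hpos) ENNReal.ofReal_ne_top
    refine le_trans (le_trans (measure_mono fun ω (hω : _ ≤ _) =>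
      (ENNReal.ofReal_le_ofReal hω : _ ≤ _)) h1) ?_
    refine (ENNReal.div_le_div_right (hB _) _).trans ?_
    rw [← ENNReal.ofReal_div_of_pos hpos]
    refine (ENNReal.ofReal_le_ofReal ?_).trans hee
    rw [div_le_iff₀ hpos]
    rw [div_le_iff₀ (by positivity)] at hN2
    have h2 : e * m * δ / 4 * n N ≤ e * δ / 4 * N := by
      have := mul_le_mul_of_nonneg_left (hn N).1 (by positivity : 0 ≤ e * δ / 4)
      linarith
    linarith
  have hlim := (tendsto_measure_mul_natCast_le μ hV (half_pos hδ)).add hWlim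
  rw [add_zero] at hlim
  exact tendsto_of_tendsto_of_tendsto_of_le_of_le tendsto_const_nhds hlim (fun _ => zero_le) hsub

end IsStationarySemiMarkov

/-! ### The states seen by the requests -/

/-- The state of the modulating process at the request number `n`. -/
noncomputable def requestState {Ω : Type*} {M : ℕ} (T : ℕ → Ω → ℝ) (X : ℕ → Ω → Fin M)
    (τ : ℕ → Ω → ℝ) (n : ℕ) (ω : Ω) : Fin M :=
  jumpPath (fun k => T k ω) (fun k => X k ω) (τ n ω)

/-- The time spent in `r` up to `n` is a measurable function of the jump path. -/
theorem measurable_integral_visit {S : Type*} [DecidableEq S] [MeasurableSpace S]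
    [MeasurableSingletonClass S] (r : S) (n : ℕ) : Measurable fun z : ℕ → ℝ × S =>
      ∫ u in (0 : ℝ)..n, visit (fun k => (z k).1) (fun k => (z k).2) r u := by
  simp_rw [intervalIntegral.integral_of_le (Nat.cast_nonneg (α := ℝ) n)]
  exact ((measurable_visit_prod r).stronglyMeasurable.integral_prod_right'
    (ν := volume.restrict (Set.Ioc 0 (n : ℝ)))).measurable

theorem statProb_nonneg {Ω : Type*} [MeasurableSpace Ω] (μ : Measure Ω) {M : ℕ}
    (T : ℕ → Ω → ℝ) (X : ℕ → Ω → Fin M) (r : Fin M) : 0 ≤ statProb μ T X r :=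
  measureReal_nonneg

namespace IsSemiMarkovModulated

variable {Ω : Type*} [MeasurableSpace Ω] {μ : Measure Ω} [IsProbabilityMeasure μ] {M : ℕ}
  {p : Matrix (Fin M) (Fin M) ℝ} {F : Fin M → Fin M → Measure ℝ} {q : Fin M → PMF ℕ}
  {T : ℕ → Ω → ℝ} {X : ℕ → Ω → Fin M} {τ : ℕ → Ω → ℝ} {R : ℕ → Ω → ℕ}

omit [IsProbabilityMeasure μ] in
theorem measurable_jumps (h : IsSemiMarkovModulated μ p F q T X τ R) :
    Measurable fun ω (n : ℕ) => (T n ω, X n ω) :=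
  measurable_pi_iff.2 fun n => (h.semiMarkov.measurable_T n).prodMk (h.semiMarkov.measurable_X n)

omit [IsProbabilityMeasure μ] in
theorem measurable_points (h : IsSemiMarkovModulated μ p F q T X τ R) :
    Measurable fun ω (n : ℕ) => τ n ω :=
  measurable_pi_iff.2 h.poisson.measurable

omit [IsProbabilityMeasure μ] in
theorem measurable_requestState (h : IsSemiMarkovModulated μ p F q T X τ R) (n : ℕ) :
    Measurable (requestState T X τ n) :=
  measurable_jumpPath.comp (h.measurable_jumps.prodMk (h.poisson.measurable n))

/-- Expectation over the jump path first, for fixed Poisson points. -/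
theorem lintegral_eq_points_jumps (h : IsSemiMarkovModulated μ p F q T X τ R)
    {Φ : (ℕ → ℝ × Fin M) × (ℕ → ℝ) → ℝ≥0∞} (hΦ : Measurable Φ) :
    ∫⁻ ω, Φ (fun n => (T n ω, X n ω), fun n => τ n ω) ∂μ =
      ∫⁻ ω', ∫⁻ ω, Φ (fun n => (T n ω, X n ω), fun n => τ n ω') ∂μ ∂μ := by
  have h1 := (indepFun_iff_map_prod_eq_prod_map_map h.measurable_jumps.aemeasurable
    h.measurable_points.aemeasurable).1 h.indep
  have : IsProbabilityMeasure (μ.map fun ω (n : ℕ) => (T n ω, X n ω)) :=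
    Measure.isProbabilityMeasure_map h.measurable_jumps.aemeasurable
  have : IsProbabilityMeasure (μ.map fun ω (n : ℕ) => τ n ω) :=
    Measure.isProbabilityMeasure_map h.measurable_points.aemeasurable
  rw [← lintegral_map (f := Φ) hΦ (h.measurable_jumps.prodMk h.measurable_points), h1,
    lintegral_prod_symm _ hΦ.aemeasurable, lintegral_map _ h.measurable_points]
  · refine lintegral_congr fun ω' => ?_
    rw [lintegral_map _ h.measurable_jumps]
    exact hΦ.comp (measurable_id.prodMk measurable_const)
  · exact hΦ.lintegral_prod_left'

/-- Expectation over the Poisson points first, for a fixed jump path. -/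
theorem lintegral_eq_jumps_points (h : IsSemiMarkovModulated μ p F q T X τ R)
    {Φ : (ℕ → ℝ × Fin M) × (ℕ → ℝ) → ℝ≥0∞} (hΦ : Measurable Φ) :
    ∫⁻ ω, Φ (fun n => (T n ω, X n ω), fun n => τ n ω) ∂μ =
      ∫⁻ ω, ∫⁻ ω', Φ (fun n => (T n ω, X n ω), fun n => τ n ω') ∂μ ∂μ := by
  rw [h.lintegral_eq_points_jumps hΦ]
  refine lintegral_lintegral_swap ?_
  exact (hΦ.comp ((h.measurable_jumps.comp measurable_snd).prodMk
    (h.measurable_points.comp measurable_fst))).aemeasurable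

theorem measure_eq_points_jumps (h : IsSemiMarkovModulated μ p F q T X τ R)
    {A : Set ((ℕ → ℝ × Fin M) × (ℕ → ℝ))} (hA : MeasurableSet A) :
    μ {ω | ((fun n => (T n ω, X n ω), fun n => τ n ω) : (ℕ → ℝ × Fin M) × (ℕ → ℝ)) ∈ A} =
      ∫⁻ ω', μ {ω | ((fun n => (T n ω, X n ω), fun n => τ n ω') :
        (ℕ → ℝ × Fin M) × (ℕ → ℝ)) ∈ A} ∂μ := by
  have h1 := h.lintegral_eq_points_jumps (Φ := A.indicator fun _ => 1)
    (measurable_const.indicator hA)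
  have h2 : ∀ g : Ω → (ℕ → ℝ × Fin M) × (ℕ → ℝ), Measurable g →
      ∫⁻ ω, A.indicator (fun _ => (1 : ℝ≥0∞)) (g ω) ∂μ = μ {ω | g ω ∈ A} := fun g hg => by
    exact lintegral_indicator_one (hg hA)
  rw [h2 _ (h.measurable_jumps.prodMk h.measurable_points)] at h1
  rw [h1]
  exact lintegral_congr fun ω' => h2 _ (h.measurable_jumps.prodMk measurable_const)

/-- A request sees the modulating process in its stationary law, whatever the time of the
request. -/
theorem measure_requestState_eq (h : IsSemiMarkovModulated μ p F q T X τ R) (n : ℕ) {B : Set ℝ}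
    (hB : MeasurableSet B) (r : Fin M) :
    μ {ω | τ n ω ∈ B ∧ requestState T X τ n ω = r} =
      μ {ω | τ n ω ∈ B} * ENNReal.ofReal (statProb μ T X r) := by
  have hA : MeasurableSet {x : (ℕ → ℝ × Fin M) × (ℕ → ℝ) | x.2 n ∈ B ∧
      jumpPath (fun k => (x.1 k).1) (fun k => (x.1 k).2) (x.2 n) = r} := by
    have hn : Measurable fun x : (ℕ → ℝ × Fin M) × (ℕ → ℝ) => x.2 n := by fun_prop
    exact (hn hB).inter
      ((measurable_jumpPath.comp (measurable_fst.prodMk hn)) (measurableSet_singleton r))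
  refine (h.measure_eq_points_jumps hA).trans ?_
  have h1 : ∀ᵐ ω' ∂μ, μ {ω | ((fun n => (T n ω, X n ω), fun n => τ n ω') :
        (ℕ → ℝ × Fin M) × (ℕ → ℝ)) ∈ {x : (ℕ → ℝ × Fin M) × (ℕ → ℝ) | x.2 n ∈ B ∧
      jumpPath (fun k => (x.1 k).1) (fun k => (x.1 k).2) (x.2 n) = r}} =
      {ω' | τ n ω' ∈ B}.indicator (fun _ => ENNReal.ofReal (statProb μ T X r)) ω' := by
    filter_upwards [h.poisson.ae_pos_strictMono] with ω' hω'
    by_cases hb : τ n ω' ∈ B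
    · have h2 := h.semiMarkov.stationary (τ n ω') (hω'.1 n).le 1 (fun _ => 0) (fun _ => le_rfl)
        (fun _ => r)
      simp only [zero_add, forall_const] at h2
      rw [Set.indicator_of_mem (by exact hb), statProb, ofReal_measureReal, ← h2]
      simp [hb]
    · rw [Set.indicator_of_notMem (by exact hb)]
      simp [hb]
  have hBm : MeasurableSet {ω' | τ n ω' ∈ B} := h.poisson.measurable n hB
  rw [lintegral_congr_ae h1, lintegral_indicator_const hBm, mul_comm]

theorem measure_requestState (h : IsSemiMarkovModulated μ p F q T X τ R) (n : ℕ) (r : Fin M) :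
    μ {ω | requestState T X τ n ω = r} = ENNReal.ofReal (statProb μ T X r) := by
  simpa using h.measure_requestState_eq n .univ r

/-- The sequence of the states at the requests is stationary: a shift of time by the point number
`m` does not change the law of the jump path, and the increments of the points are stationary. -/
theorem map_requestState (h : IsSemiMarkovModulated μ p F q T X τ R) (m N : ℕ) :
    μ.map (fun ω (j : Fin N) => requestState T X τ (m + j) ω) =
      μ.map (fun ω (j : Fin N) => requestState T X τ j ω) := by
  have hY : ∀ m, Measurable fun ω (j : Fin N) => requestState T X τ (m + j) ω := fun m =>
    measurable_pi_iff.2 fun j => h.measurable_requestState _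
  let inc : ℕ → Ω → ℕ → ℝ := fun m ω j => τ (m + j) ω - τ m ω
  have hinc : ∀ m, Measurable (inc m) := fun m =>
    measurable_pi_iff.2 fun j => (h.poisson.measurable _).sub (h.poisson.measurable _)
  have key : ∀ (x : Fin N → Fin M) (m : ℕ),
      μ {ω | ∀ j : Fin N, requestState T X τ (m + j) ω = x j} = ∫⁻ v,
         μ {ω | ∀ j : Fin N, jumpPath (fun k => T k ω) (fun k => X k ω) (v j) = x j}
        ∂μ.map (inc m) := by
    intro x m
    have hvm : Measurable fun v : ℕ → ℝ =>
        μ {ω | ∀ j : Fin N, jumpPath (fun k => T k ω) (fun k => X k ω) (v j) = x j} := by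
      have hs : MeasurableSet {y : (ℕ → ℝ) × Ω | ∀ j : Fin N,
          jumpPath (fun k => T k y.2) (fun k => X k y.2) (y.1 j) = x j} := by
        rw [Set.ofPred_forall]
        refine .iInter fun j => ?_
        have hj : Measurable fun y : (ℕ → ℝ) × Ω => y.1 j := by fun_prop
        exact (measurable_jumpPath.comp ((h.measurable_jumps.comp measurable_snd).prodMk hj))
          (measurableSet_singleton (x j))
      exact measurable_measure_prodMk_left hs
    have hA : MeasurableSet {y : (ℕ → ℝ × Fin M) × (ℕ → ℝ) | ∀ j : Fin N,
        jumpPath (fun k => (y.1 k).1) (fun k => (y.1 k).2) (y.2 (m + j)) = x j} := by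
      rw [Set.ofPred_forall]
      refine .iInter fun j => ?_
      have hj : Measurable fun y : (ℕ → ℝ × Fin M) × (ℕ → ℝ) => y.2 (m + j) := by fun_prop
      exact (measurable_jumpPath.comp (measurable_fst.prodMk hj)) (measurableSet_singleton (x j))
    rw [lintegral_map hvm (hinc m)]
    refine (h.measure_eq_points_jumps hA).trans (lintegral_congr_ae ?_)
    filter_upwards [h.poisson.ae_pos_strictMono] with ω' hω'
    have h2 := h.semiMarkov.stationary (τ m ω') (hω'.1 m).le N (fun j => inc m ω' j)
      (fun j => sub_nonneg.2 (hω'.2.monotone (by omega))) x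
    simp only [inc, sub_add_cancel] at h2
    exact h2
  refine Measure.ext_of_singleton fun x => ?_
  have hz := hY 0
  simp only [zero_add] at hz
  rw [Measure.map_apply (hY m) (measurableSet_singleton x),
    Measure.map_apply hz (measurableSet_singleton x)]
  have hset : ∀ m, (fun ω (j : Fin N) => requestState T X τ (m + j) ω) ⁻¹' {x} =
      {ω | ∀ j : Fin N, requestState T X τ (m + j) ω = x j} := fun m => by
    ext ω; simp [funext_iff]
  have h0 := hset 0
  have k0 := key x 0
  simp only [zero_add] at h0 k0
  rw [hset m, h0, key x m, k0]
  have hi := h.poisson.map_increments_eq m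
  simp only [inc, zero_add] at hi ⊢
  rw [hi]

/-- The number of visits to `r` among the first `n` requests. -/
noncomputable def visits (T : ℕ → Ω → ℝ) (X : ℕ → Ω → Fin M) (τ : ℕ → Ω → ℝ) (r : Fin M) (n : ℕ)
    (ω : Ω) : ℝ :=
  ∑ i ∈ Finset.range n, if requestState T X τ i ω = r then 1 else 0

omit [IsProbabilityMeasure μ] in
theorem measurable_visits (h : IsSemiMarkovModulated μ p F q T X τ R) (r : Fin M) (n : ℕ) :
    Measurable (visits T X τ r n) :=
  Finset.measurable_sum _ fun i _ => Measurable.ite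
    (h.measurable_requestState i (measurableSet_singleton r)) measurable_const measurable_const

/-- Poisson sampling of the state approximates the time spent in it, since the points are
independent of the jump path. -/
theorem lintegral_visits_sub_sq_le (h : IsSemiMarkovModulated μ p F q T X τ R) (r : Fin M) (n : ℕ) :
    ∫⁻ ω, ENNReal.ofReal ((visits T X τ r n ω -
      ∫ u in (0 : ℝ)..n, visit (fun k => T k ω) (fun k => X k ω) r u) ^ 2) ∂μ ≤
      ENNReal.ofReal (n * 24) := by
  let Φ : (ℕ → ℝ × Fin M) × (ℕ → ℝ) → ℝ≥0∞ := fun y => ENNReal.ofReal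
    ((∑ i ∈ Finset.range n, visit (fun k => (y.1 k).1) (fun k => (y.1 k).2) r (y.2 i) -
      ∫ u in (0 : ℝ)..n, visit (fun k => (y.1 k).1) (fun k => (y.1 k).2) r u) ^ 2)
  have hΦ : Measurable Φ := by
    have h1 : ∀ i, Measurable fun y : (ℕ → ℝ × Fin M) × (ℕ → ℝ) =>
        visit (fun k => (y.1 k).1) (fun k => (y.1 k).2) r (y.2 i) := fun i => by
      have hi : Measurable fun y : (ℕ → ℝ × Fin M) × (ℕ → ℝ) => y.2 i := by fun_prop
      exact (measurable_visit_prod r).comp (measurable_fst.prodMk hi)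
    have h3 : Measurable fun y : (ℕ → ℝ × Fin M) × (ℕ → ℝ) =>
        ∫ u in (0 : ℝ)..n, visit (fun k => (y.1 k).1) (fun k => (y.1 k).2) r u :=
      (measurable_integral_visit r n).comp measurable_fst
    exact (((Finset.measurable_sum _ fun i _ => h1 i).sub h3).pow_const 2).ennreal_ofReal
  have hvis : ∀ ω, visits T X τ r n ω =
      ∑ i ∈ Finset.range n, visit (fun k => T k ω) (fun k => X k ω) r (τ i ω) := fun ω => rfl
  simp_rw [hvis]
  refine (h.lintegral_eq_jumps_points hΦ).le.trans ?_
  refine (lintegral_mono fun ω => h.poisson.lintegral_sum_sub_integral_sq_le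
    (measurable_visit (fun k => T k ω) (fun k => X k ω) r)
    (visit_mem_Icc (fun k => T k ω) (fun k => X k ω) r) n).trans ?_
  simp

/-- The fraction of requests that see the state `r` converges in probability to the stationary
probability of `r`. -/
theorem tendsto_visits (h : IsSemiMarkovModulated μ p F q T X τ R) (r : Fin M) {δ : ℝ}
    (hδ : 0 < δ) : Tendsto (fun n : ℕ => μ {ω | δ * n ≤ |visits T X τ r n ω -
      statProb μ T X r * n|}) atTop (𝓝 0) := by
  obtain ⟨c, hc⟩ := h.semiMarkov.exists_tendsto_occupation r
  let occ : ℕ → Ω → ℝ := fun n ω => ∫ u in (0 : ℝ)..n, visit (fun k => T k ω) (fun k => X k ω) r u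
  have hocc : ∀ n, Measurable (occ n) := fun n =>
    (measurable_integral_visit r n).comp h.measurable_jumps
  have hlim : ∀ δ > 0, Tendsto (fun n : ℕ => μ {ω | δ * n ≤ |visits T X τ r n ω - c * n|}) atTop
      (𝓝 0) := by
    intro δ hδ
    have h1 : Tendsto (fun n : ℕ => ENNReal.ofReal (n * 24 / (δ / 2 * n) ^ 2)) atTop (𝓝 0) := by
      rw [← ENNReal.ofReal_zero]
      refine ENNReal.tendsto_ofReal ?_
      have h2 : Tendsto (fun n : ℕ => 24 / (δ / 2) ^ 2 * (1 / (n : ℝ))) atTop (𝓝 0) := by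
        have := (tendsto_one_div_atTop_nhds_zero_nat (𝕜 := ℝ)).const_mul (24 / (δ / 2) ^ 2)
        rwa [mul_zero] at this
      refine h2.congr' ?_
      filter_upwards [eventually_gt_atTop 0] with n hn
      have : (0 : ℝ) < n := by exact_mod_cast hn
      field_simp
    have h3 := h1.add (hc (δ / 2) (half_pos hδ))
    rw [add_zero] at h3
    refine tendsto_of_tendsto_of_tendsto_of_le_of_le' tendsto_const_nhds h3
      (Eventually.of_forall fun _ => zero_le) ?_
    filter_upwards [eventually_gt_atTop 0] with n hn
    have hn' : (0 : ℝ) < n := by exact_mod_cast hn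
    have hpos : 0 < (δ / 2 * n) ^ 2 := by positivity
    have h4 := meas_ge_le_lintegral_div (μ := μ)
      (f := fun ω => ENNReal.ofReal ((visits T X τ r n ω - occ n ω) ^ 2))
      (((h.measurable_visits r n).sub (hocc n)).pow_const 2).ennreal_ofReal.aemeasurable
      (ε := ENNReal.ofReal ((δ / 2 * n) ^ 2)) (ENNReal.ofReal_pos.2 hpos).ne' ENNReal.ofReal_ne_top
    have h5 := h4.trans (ENNReal.div_le_div_right (h.lintegral_visits_sub_sq_le r n) _)
    rw [← ENNReal.ofReal_div_of_pos hpos] at h5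
    refine le_trans ?_ (add_le_add_left h5 _)
    refine (measure_mono fun ω (hω : δ * n ≤ _) => ?_).trans (measure_union_le _ _)
    by_cases hcase : δ / 2 * n ≤ |occ n ω - c * n|
    · exact Or.inr hcase
    · refine Or.inl (ENNReal.ofReal_le_ofReal ?_ : _ ≤ _)
      have h6 := abs_add_le (visits T X τ r n ω - occ n ω) (occ n ω - c * n)
      rw [sub_add_sub_cancel] at h6
      rw [← sq_abs (visits T X τ r n ω - occ n ω)]
      exact pow_le_pow_left₀ (by positivity) (by linarith) 2
  suffices hcπ : c = statProb μ T X r by rw [← hcπ]; exact hlim δ hδ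
  -- both are the limit of the means of the bounded variables `visits n / n`
  have hvis : ∀ (n : ℕ) (ω : Ω), visits T X τ r n ω ∈ Set.Icc (0 : ℝ) n := fun n ω =>
    ⟨Finset.sum_nonneg fun i _ => by split_ifs <;> simp,
      (Finset.sum_le_sum (g := fun _ => (1 : ℝ)) fun i _ => by split_ifs <;> simp).trans (by simp)⟩
  have hmean : ∀ n : ℕ, ∫ ω, visits T X τ r n ω ∂μ = n * statProb μ T X r := by
    intro n
    have hi : ∀ i, (fun ω => if requestState T X τ i ω = r then (1 : ℝ) else 0) =
        {ω | requestState T X τ i ω = r}.indicator 1 := fun i => by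
      ext ω; simp [Set.indicator_apply]
    have hm : ∀ i, MeasurableSet {ω | requestState T X τ i ω = r} := fun i =>
      h.measurable_requestState i (measurableSet_singleton r)
    simp only [visits]
    rw [integral_finsetSum]
    · simp_rw [hi, integral_indicator_one (hm _), measureReal_def, h.measure_requestState]
      simp [statProb_nonneg]
    · intro i _
      rw [hi]
      exact (integrable_const 1).indicator (hm i)
  by_contra hne
  have hd : 0 < |statProb μ T X r - c| := abs_pos.2 (sub_ne_zero.2 (Ne.symm hne))
  -- the means differ from `c * n` by `d * n`; but `visits n - c * n` is at most `d / 3 * n` outside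
  -- of the event `E`, which contributes at most `d / 3 * n` for large `n`
  set d := |statProb μ T X r - c| with hdd
  have hK : 0 < 1 + |c| := by positivity
  have hlim2 := (ENNReal.tendsto_toReal ENNReal.zero_ne_top).comp (hlim (d / 3) (by positivity))
  rw [ENNReal.toReal_zero] at hlim2
  obtain ⟨n, hn1, hn2⟩ := ((eventually_gt_atTop 0).and
    (hlim2.eventually (gt_mem_nhds (show (0 : ℝ) < d / 3 / (1 + |c|) by positivity)))).exists
  have hn' : (0 : ℝ) < n := by exact_mod_cast hn1
  have hV : Integrable (visits T X τ r n) μ := Integrable.of_bound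
    (h.measurable_visits r n).aestronglyMeasurable n (Eventually.of_forall fun ω => by
      rw [Real.norm_eq_abs, abs_of_nonneg (hvis n ω).1]; exact (hvis n ω).2)
  let E : Set Ω := {ω | d / 3 * n ≤ |visits T X τ r n ω - c * n|}
  have hE : MeasurableSet E :=
    measurableSet_le measurable_const (((h.measurable_visits r n).sub_const _).abs)
  have h1 : n * d ≤ ∫ ω, |visits T X τ r n ω - c * n| ∂μ := by
    have h2 : ∫ ω, (visits T X τ r n ω - c * n) ∂μ = n * (statProb μ T X r - c) := by
      rw [integral_sub hV (integrable_const _), hmean]; simp; ring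
    have h3 := abs_integral_le_integral_abs (μ := μ) (f := fun ω => visits T X τ r n ω - c * n)
    rwa [h2, abs_mul, abs_of_pos hn'] at h3
  have h2 : ∫ ω, |visits T X τ r n ω - c * n| ∂μ ≤
      ∫ ω, (d / 3 * n + E.indicator (fun _ => (1 + |c|) * n) ω) ∂μ := by
    refine integral_mono (hV.sub (integrable_const _)).abs
      ((integrable_const _).add ((integrable_const _).indicator hE)) fun ω => ?_
    by_cases hω : ω ∈ E
    · simp only [Set.indicator_of_mem hω]
      have h4 := abs_sub (visits T X τ r n ω) (c * n)
      rw [abs_of_nonneg (hvis n ω).1, abs_mul, abs_of_pos hn'] at h4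
      have : 0 ≤ d / 3 * n := by positivity
      linarith [(hvis n ω).2]
    · simp only [Set.indicator_of_notMem hω, add_zero]
      exact (not_le.1 hω).le
  rw [integral_add (integrable_const _) ((integrable_const _).indicator hE),
    integral_indicator_const _ hE] at h2
  simp only [integral_const, probReal_univ, smul_eq_mul] at h2
  have h3 : μ.real E < d / 3 / (1 + |c|) := hn2
  rw [lt_div_iff₀ hK] at h3
  nlinarith

/-- Long windows of consecutive requests see every state about as often as it should be, with a
probability that does not depend on the position of the window, because the states at the requests
are stationary. -/
theorem exists_window (h : IsSemiMarkovModulated μ p F q T X τ R) (hπ : ∀ r, 0 < statProb μ T X r)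
    {ε : ℝ} (hε : 0 < ε) : ∃ N : ℕ, 0 < N ∧ ∀ m, μ {ω | ∃ r,
      ∑ j ∈ Finset.range N, (if requestState T X τ (m + j) ω = r then (1 : ℝ) else 0) <
        (1 - ε) * statProb μ T X r * N} ≤ ENNReal.ofReal ε := by
  have h1 : Tendsto (fun n : ℕ => ∑ r, μ {ω | ε * statProb μ T X r * n ≤ |visits T X τ r n ω -
      statProb μ T X r * n|}) atTop (𝓝 0) := by
    simpa using tendsto_finsetSum Finset.univ fun r _ =>
      h.tendsto_visits r (mul_pos hε (hπ r))
  obtain ⟨N, hN0, hN⟩ := ((eventually_gt_atTop 0).and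
    (h1.eventually (Iic_mem_nhds (ENNReal.ofReal_pos.2 hε)))).exists
  refine ⟨N, hN0, fun m => ?_⟩
  let B : Set (Fin N → Fin M) := {x | ∃ r, ∑ j : Fin N, (if x j = r then (1 : ℝ) else 0) <
    (1 - ε) * statProb μ T X r * N}
  have hB : ∀ m, {ω | ∃ r,
      ∑ j ∈ Finset.range N, (if requestState T X τ (m + j) ω = r then (1 : ℝ) else 0) <
        (1 - ε) * statProb μ T X r * N} =
          (fun ω (j : Fin N) => requestState T X τ (m + j) ω) ⁻¹' B :=
    fun m => by
      ext ω
      simp only [B, Set.mem_preimage, Set.mem_ofPred_eq]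
      simp_rw [Finset.sum_range]
  have hY : ∀ m, Measurable fun ω (j : Fin N) => requestState T X τ (m + j) ω := fun m =>
    measurable_pi_iff.2 fun j => h.measurable_requestState _
  have hz := hY 0
  have hB0 := hB 0
  simp only [zero_add] at hz hB0
  rw [hB m, ← Measure.map_apply (hY m) (Set.toFinite B).measurableSet, h.map_requestState m N,
    Measure.map_apply hz (Set.toFinite B).measurableSet, ← hB0]
  refine le_trans ?_ hN
  refine le_trans (measure_mono ?_) (measure_biUnion_finset_le Finset.univ _)
  rintro ω ⟨r, hr⟩
  refine Set.mem_biUnion (Finset.mem_univ r) ?_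
  change ε * statProb μ T X r * N ≤ |visits T X τ r N ω - statProb μ T X r * N|
  rw [abs_sub_comm]
  refine le_trans ?_ (le_abs_self _)
  change visits T X τ r N ω < _ at hr
  linarith

end IsSemiMarkovModulated

/-! ### Requests in a window -/

namespace CachingPolicy

variable {x : ℕ} (π : CachingPolicy x) (r : ℕ → ℕ)

theorem content_succ_subset (n : ℕ) : π.content r (n + 1) ⊆ insert (r n) (π.content r n) := by
  by_cases h : r n ∈ π.content r n
  · rw [π.hit r n h]; exact Finset.subset_insert _ _
  · obtain ⟨e, -, he⟩ := π.miss r n h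
    rw [he]; exact Finset.erase_subset _ _

theorem card_content (n : ℕ) : (π.content r n).card = x := by
  induction n with
  | zero => exact π.card_initial r
  | succ n ih =>
    by_cases h : r n ∈ π.content r n
    · rw [π.hit r n h, ih]
    · obtain ⟨e, he, heq⟩ := π.miss r n h
      rw [heq, Finset.card_erase_of_mem he, Finset.card_insert_of_notMem h, ih]
      rfl

/-- A document that is not in the cache stays out of it until it is requested. -/
theorem notMem_content_of_forall_ne {i m : ℕ} (hi : i ∉ π.content r m) (n : ℕ)
    (hn : ∀ j < n, r (m + j) ≠ i) : i ∉ π.content r (m + n) := by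
  induction n with
  | zero => simpa using hi
  | succ n ih =>
    intro hmem
    have h1 := π.content_succ_subset r (m + n) hmem
    rcases Finset.mem_insert.1 h1 with h2 | h2
    · exact hn n (Nat.lt_succ_self n) h2.symm
    · exact ih (fun j hj => hn j (hj.trans (Nat.lt_succ_self n))) h2

/-- A document missing from the cache at the start of a window and requested in the window causes
a miss: its first request in the window does. -/
theorem exists_miss_of_request {i m N : ℕ} (hi : i ∉ π.content r m) (h : ∃ j < N, r (m + j) = i) :
    ∃ j < N, r (m + j) = i ∧ i ∉ π.content r (m + j) := by
  classical
  have hex : ∃ j, r (m + j) = i := let ⟨j, _, hj⟩ := h; ⟨j, hj⟩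
  refine ⟨Nat.find hex, ?_, Nat.find_spec hex,
    π.notMem_content_of_forall_ne r hi _ fun j hj => Nat.find_min hex hj⟩
  obtain ⟨j, hj, hji⟩ := h
  exact (Nat.find_min' hex hji).trans_lt hj

end CachingPolicy

/-- The second Bonferroni inequality. -/
theorem sum_measureReal_le_biUnion_add {Ω : Type*} [MeasurableSpace Ω] (μ : Measure Ω)
    [IsFiniteMeasure μ] {A : ℕ → Set Ω} (hA : ∀ j, MeasurableSet (A j)) (N : ℕ) :
    ∑ j ∈ Finset.range N, μ.real (A j) ≤ μ.real (⋃ j ∈ Finset.range N, A j) +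
      ∑ j ∈ Finset.range N, ∑ l ∈ Finset.range j, μ.real (A l ∩ A j) := by
  induction N with
  | zero => simp
  | succ N ih =>
    rw [Finset.sum_range_succ, Finset.sum_range_succ]
    have h1 : ⋃ j ∈ Finset.range (N + 1), A j = (⋃ j ∈ Finset.range N, A j) ∪ A N := by
      rw [Finset.range_add_one, Finset.set_biUnion_insert, Set.union_comm]
    have h2 := measureReal_union_add_inter (μ := μ) (s := ⋃ j ∈ Finset.range N, A j) (hA N)
      (measure_ne_top _ _)
    have h3 : μ.real ((⋃ j ∈ Finset.range N, A j) ∩ A N) ≤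
        ∑ l ∈ Finset.range N, μ.real (A l ∩ A N) := by
      rw [Set.iUnion₂_inter]
      exact measureReal_biUnion_finset_le _ _
    rw [h1]
    linarith

namespace IsSemiMarkovModulated

variable {Ω : Type*} [MeasurableSpace Ω] {μ : Measure Ω} {M : ℕ}
  {p : Matrix (Fin M) (Fin M) ℝ} {F : Fin M → Fin M → Measure ℝ} {q : Fin M → PMF ℕ}
  {T : ℕ → Ω → ℝ} {X : ℕ → Ω → Fin M} {τ : ℕ → Ω → ℝ} {R : ℕ → Ω → ℕ}

/-- The jump path together with the Poisson points: the environment of the requests. -/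
def environment (T : ℕ → Ω → ℝ) (X : ℕ → Ω → Fin M) (τ : ℕ → Ω → ℝ) (ω : Ω) :
    (ℕ → ℝ × Fin M) × (ℕ → ℝ) := (fun n => (T n ω, X n ω), fun n => τ n ω)

theorem measurable_environment (h : IsSemiMarkovModulated μ p F q T X τ R) :
    Measurable (environment T X τ) := h.measurable_jumps.prodMk h.measurable_points

/-- The state at the request number `n` as a function of the environment. -/
noncomputable def envState (n : ℕ) (y : (ℕ → ℝ × Fin M) × (ℕ → ℝ)) : Fin M :=
  jumpPath (fun k => (y.1 k).1) (fun k => (y.1 k).2) (y.2 n)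

theorem measurable_envState (n : ℕ) : Measurable (envState (M := M) n) := by
  have hn : Measurable fun y : (ℕ → ℝ × Fin M) × (ℕ → ℝ) => y.2 n := by fun_prop
  exact measurable_jumpPath.comp (measurable_fst.prodMk hn)

variable [IsProbabilityMeasure μ]

/-- The conditional law of the requests given the environment, integrated over an event of the
environment. -/
theorem measureReal_cylinder (h : IsSemiMarkovModulated μ p F q T X τ R)
    {D : Set ((ℕ → ℝ × Fin M) × (ℕ → ℝ))} (hD : MeasurableSet D) (n : ℕ) (i : ℕ → ℕ) :
    μ.real (environment T X τ ⁻¹' D ∩ {ω | ∀ l < n, R l ω = i l}) =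
      ∫ ω in environment T X τ ⁻¹' D, ∏ l ∈ Finset.range n,
        (q (requestState T X τ l ω) (i l)).toReal ∂μ := by
  have hm : MeasurableSpace.comap (environment T X τ) inferInstance ≤ ‹MeasurableSpace Ω› :=
    h.measurable_environment.comap_le
  have hC : MeasurableSet {ω | ∀ l < n, R l ω = i l} := by
    simp only [Set.ofPred_forall]
    exact .iInter fun l => .iInter fun _ => h.measurable_R l (measurableSet_singleton (i l))
  have h1 := setIntegral_condExp (μ := μ) hm
    (f := {ω | ∀ l < n, R l ω = i l}.indicator fun _ => (1 : ℝ))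
    ((integrable_const 1).indicator hC) (s := environment T X τ ⁻¹' D) ⟨D, hD, rfl⟩
  have h2 := setIntegral_congr_ae (μ := μ) (s := environment T X τ ⁻¹' D)
    (h.measurable_environment hD) ((h.requests n i).mono fun ω hω _ => hω)
  rw [← Set.inter_comm, measureReal_def, ← Measure.restrict_apply hC, ← measureReal_def,
    ← integral_indicator_one hC]
  exact h1.symm.trans h2

/-- The requests before the request number `n`. -/
def requestHistory (R : ℕ → Ω → ℕ) (n : ℕ) (ω : Ω) (l : Fin n) : ℕ := R l ω

/-- Given the environment and the earlier requests, the request number `n` has the law `q r` if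
the state at its time is `r`. -/
theorem measure_request_eq (h : IsSemiMarkovModulated μ p F q T X τ R)
    {D : Set ((ℕ → ℝ × Fin M) × (ℕ → ℝ))} (hD : MeasurableSet D) (n i : ℕ) (r : Fin M)
    (B : Set (Fin n → ℕ)) :
    μ ((environment T X τ ⁻¹' D ∩ requestHistory R n ⁻¹' B ∩ {ω | R n ω = i}) ∩
        {ω | requestState T X τ n ω = r}) =
      q r i * μ ((environment T X τ ⁻¹' D ∩ requestHistory R n ⁻¹' B) ∩
        {ω | requestState T X τ n ω = r}) := by
  have hH : Measurable (requestHistory R n) := measurable_pi_iff.2 fun l => h.measurable_R l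
  have hR : MeasurableSet {ω | R n ω = i} := h.measurable_R n (measurableSet_singleton i)
  let D' := D ∩ envState n ⁻¹' {r}
  have hD' : MeasurableSet D' := hD.inter (measurable_envState n (measurableSet_singleton r))
  have hED : MeasurableSet (environment T X τ ⁻¹' D') := h.measurable_environment hD'
  -- measures on the countable set of histories are compared at single histories
  have key : (μ.restrict (environment T X τ ⁻¹' D' ∩ {ω | R n ω = i})).map (requestHistory R n) =
      q r i • (μ.restrict (environment T X τ ⁻¹' D')).map (requestHistory R n) := by
    refine Measure.ext_of_singleton fun v => ?_
    rw [Measure.smul_apply, Measure.map_apply hH (measurableSet_singleton v),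
      Measure.map_apply hH (measurableSet_singleton v),
      Measure.restrict_apply (hH (measurableSet_singleton v)),
      Measure.restrict_apply (hH (measurableSet_singleton v)), smul_eq_mul]
    let w : ℕ → ℕ := fun k => if hk : k < n then v ⟨k, hk⟩ else i
    have hw : ∀ k (hk : k < n), w k = v ⟨k, hk⟩ := fun k hk => by simp [w, hk]
    have hwn : w n = i := by simp [w]
    have e1 : requestHistory R n ⁻¹' {v} ∩ (environment T X τ ⁻¹' D' ∩ {ω | R n ω = i}) =
        environment T X τ ⁻¹' D' ∩ {ω | ∀ l < n + 1, R l ω = w l} := by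
      ext ω
      simp only [Set.mem_inter_iff, Set.mem_preimage, Set.mem_singleton_iff, Set.mem_ofPred_eq,
        funext_iff, requestHistory]
      constructor
      · rintro ⟨h1, h2, h3⟩
        refine ⟨h2, fun l hl => ?_⟩
        rcases Nat.lt_succ_iff_lt_or_eq.1 hl with hl | rfl
        · rw [hw l hl]; exact h1 ⟨l, hl⟩
        · rw [hwn, h3]
      · rintro ⟨h1, h2⟩
        exact ⟨fun l => (h2 l (by omega)).trans (hw l l.2), h1, (h2 n (by omega)).trans hwn⟩
    have e2 : requestHistory R n ⁻¹' {v} ∩ environment T X τ ⁻¹' D' =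
        environment T X τ ⁻¹' D' ∩ {ω | ∀ l < n, R l ω = w l} := by
      ext ω
      simp only [Set.mem_inter_iff, Set.mem_preimage, Set.mem_singleton_iff, Set.mem_ofPred_eq,
        funext_iff, requestHistory]
      constructor
      · rintro ⟨h1, h2⟩
        exact ⟨h2, fun l hl => (h1 ⟨l, hl⟩).trans (hw l hl).symm⟩
      · rintro ⟨h1, h2⟩
        exact ⟨fun l => (h2 l l.2).trans (hw l l.2), h1⟩
    rw [e1, e2, ← ENNReal.toReal_eq_toReal_iff' (measure_ne_top _ _)
      (ENNReal.mul_ne_top ((q r).apply_ne_top i) (measure_ne_top _ _)), ENNReal.toReal_mul]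
    change μ.real _ = _ * μ.real _
    rw [h.measureReal_cylinder hD', h.measureReal_cylinder hD', ← integral_const_mul]
    refine setIntegral_congr_fun hED fun ω hω => ?_
    have hstate : requestState T X τ n ω = r := hω.2
    simp only [Finset.prod_range_succ, hstate, hwn]
    ring
  have h1 := congrArg (fun ν : Measure (Fin n → ℕ) => ν B) key
  have hB : MeasurableSet B := B.to_countable.measurableSet
  simp only [Measure.smul_apply, Measure.map_apply hH hB, Measure.restrict_apply (hH hB),
    smul_eq_mul] at h1
  have e1 : (environment T X τ ⁻¹' D ∩ requestHistory R n ⁻¹' B ∩ {ω | R n ω = i}) ∩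
      {ω | requestState T X τ n ω = r} =
      requestHistory R n ⁻¹' B ∩ (environment T X τ ⁻¹' D' ∩ {ω | R n ω = i}) := by
    ext ω
    change ((_ ∧ _) ∧ _) ∧ envState n (environment T X τ ω) = r ↔
      _ ∧ ((_ ∧ envState n (environment T X τ ω) = r) ∧ _)
    tauto
  have e2 : (environment T X τ ⁻¹' D ∩ requestHistory R n ⁻¹' B) ∩
      {ω | requestState T X τ n ω = r} =
      requestHistory R n ⁻¹' B ∩ environment T X τ ⁻¹' D' := by
    ext ω
    change (_ ∧ _) ∧ envState n (environment T X τ ω) = r ↔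
      _ ∧ (_ ∧ envState n (environment T X τ ω) = r)
    tauto
  rw [e1, e2, h1]

/-- The mass of an event is the sum over the states at the request number `n`. -/
theorem sum_measureReal_requestState (h : IsSemiMarkovModulated μ p F q T X τ R) (n : ℕ)
    {A : Set Ω} (hA : MeasurableSet A) :
    ∑ r, μ.real (A ∩ {ω | requestState T X τ n ω = r}) = μ.real A := by
  have h1 := sum_restrict_fiber μ (h.measurable_requestState n)
  have h2 := congrArg (fun ν : Measure Ω => (ν A).toReal) h1
  simp only [Measure.finsetSum_apply, Measure.restrict_apply hA] at h2
  rwa [ENNReal.toReal_sum fun r _ => measure_ne_top _ _] at h2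

variable {D : Set ((ℕ → ℝ × Fin M) × (ℕ → ℝ))} {P : (ℕ → ℕ) → Prop}

omit [MeasurableSpace Ω] [IsProbabilityMeasure μ] in
/-- An event that depends on the first `n` requests only, as a set of histories. -/
theorem exists_history_set {n : ℕ} (hP : ∀ r r' : ℕ → ℕ, (∀ k < n, r k = r' k) → (P r ↔ P r')) :
    ∃ B : Set (Fin n → ℕ), {ω | P fun k => R k ω} = requestHistory R n ⁻¹' B := by
  refine ⟨{v | P fun k => if hk : k < n then v ⟨k, hk⟩ else 0}, ?_⟩
  ext ω
  exact hP _ _ fun k hk => by simp [hk, requestHistory]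

/-- The probability of a request for `i`, jointly with an event of the environment and the earlier
requests. -/
theorem measureReal_request (h : IsSemiMarkovModulated μ p F q T X τ R) (hD : MeasurableSet D)
    (n i : ℕ) (hP : ∀ r r' : ℕ → ℕ, (∀ k < n, r k = r' k) → (P r ↔ P r')) :
    μ.real (environment T X τ ⁻¹' D ∩ {ω | P fun k => R k ω} ∩ {ω | R n ω = i}) =
      ∑ r, (q r i).toReal * μ.real (environment T X τ ⁻¹' D ∩ {ω | P fun k => R k ω} ∩
        {ω | requestState T X τ n ω = r}) := by
  obtain ⟨B, hB⟩ := exists_history_set (R := R) hP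
  have hH : Measurable (requestHistory R n) := measurable_pi_iff.2 fun l => h.measurable_R l
  have hBm : MeasurableSet B := B.to_countable.measurableSet
  have hRm : MeasurableSet {ω | R n ω = i} := h.measurable_R n (measurableSet_singleton i)
  rw [hB, ← h.sum_measureReal_requestState n
    (((h.measurable_environment hD).inter (hH hBm)).inter hRm)]
  refine Finset.sum_congr rfl fun r _ => ?_
  rw [measureReal_def, h.measure_request_eq hD n i r B, ENNReal.toReal_mul]
  rfl

omit [IsProbabilityMeasure μ] in
theorem measurableSet_history (h : IsSemiMarkovModulated μ p F q T X τ R) {n : ℕ}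
    (hP : ∀ r r' : ℕ → ℕ, (∀ k < n, r k = r' k) → (P r ↔ P r')) :
    MeasurableSet {ω | P fun k => R k ω} := by
  obtain ⟨B, hB⟩ := exists_history_set (R := R) hP
  have hH : Measurable (requestHistory R n) := measurable_pi_iff.2 fun l => h.measurable_R l
  rw [hB]
  exact hH B.to_countable.measurableSet

theorem measureReal_request_le (h : IsSemiMarkovModulated μ p F q T X τ R) (hD : MeasurableSet D)
    (n i : ℕ) (hP : ∀ r r' : ℕ → ℕ, (∀ k < n, r k = r' k) → (P r ↔ P r')) {b : ℝ}
    (hb : ∀ r, (q r i).toReal ≤ b) :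
    μ.real (environment T X τ ⁻¹' D ∩ {ω | P fun k => R k ω} ∩ {ω | R n ω = i}) ≤
      b * μ.real (environment T X τ ⁻¹' D ∩ {ω | P fun k => R k ω}) := by
  rw [h.measureReal_request hD n i hP, ← h.sum_measureReal_requestState n
    ((h.measurable_environment hD).inter (h.measurableSet_history hP)), Finset.mul_sum]
  exact Finset.sum_le_sum fun r _ => mul_le_mul_of_nonneg_right (hb r) measureReal_nonneg

/-- If in the window every state is seen about as often as it should be, then the expected number
of requests for `i` in the window is about what it should be, given the past. -/
theorem le_sum_measureReal_request (h : IsSemiMarkovModulated μ p F q T X τ R)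
    (hD : MeasurableSet D) {m N : ℕ} {ε : ℝ} (hDN : ∀ y ∈ D, ∀ r, (1 - ε) *
      statProb μ T X r * N ≤ ∑ j ∈ Finset.range N, if envState (m + j) y = r then (1 : ℝ) else 0)
    (i : ℕ) (hP : ∀ r r' : ℕ → ℕ, (∀ k < m, r k = r' k) → (P r ↔ P r')) :
    (1 - ε) * N * popularity μ q T X i *
        μ.real (environment T X τ ⁻¹' D ∩ {ω | P fun k => R k ω}) ≤
      ∑ j ∈ Finset.range N,
        μ.real (environment T X τ ⁻¹' D ∩ {ω | P fun k => R k ω} ∩ {ω | R (m + j) ω = i}) := by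
  have hPj : ∀ j, ∀ r r' : ℕ → ℕ, (∀ k < m + j, r k = r' k) → (P r ↔ P r') := fun j r r' hr =>
    hP r r' fun k hk => hr k (by omega)
  simp_rw [fun j => h.measureReal_request hD (m + j) i (hPj j)]
  rw [Finset.sum_comm]
  set A := environment T X τ ⁻¹' D ∩ {ω | P fun k => R k ω} with hAdef
  have hA : MeasurableSet A := (h.measurable_environment hD).inter (h.measurableSet_history hP)
  have hr : ∀ r, (1 - ε) * statProb μ T X r * N * μ.real A ≤
      ∑ j ∈ Finset.range N, μ.real (A ∩ {ω | requestState T X τ (m + j) ω = r}) := by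
    intro r
    have hm : ∀ j, MeasurableSet {ω | requestState T X τ (m + j) ω = r} := fun j =>
      h.measurable_requestState _ (measurableSet_singleton r)
    have hi : ∀ j, (fun ω => if requestState T X τ (m + j) ω = r then (1 : ℝ) else 0) =
        {ω | requestState T X τ (m + j) ω = r}.indicator 1 := fun j => by
      ext ω; simp [Set.indicator_apply]
    have hint : ∀ j, Integrable (fun ω => if requestState T X τ (m + j) ω = r then (1 : ℝ) else 0)
        (μ.restrict A) := fun j => by
      rw [hi]
      exact (integrable_const 1).indicator (hm j)
    have e1 : ∀ j, μ.real (A ∩ {ω | requestState T X τ (m + j) ω = r}) =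
        ∫ ω in A, (if requestState T X τ (m + j) ω = r then (1 : ℝ) else 0) ∂μ := fun j => by
      rw [hi, integral_indicator_one (hm j), measureReal_def, measureReal_def,
        Measure.restrict_apply (hm j), Set.inter_comm]
    simp_rw [e1]
    rw [← integral_finsetSum _ fun j _ => hint j]
    have e2 : (1 - ε) * statProb μ T X r * N * μ.real A =
        ∫ _ in A, (1 - ε) * statProb μ T X r * N ∂μ := by simp [mul_comm]
    rw [e2]
    exact setIntegral_mono_on (integrable_const _) (integrable_finsetSum _ fun j _ => hint j) hA
      fun ω hω => hDN _ hω.1 r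
  calc (1 - ε) * N * popularity μ q T X i * μ.real A
      = ∑ r, (q r i).toReal * ((1 - ε) * statProb μ T X r * N * μ.real A) := by
        rw [popularity, Finset.mul_sum, Finset.sum_mul]
        exact Finset.sum_congr rfl fun r _ => by ring
    _ ≤ _ := Finset.sum_le_sum fun r _ => by
        rw [← Finset.mul_sum]
        exact mul_le_mul_of_nonneg_left (hr r) ENNReal.toReal_nonneg

/-- The event that `i` is requested in the window of length `N` starting at `m`. -/
def requestedIn (R : ℕ → Ω → ℕ) (m N i : ℕ) : Set Ω := {ω | ∃ j < N, R (m + j) ω = i}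

omit [MeasurableSpace Ω] in
theorem inter_requestedIn (A : Set Ω) (m N i : ℕ) :
    A ∩ requestedIn R m N i = ⋃ j ∈ Finset.range N, A ∩ {ω | R (m + j) ω = i} := by
  ext ω
  simp [requestedIn]

/-- Any document is requested in the window with at least the probability of a request for it at a
uniformly chosen position of the window. -/
theorem le_measureReal_requestedIn (h : IsSemiMarkovModulated μ p F q T X τ R)
    (hD : MeasurableSet D) {m N : ℕ} (hN : 0 < N) {ε : ℝ} (hDN : ∀ y ∈ D, ∀ r, (1 - ε) *
      statProb μ T X r * N ≤ ∑ j ∈ Finset.range N, if envState (m + j) y = r then (1 : ℝ) else 0)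
    (i : ℕ) (hP : ∀ r r' : ℕ → ℕ, (∀ k < m, r k = r' k) → (P r ↔ P r')) :
    (1 - ε) * popularity μ q T X i *
        μ.real (environment T X τ ⁻¹' D ∩ {ω | P fun k => R k ω}) ≤
      μ.real (environment T X τ ⁻¹' D ∩ {ω | P fun k => R k ω} ∩ requestedIn R m N i) := by
  have h1 := h.le_sum_measureReal_request hD hDN i hP
  have h2 := h1.trans (Finset.sum_le_card_nsmul _ _ _ fun j hj => measureReal_mono
    (s₂ := environment T X τ ⁻¹' D ∩ {ω | P fun k => R k ω} ∩ requestedIn R m N i)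
    (Set.inter_subset_inter_right _ fun ω hω => ⟨j, Finset.mem_range.1 hj, hω⟩))
  rw [Finset.card_range, nsmul_eq_mul] at h2
  have hN' : (0 : ℝ) < N := by exact_mod_cast hN
  refine le_of_mul_le_mul_left (le_trans (le_of_eq ?_) h2) hN'
  ring

/-- A rare document is hardly ever requested twice in the window, so that the probability of a
request in the window is about the expected number of requests. -/
theorem le_measureReal_requestedIn_of_rare (h : IsSemiMarkovModulated μ p F q T X τ R)
    (hD : MeasurableSet D) {m N : ℕ} (hN : 0 < N) {ε : ℝ} (hε : ε ≤ 1)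
    (hDN : ∀ y ∈ D, ∀ r, (1 - ε) * statProb μ T X r * N ≤
      ∑ j ∈ Finset.range N, if envState (m + j) y = r then (1 : ℝ) else 0)
    {i : ℕ} (hi : ∀ r, (q r i).toReal ≤ ε / N)
    (hP : ∀ r r' : ℕ → ℕ, (∀ k < m, r k = r' k) → (P r ↔ P r')) :
    (1 - ε) ^ 2 * N * popularity μ q T X i *
        μ.real (environment T X τ ⁻¹' D ∩ {ω | P fun k => R k ω}) ≤
      μ.real (environment T X τ ⁻¹' D ∩ {ω | P fun k => R k ω} ∩ requestedIn R m N i) := by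
  have h1 := h.le_sum_measureReal_request hD hDN i hP
  set A := environment T X τ ⁻¹' D ∩ {ω | P fun k => R k ω} with hAdef
  have hA : MeasurableSet A := (h.measurable_environment hD).inter (h.measurableSet_history hP)
  have hN' : (0 : ℝ) < N := by exact_mod_cast hN
  have hpair : ∀ j, ∀ l ∈ Finset.range j,
      μ.real ((A ∩ {ω | R (m + l) ω = i}) ∩ (A ∩ {ω | R (m + j) ω = i})) ≤
        ε / N * μ.real (A ∩ {ω | R (m + l) ω = i}) := by
    intro j l hl
    rw [Finset.mem_range] at hl
    have h2 := h.measureReal_request_le (P := fun r => P r ∧ r (m + l) = i) hD (m + j) i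
      (fun r r' hr => by rw [hP r r' fun k hk => hr k (by omega), hr (m + l) (by omega)]) hi
    have e1 : {ω | P (fun k => R k ω) ∧ R (m + l) ω = i} =
        {ω | P fun k => R k ω} ∩ {ω | R (m + l) ω = i} := rfl
    rw [e1, ← Set.inter_assoc, ← hAdef] at h2
    refine le_trans (measureReal_mono ?_) h2
    exact Set.inter_subset_inter_right _ Set.inter_subset_right
  have h3 := sum_measureReal_le_biUnion_add μ (A := fun j => A ∩ {ω | R (m + j) ω = i})
    (fun j => hA.inter (h.measurable_R _ (measurableSet_singleton i))) N
  rw [← inter_requestedIn] at h3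
  have h4 : ∑ j ∈ Finset.range N, ∑ l ∈ Finset.range j,
      μ.real ((A ∩ {ω | R (m + l) ω = i}) ∩ (A ∩ {ω | R (m + j) ω = i})) ≤
      ε * ∑ l ∈ Finset.range N, μ.real (A ∩ {ω | R (m + l) ω = i}) := by
    have hε0 : ∀ r : Fin M, 0 ≤ ε / N := fun r => ENNReal.toReal_nonneg.trans (hi r)
    have hΩ : Nonempty Ω := μ.nonempty_of_neZero
    have hε0 := hε0 (X 0 (Classical.arbitrary Ω))
    calc _ ≤ ∑ j ∈ Finset.range N, ε / N *
          ∑ l ∈ Finset.range N, μ.real (A ∩ {ω | R (m + l) ω = i}) := by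
          refine Finset.sum_le_sum fun j hj => ?_
          refine (Finset.sum_le_sum (hpair j)).trans ?_
          rw [← Finset.mul_sum]
          refine mul_le_mul_of_nonneg_left (Finset.sum_le_sum_of_subset_of_nonneg ?_
            fun _ _ _ => measureReal_nonneg) hε0
          exact Finset.range_subset_range.2 (Finset.mem_range.1 hj).le
      _ = _ := by
          rw [Finset.sum_const, Finset.card_range, nsmul_eq_mul]
          field_simp
  have h5 := mul_le_mul_of_nonneg_left h1 (sub_nonneg.2 hε)
  calc _ = (1 - ε) * ((1 - ε) * N * popularity μ q T X i * μ.real A) := by ring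
    _ ≤ _ := by linarith

end IsSemiMarkovModulated

/-! ### The long-run cost -/

/-- The total weight of the documents outside of `C`. -/
noncomputable def missedMass (b : ℕ → ℝ≥0∞) (C : Finset ℕ) : ℝ≥0∞ :=
  ∑' i, if i ∈ C then 0 else b i

section MissedMass

variable {b : ℕ → ℝ≥0∞}

theorem missedMass_eq_add (S C : Finset ℕ) :
    missedMass b S = missedMass b (S ∪ C) + ∑ i ∈ C \ S, b i := by
  have h1 : ∑ i ∈ C \ S, b i = ∑' i, if i ∈ C \ S then b i else 0 := by
    rw [tsum_eq_sum (s := C \ S) fun i hi => if_neg hi]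
    exact Finset.sum_congr rfl fun i hi => (if_pos hi).symm
  rw [h1, missedMass, missedMass, ← ENNReal.tsum_add]
  refine tsum_congr fun i => ?_
  by_cases hS : i ∈ S <;> by_cases hC : i ∈ C <;> simp [hS, hC]

/-- The documents of largest weight leave the smallest weight outside. -/
theorem missedMass_le_of_card_eq {S C : Finset ℕ} (hcard : S.card = C.card)
    (hS : ∀ i ∈ S, ∀ j ∉ S, b j ≤ b i) : missedMass b S ≤ missedMass b C := by
  rw [missedMass_eq_add S C, missedMass_eq_add C S, Finset.union_comm C S]
  gcongr 1
  have hc : (C \ S).card = (S \ C).card := by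
    have h1 := Finset.card_sdiff_add_card_inter C S
    have h2 := Finset.card_sdiff_add_card_inter S C
    rw [Finset.inter_comm] at h2
    omega
  rcases (S \ C).eq_empty_or_nonempty with h | h
  · rw [h, Finset.card_empty, Finset.card_eq_zero] at hc
    rw [hc, h]
  · obtain ⟨i, hi, hmin⟩ := (S \ C).exists_min_image b h
    calc ∑ j ∈ C \ S, b j ≤ (C \ S).card • b i := Finset.sum_le_card_nsmul _ _ _ fun j hj =>
          hS i (Finset.mem_sdiff.1 hi).1 j (Finset.mem_sdiff.1 hj).2
      _ = (S \ C).card • b i := by rw [hc]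
      _ ≤ _ := Finset.card_nsmul_le_sum _ _ _ hmin

theorem tendsto_missedMass {S : ℕ → Finset ℕ} (hcard : ∀ x, (S x).card = x)
    (hS : ∀ x, ∀ i ∈ S x, ∀ j ∉ S x, b j ≤ b i) (hb : ∑' i, b i ≠ ∞) :
    Tendsto (fun x => missedMass b (S x)) atTop (𝓝 0) := by
  have h1 := (ENNReal.tendsto_tsum_compl_atTop_zero hb).comp tendsto_finset_range
  refine tendsto_of_tendsto_of_tendsto_of_le_of_le tendsto_const_nhds h1 (fun _ => zero_le)
    fun x => ?_
  refine (missedMass_le_of_card_eq (C := Finset.range x) (by simp [hcard]) (hS x)).trans_eq ?_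
  change _ = ∑' i : ((Finset.range x : Set ℕ)ᶜ : Set ℕ), b i
  rw [tsum_subtype]
  refine tsum_congr fun i => ?_
  by_cases hi : i ∈ Finset.range x
  · rw [if_pos hi, Set.indicator_of_notMem (by simpa using hi)]
  · rw [if_neg hi, Set.indicator_of_mem (by simpa using hi)]

theorem le_missedMass {C : Finset ℕ} {i : ℕ} (hi : i ∉ C) : b i ≤ missedMass b C := by
  refine le_trans ?_ (ENNReal.le_tsum i)
  rw [if_neg hi]

/-- If the weights `b'` are at least `a` times the weights `b` outside of a finite set `I`, and
positive on `I`, then for a large cache the weight `b'` left outside by any content is at least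
`a` times the smallest weight `b` that can be left outside: a content that leaves out a document
of `I` leaves too much weight outside. -/
theorem eventually_mul_missedMass_le {b' : ℕ → ℝ≥0∞} {a : ℝ≥0∞} (ha : a ≠ ∞) {S : ℕ → Finset ℕ}
    (hcard : ∀ x, (S x).card = x) (hS : ∀ x, ∀ i ∈ S x, ∀ j ∉ S x, b j ≤ b i)
    (hb : ∑' i, b i ≠ ∞) (I : Finset ℕ) (hI : ∀ i ∉ I, a * b i ≤ b' i) (hpos : ∀ i ∈ I, 0 < b' i) :
    ∀ᶠ x in atTop, ∀ C : Finset ℕ, C.card = x → a * missedMass b (S x) ≤ missedMass b' C := by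
  have h1 : Tendsto (fun x => a * missedMass b (S x)) atTop (𝓝 0) := by
    simpa using ENNReal.Tendsto.const_mul (tendsto_missedMass hcard hS hb) (Or.inr ha)
  have h2 : ∀ᶠ x in atTop, ∀ i ∈ I, a * missedMass b (S x) ≤ b' i :=
    (Finset.eventually_all I).2 fun i hi => h1.eventually (Iic_mem_nhds (hpos i hi))
  filter_upwards [h2] with x hx C hC
  by_cases hIC : I ⊆ C
  · refine (mul_le_mul_right (missedMass_le_of_card_eq ((hcard x).trans hC.symm) (hS x)) a).trans ?_
    rw [missedMass, missedMass, ← ENNReal.tsum_mul_left]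
    refine ENNReal.tsum_le_tsum fun i => ?_
    by_cases hi : i ∈ C
    · simp [hi]
    · simpa [hi] using hI i fun h => hi (hIC h)
  · obtain ⟨i, hi, hiC⟩ := Finset.not_subset.1 hIC
    exact (hx i hi).trans (le_missedMass hiC)

end MissedMass

/-- The point number `n` of a unit rate Poisson process does not exceed `n` by a positive
proportion, with a probability that tends to `1`. -/
theorem IsUnitPoisson.tendsto_measure_lt {Ω : Type*} [MeasurableSpace Ω] {μ : Measure Ω}
    [IsProbabilityMeasure μ] {τ : ℕ → Ω → ℝ} (h : IsUnitPoisson μ τ) {ε : ℝ} (hε : 0 < ε) :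
    Tendsto (fun n : ℕ => μ {ω | (1 + ε) * n < τ n ω}) atTop (𝓝 0) := by
  -- Chebyshev's inequality for the deviation `ε / 2 * n`, where `n + 1 - τ n` is the martingale of
  -- the constant function `1`, with second moment at most `6 * (n + 1) ≤ 12 * n`
  have h1 : Tendsto (fun n : ℕ => ENNReal.ofReal (48 / ε ^ 2 * (1 / (n : ℝ)))) atTop (𝓝 0) := by
    rw [← ENNReal.ofReal_zero]
    refine ENNReal.tendsto_ofReal ?_
    have := (tendsto_one_div_atTop_nhds_zero_nat (𝕜 := ℝ)).const_mul (48 / ε ^ 2)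
    rwa [mul_zero] at this
  refine tendsto_of_tendsto_of_tendsto_of_le_of_le' tendsto_const_nhds h1
    (Eventually.of_forall fun _ => zero_le) ?_
  filter_upwards [eventually_ge_atTop (max 1 ⌈2 / ε⌉₊)] with n hn
  have hn1 : (1 : ℝ) ≤ n := by exact_mod_cast (le_max_left _ _).trans hn
  have hn2 : 2 / ε ≤ n := (Nat.le_ceil _).trans (by exact_mod_cast (le_max_right _ _).trans hn)
  rw [div_le_iff₀ hε] at hn2
  have h01 : ∀ t : ℝ, (fun _ : ℝ => (1 : ℝ)) t ∈ Set.Icc (0 : ℝ) 1 := by simp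
  have hsum : ∀ ω, ∑ i ∈ Finset.range (n + 1), compensatedPoint τ (fun _ => 1) i ω =
      n + 1 - τ n ω := by
    intro ω
    rw [sum_compensatedPoint (by simp), prevPoint_succ]
    simp
  have h2 := h.integral_sum_compensatedPoint_sq_le measurable_const h01 (n + 1)
  simp_rw [hsum] at h2
  have hint : Integrable (fun ω => (n + 1 - τ n ω) ^ 2) μ := by
    have h3 : MemLp (fun ω => ∑ i ∈ Finset.range (n + 1),
        compensatedPoint τ (fun _ => 1) i ω) 2 μ :=
      memLp_finsetSum _ fun k _ => h.memLp_compensatedPoint measurable_const h01 k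
    simp_rw [hsum] at h3
    exact h3.integrable_sq
  have hpos : 0 < (ε / 2 * n) ^ 2 := by positivity
  have hτ := h.measurable n
  have h4 := meas_ge_le_lintegral_div (μ := μ)
    (f := fun ω => ENNReal.ofReal ((n + 1 - τ n ω) ^ 2)) (by fun_prop)
    (ε := ENNReal.ofReal ((ε / 2 * n) ^ 2)) (ENNReal.ofReal_pos.2 hpos).ne' ENNReal.ofReal_ne_top
  rw [← ofReal_integral_eq_lintegral_ofReal hint (Eventually.of_forall fun ω => sq_nonneg _),
    ← ENNReal.ofReal_div_of_pos hpos] at h4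
  refine (measure_mono fun ω (hω : (1 + ε) * n < τ n ω) => ?_).trans
    (h4.trans (ENNReal.ofReal_le_ofReal ?_))
  · refine ENNReal.ofReal_le_ofReal ?_
    rw [show (n + 1 - τ n ω) ^ 2 = (τ n ω - (n + 1)) ^ 2 by ring]
    exact pow_le_pow_left₀ (by positivity) (by linarith) 2
  · rw [div_le_iff₀ hpos]
    refine h2.trans ?_
    have : 48 / ε ^ 2 * (1 / (n : ℝ)) * (ε / 2 * n) ^ 2 = 12 * n := by
      field_simp
      norm_num
    rw [this]
    push_cast
    linarith

theorem sum_range_mul_eq {β : Type*} [AddCommMonoid β] (a : ℕ → β) (L N : ℕ) :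
    ∑ n ∈ Finset.range (L * N), a n =
      ∑ k ∈ Finset.range L, ∑ j ∈ Finset.range N, a (k * N + j) := by
  induction L with
  | zero => simp
  | succ L ih => rw [Nat.succ_mul, Finset.sum_range_add, ih, Finset.sum_range_succ]

open Classical in
/-- The cost of the request number `n`, which is zero unless the request is a miss. -/
noncomputable def missCost {Ω : Type*} (R : ℕ → Ω → ℕ) (f : ℕ → ℝ) {x : ℕ} (π : CachingPolicy x)
    (n : ℕ) (ω : Ω) : ℝ≥0∞ :=
  if R n ω ∉ π.content (fun k => R k ω) n then ENNReal.ofReal (f (R n ω)) else 0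

/-- The cost in a window is at least the cost of the documents that are missing from the cache at
its start and requested in it. -/
theorem tsum_requestedIn_le_sum_missCost {Ω : Type*} (R : ℕ → Ω → ℕ) (f : ℕ → ℝ) {x : ℕ}
    (π : CachingPolicy x) (m N : ℕ) (ω : Ω) :
    ∑' i, ENNReal.ofReal (f i) * ({ω | i ∉ π.content (fun k => R k ω) m} ∩
        IsSemiMarkovModulated.requestedIn R m N i).indicator 1 ω ≤
      ∑ j ∈ Finset.range N, missCost R f π (m + j) ω := by
  classical
  have h1 : ∀ j, missCost R f π (m + j) ω = ∑' i, if R (m + j) ω = i ∧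
      i ∉ π.content (fun k => R k ω) (m + j) then ENNReal.ofReal (f i) else 0 := by
    intro j
    rw [tsum_eq_single (R (m + j) ω) fun i hi => if_neg fun h => hi h.1.symm]
    simp [missCost]
  simp_rw [h1]
  rw [← Summable.tsum_finsetSum fun _ _ => ENNReal.summable]
  refine ENNReal.tsum_le_tsum fun i => ?_
  by_cases hi : ω ∈ {ω | i ∉ π.content (fun k => R k ω) m} ∩
      IsSemiMarkovModulated.requestedIn R m N i
  · obtain ⟨j, hj, h2⟩ := π.exists_miss_of_request _ hi.1 hi.2
    rw [Set.indicator_of_mem hi, Pi.one_apply, mul_one]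
    refine le_trans ?_ (Finset.single_le_sum (fun _ _ => zero_le) (Finset.mem_range.2 hj))
    rw [if_pos h2]
  · rw [Set.indicator_of_notMem hi, mul_zero]
    exact zero_le

namespace IsSemiMarkovModulated

variable {Ω : Type*} [MeasurableSpace Ω] {μ : Measure Ω} {M : ℕ}
  {p : Matrix (Fin M) (Fin M) ℝ} {F : Fin M → Fin M → Measure ℝ} {q : Fin M → PMF ℕ}
  {T : ℕ → Ω → ℝ} {X : ℕ → Ω → Fin M} {τ : ℕ → Ω → ℝ} {R : ℕ → Ω → ℕ}

theorem popularity_nonneg (μ : Measure Ω) (q : Fin M → PMF ℕ) (T : ℕ → Ω → ℝ) (X : ℕ → Ω → Fin M)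
    (i : ℕ) : 0 ≤ popularity μ q T X i :=
  Finset.sum_nonneg fun r _ => mul_nonneg (statProb_nonneg μ T X r) ENNReal.toReal_nonneg

theorem ofReal_popularity (μ : Measure Ω) (q : Fin M → PMF ℕ) (T : ℕ → Ω → ℝ) (X : ℕ → Ω → Fin M)
    (i : ℕ) : ENNReal.ofReal (popularity μ q T X i) =
      ∑ r, ENNReal.ofReal (statProb μ T X r) * q r i := by
  rw [popularity, ENNReal.ofReal_sum_of_nonneg fun r _ =>
    mul_nonneg (statProb_nonneg μ T X r) ENNReal.toReal_nonneg]
  refine Finset.sum_congr rfl fun r _ => ?_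
  rw [ENNReal.ofReal_mul (statProb_nonneg μ T X r), ENNReal.ofReal_toReal ((q r).apply_ne_top i)]

theorem tsum_popularity_mul_ne_top (μ : Measure Ω) (q : Fin M → PMF ℕ) (T : ℕ → Ω → ℝ)
    (X : ℕ → Ω → Fin M) {f : ℕ → ℝ} {K : ℝ} (hf : ∀ i, f i ≤ K) :
    ∑' i, ENNReal.ofReal (popularity μ q T X i * f i) ≠ ∞ := by
  have h1 : ∀ i, ENNReal.ofReal (popularity μ q T X i * f i) ≤
      (∑ r, ENNReal.ofReal (statProb μ T X r) * q r i) * ENNReal.ofReal K := fun i => by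
    rw [ENNReal.ofReal_mul (popularity_nonneg μ q T X i), ofReal_popularity]
    gcongr
    exact hf i
  refine ne_top_of_le_ne_top ?_ (ENNReal.tsum_le_tsum h1)
  rw [ENNReal.tsum_mul_right, Summable.tsum_finsetSum fun _ _ => ENNReal.summable]
  simp_rw [ENNReal.tsum_mul_left, PMF.tsum_coe, mul_one]
  exact ENNReal.mul_ne_top (ENNReal.sum_ne_top.2 fun _ _ => ENNReal.ofReal_ne_top)
    ENNReal.ofReal_ne_top

theorem measurableSet_notMem_content (h : IsSemiMarkovModulated μ p F q T X τ R) {x : ℕ}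
    (π : CachingPolicy x) (n i : ℕ) : MeasurableSet {ω | i ∉ π.content (fun k => R k ω) n} :=
  h.measurableSet_history (P := fun r => i ∉ π.content r n) fun r r' hr => by
    rw [π.adapted n r r' hr]

theorem measurableSet_requestedIn (h : IsSemiMarkovModulated μ p F q T X τ R) (m N i : ℕ) :
    MeasurableSet (requestedIn R m N i) :=
  h.measurableSet_history (n := m + N) (P := fun r => ∃ j < N, r (m + j) = i) fun r r' hr => by
    refine exists_congr fun j => and_congr_right fun hj => ?_
    rw [hr (m + j) (by omega)]

variable [IsProbabilityMeasure μ]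

/-- The weight of the document `i` in the lower bound for the cost in a window of length `N`: about
`N` times its rate of cost `popularity i * f i` if the document is rare, that is, has a probability
of at most `ε / N` in all states, and about its rate of cost otherwise. -/
noncomputable def windowWeight (μ : Measure Ω) (q : Fin M → PMF ℕ) (T : ℕ → Ω → ℝ)
    (X : ℕ → Ω → Fin M) (f : ℕ → ℝ) (N : ℕ) (ε : ℝ) (i : ℕ) : ℝ :=
  open Classical in
  if ∀ r, (q r i).toReal ≤ ε / N then (1 - ε) ^ 2 * N * popularity μ q T X i * f i
  else (1 - ε) * popularity μ q T X i * f i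

/-- The expected cost in a window in which every state is seen about as often as it should be: it is
at least the weight left out by the content at the start of the window.  The event `D` that the
window is such is an event of the environment, so that it does not interfere with the law of the
requests. -/
theorem mul_measure_le_setLIntegral_missCost (h : IsSemiMarkovModulated μ p F q T X τ R)
    {f : ℕ → ℝ} (hf : ∀ i, 0 ≤ f i) {x : ℕ} (π : CachingPolicy x)
    {D : Set ((ℕ → ℝ × Fin M) × (ℕ → ℝ))} (hD : MeasurableSet D) {m N : ℕ} (hN : 0 < N) {ε : ℝ}
    (hε : ε ≤ 1) (hDN : ∀ y ∈ D, ∀ r, (1 - ε) * statProb μ T X r * N ≤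
      ∑ j ∈ Finset.range N, if envState (m + j) y = r then (1 : ℝ) else 0)
    {κ : ℝ≥0∞} (hκ : ∀ C : Finset ℕ, C.card = x →
      κ ≤ missedMass (fun i => ENNReal.ofReal (windowWeight μ q T X f N ε i)) C) :
    κ * μ (environment T X τ ⁻¹' D) ≤
      ∫⁻ ω in environment T X τ ⁻¹' D, ∑ j ∈ Finset.range N, missCost R f π (m + j) ω ∂μ := by
  set G := environment T X τ ⁻¹' D with hG
  have hGm : MeasurableSet G := h.measurable_environment hD
  let H : ℕ → Set Ω := fun i => {ω | i ∉ π.content (fun k => R k ω) m}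
  have hH : ∀ i, MeasurableSet (H i) := h.measurableSet_notMem_content π m
  have hQ : ∀ i, MeasurableSet (H i ∩ requestedIn R m N i) := fun i =>
    (hH i).inter (h.measurableSet_requestedIn m N i)
  have key : ∀ i, ENNReal.ofReal (windowWeight μ q T X f N ε i) * μ (G ∩ H i) ≤
      ENNReal.ofReal (f i) * μ (G ∩ H i ∩ requestedIn R m N i) := by
    intro i
    have hP : ∀ r r' : ℕ → ℕ, (∀ k < m, r k = r' k) →
        (i ∉ π.content r m ↔ i ∉ π.content r' m) := fun r r' hr => by rw [π.adapted m r r' hr]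
    have hw : windowWeight μ q T X f N ε i * μ.real (G ∩ H i) ≤
        f i * μ.real (G ∩ H i ∩ requestedIn R m N i) := by
      unfold windowWeight
      split_ifs with hi
      · have := mul_le_mul_of_nonneg_left
          (h.le_measureReal_requestedIn_of_rare hD hN hε hDN hi hP) (hf i)
        refine le_trans (le_of_eq ?_) this
        simp only [H, hG]; ring
      · have := mul_le_mul_of_nonneg_left (h.le_measureReal_requestedIn hD hN hDN i hP) (hf i)
        refine le_trans (le_of_eq ?_) this
        simp only [H, hG]; ring
    rw [← ofReal_measureReal, ← ofReal_measureReal, ← ENNReal.ofReal_mul (hf i),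
      ← ENNReal.ofReal_mul' measureReal_nonneg]
    exact ENNReal.ofReal_le_ofReal hw
  calc κ * μ G = ∫⁻ _ in G, κ ∂μ := by rw [setLIntegral_const]
    _ ≤ ∫⁻ ω in G, ∑' i, ENNReal.ofReal (windowWeight μ q T X f N ε i) *
          (H i).indicator 1 ω ∂μ := by
        refine lintegral_mono fun ω => (hκ _ (π.card_content (fun k => R k ω) m)).trans_eq ?_
        refine tsum_congr fun i => ?_
        by_cases hi : i ∈ π.content (fun k => R k ω) m <;> simp [H, hi]
    _ = ∑' i, ENNReal.ofReal (windowWeight μ q T X f N ε i) * μ (G ∩ H i) := by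
        rw [lintegral_tsum fun i => ((measurable_one.indicator (hH i)).const_mul _).aemeasurable]
        refine tsum_congr fun i => ?_
        rw [lintegral_const_mul _ (measurable_one.indicator (hH i)), lintegral_indicator_one (hH i),
          Measure.restrict_apply (hH i), Set.inter_comm]
    _ ≤ ∑' i, ENNReal.ofReal (f i) * μ (G ∩ H i ∩ requestedIn R m N i) :=
        ENNReal.tsum_le_tsum key
    _ = ∫⁻ ω in G, ∑' i, ENNReal.ofReal (f i) *
          (H i ∩ requestedIn R m N i).indicator 1 ω ∂μ := by
        rw [lintegral_tsum fun i => ((measurable_one.indicator (hQ i)).const_mul _).aemeasurable]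
        refine tsum_congr fun i => ?_
        rw [lintegral_const_mul _ (measurable_one.indicator (hQ i)), lintegral_indicator_one (hQ i),
          Measure.restrict_apply (hQ i), Set.inter_comm _ G, ← Set.inter_assoc]
    _ ≤ _ := lintegral_mono fun ω => tsum_requestedIn_le_sum_missCost R f π m N ω

/-- A lower bound for the long-run cost of a policy through consecutive windows of length `N`: up to
the time `(1 + ε) L N`, `L` windows are completed, each of which costs at least `κ`, outside of
events of probability `ε` each. -/
theorem le_longRunCost (h : IsSemiMarkovModulated μ p F q T X τ R)
    {f : ℕ → ℝ} (hf : ∀ i, 0 ≤ f i) {x : ℕ} (π : CachingPolicy x) {N : ℕ} (hN : 0 < N) {ε : ℝ}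
    (hε0 : 0 < ε) (hε : ε ≤ 1 / 2) (hgood : ∀ m, μ {ω | ∃ r,
      ∑ j ∈ Finset.range N, (if requestState T X τ (m + j) ω = r then (1 : ℝ) else 0) <
        (1 - ε) * statProb μ T X r * N} ≤ ENNReal.ofReal ε)
    {κ : ℝ≥0∞} (hκ : ∀ C : Finset ℕ, C.card = x →
      κ ≤ missedMass (fun i => ENNReal.ofReal (windowWeight μ q T X f N ε i)) C) :
    κ * ENNReal.ofReal ((1 - 2 * ε) / ((1 + ε) * N)) ≤ longRunCost μ τ R f π := by
  classical
  have hN' : (0 : ℝ) < N := by exact_mod_cast hN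
  -- times at which `L` windows are completed with a high probability
  let t : ℕ → ℝ := fun L => (1 + ε) * (L * N : ℕ)
  have ht : Tendsto t atTop atTop :=
    (tendsto_natCast_atTop_atTop.comp (tendsto_id.atTop_mul_const' hN)).const_mul_atTop
      (by linarith)
  have hlate : ∀ᶠ L : ℕ in atTop, μ {ω | t L < τ (L * N) ω} ≤ ENNReal.ofReal ε :=
    ((h.poisson.tendsto_measure_lt hε0).comp (tendsto_id.atTop_mul_const' hN)).eventually
      (Iic_mem_nhds (ENNReal.ofReal_pos.2 hε0))
  refine le_limsup_of_frequently_le (ht.frequently (Eventually.frequently ?_))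
  filter_upwards [hlate, eventually_gt_atTop 0] with L hL hL0
  have hL0' : (0 : ℝ) < L := by exact_mod_cast hL0
  have htpos : 0 < t L := by simp only [t]; push_cast; positivity
  -- the window number `k` sees the states as it should and is completed before the time `t L`
  let D : ℕ → Set ((ℕ → ℝ × Fin M) × (ℕ → ℝ)) := fun k =>
    (⋂ r, {y | (1 - ε) * statProb μ T X r * N ≤
      ∑ j ∈ Finset.range N, if envState (k * N + j) y = r then (1 : ℝ) else 0}) ∩
    ⋂ j ∈ Finset.range N, {y | y.2 (k * N + j) ∈ Set.Icc 0 (t L)}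
  have hD : ∀ k, MeasurableSet (D k) := by
    intro k
    refine (MeasurableSet.iInter fun r => measurableSet_le measurable_const
      (Finset.measurable_sum _ fun j _ => Measurable.ite
        (measurable_envState _ (measurableSet_singleton r)) measurable_const
          measurable_const)).inter
      (Finset.measurableSet_biInter _ fun j _ => ?_)
    have : Measurable fun y : (ℕ → ℝ × Fin M) × (ℕ → ℝ) => y.2 (k * N + j) := by fun_prop
    exact this measurableSet_Icc
  have hDprob : ∀ k < L, ENNReal.ofReal (1 - 2 * ε) ≤ μ (environment T X τ ⁻¹' D k) := by
    intro k hk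
    have h1 : μ (environment T X τ ⁻¹' D k)ᶜ ≤ ENNReal.ofReal (2 * ε) := by
      rw [two_mul, ENNReal.ofReal_add hε0.le hε0.le]
      refine (measure_mono_ae ?_).trans
        ((measure_union_le _ _).trans (add_le_add (hgood (k * N)) hL))
      filter_upwards [h.poisson.ae_pos_strictMono] with ω hω (hωD : ¬ _ ∈ D k)
      by_contra hnot
      refine hωD ⟨Set.mem_iInter.2 fun r => ?_, Set.mem_iInter₂.2 fun j hj => ⟨(hω.1 _).le, ?_⟩⟩
      · by_contra hr
        exact hnot (Or.inl ⟨r, not_le.1 hr⟩)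
      · have h2 : τ (L * N) ω ≤ t L := by
          by_contra hr
          exact hnot (Or.inr (not_le.1 hr))
        refine le_trans (hω.2.monotone ?_) h2
        have : (k + 1) * N ≤ L * N := Nat.mul_le_mul_right N hk
        have := Finset.mem_range.1 hj
        lia
    have h2 := prob_compl_eq_one_sub (μ := μ) (h.measurable_environment (hD k))
    rw [h2, tsub_le_iff_right] at h1
    rw [ENNReal.ofReal_sub _ (by positivity), ENNReal.ofReal_one, tsub_le_iff_right]
    rwa [add_comm]
  rw [ENNReal.le_div_iff_mul_le (Or.inl (ENNReal.ofReal_pos.2 htpos).ne')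
    (Or.inl ENNReal.ofReal_ne_top), mul_assoc, ← ENNReal.ofReal_mul (by
      exact div_nonneg (by linarith) (by positivity))]
  have e1 : (1 - 2 * ε) / ((1 + ε) * N) * t L = L * (1 - 2 * ε) := by
    simp only [t]; push_cast; field_simp
  rw [e1]
  have hcostm : ∀ n, Measurable (missCost R f π n) := by
    intro n
    have hH := h.measurableSet_history (n := n + 1) (P := fun r => r n ∉ π.content r n)
      fun r r' hr => by
        rw [hr n (Nat.lt_succ_self n), π.adapted n r r' fun k hk => hr k (by omega)]
    exact Measurable.ite hH ((measurable_of_countable fun i => ENNReal.ofReal (f i)).comp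
      (h.measurable_R n)) measurable_const
  calc κ * ENNReal.ofReal (L * (1 - 2 * ε))
      = ∑ k ∈ Finset.range L, κ * ENNReal.ofReal (1 - 2 * ε) := by
        rw [Finset.sum_const, Finset.card_range, nsmul_eq_mul,
          ENNReal.ofReal_mul (Nat.cast_nonneg L), ENNReal.ofReal_natCast]
        ring
    _ ≤ ∑ k ∈ Finset.range L, ∫⁻ ω in environment T X τ ⁻¹' D k,
          ∑ j ∈ Finset.range N, missCost R f π (k * N + j) ω ∂μ := by
        refine Finset.sum_le_sum fun k hk => ?_
        refine le_trans (mul_le_mul_right (hDprob k (Finset.mem_range.1 hk)) κ) ?_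
        exact h.mul_measure_le_setLIntegral_missCost hf π (hD k) hN (by linarith)
          (fun y hy r => Set.mem_iInter.1 hy.1 r) hκ
    _ = ∫⁻ ω, ∑ k ∈ Finset.range L, (environment T X τ ⁻¹' D k).indicator
          (fun ω => ∑ j ∈ Finset.range N, missCost R f π (k * N + j) ω) ω ∂μ := by
        rw [lintegral_finsetSum _ fun k _ => (Finset.measurable_sum _ fun j _ =>
          hcostm (k * N + j)).indicator (h.measurable_environment (hD k))]
        exact Finset.sum_congr rfl fun k _ =>
          (lintegral_indicator (h.measurable_environment (hD k)) _).symm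
    _ ≤ _ := by
        refine lintegral_mono fun ω => ?_
        refine le_trans ?_ (ENNReal.sum_le_tsum (Finset.range (L * N)))
        rw [sum_range_mul_eq]
        refine Finset.sum_le_sum fun k _ => ?_
        by_cases hω : ω ∈ environment T X τ ⁻¹' D k
        · rw [Set.indicator_of_mem hω]
          refine Finset.sum_le_sum fun j hj => ?_
          have hτ : τ (k * N + j) ω ∈ Set.Icc 0 (t L) := Set.mem_iInter₂.1 hω.2 j hj
          simp only [missCost, hτ, true_and]
          exact le_of_eq (by congr)
        · rw [Set.indicator_of_notMem hω]
          exact zero_le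

/-- The document requested at a point has the law `popularity`, whatever the time of the point. -/
theorem measure_point_mem_request (h : IsSemiMarkovModulated μ p F q T X τ R) (n i : ℕ) {B : Set ℝ}
    (hB : MeasurableSet B) : μ {ω | τ n ω ∈ B ∧ R n ω = i} =
      μ {ω | τ n ω ∈ B} * ENNReal.ofReal (popularity μ q T X i) := by
  have hn : Measurable fun y : (ℕ → ℝ × Fin M) × (ℕ → ℝ) => y.2 n := by fun_prop
  have h1 := h.measureReal_request (P := fun _ => True) (hn hB) n i fun _ _ _ => Iff.rfl
  have e0 : environment T X τ ⁻¹' ((fun y : (ℕ → ℝ × Fin M) × (ℕ → ℝ) => y.2 n) ⁻¹' B) ∩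
      {_ω : Ω | True} = {ω | τ n ω ∈ B} := by
    ext ω; simp [environment]
  rw [e0] at h1
  have h2 : ∀ r, μ.real ({ω | τ n ω ∈ B} ∩ {ω | requestState T X τ n ω = r}) =
      μ.real {ω | τ n ω ∈ B} * statProb μ T X r := fun r => by
    have := congrArg ENNReal.toReal (h.measure_requestState_eq n hB r)
    rwa [ENNReal.toReal_mul, ENNReal.toReal_ofReal (statProb_nonneg μ T X r)] at this
  simp_rw [h2] at h1
  rw [← ofReal_measureReal, ← ofReal_measureReal, ← ENNReal.ofReal_mul measureReal_nonneg,
    popularity, Finset.mul_sum]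
  refine congrArg ENNReal.ofReal (Eq.trans ?_ (h1.trans ?_))
  · rfl
  · exact Finset.sum_congr rfl fun r _ => by ring

/-- The static policy pays at most the rate of cost of the documents that it does not hold, since
the expected number of requests up to time `t` is at most `t`. -/
theorem longRunCost_static_le (h : IsSemiMarkovModulated μ p F q T X τ R) {f : ℕ → ℝ}
    {x : ℕ} (C : Finset ℕ) (hC : C.card = x) :
    longRunCost μ τ R f (CachingPolicy.static C hC) ≤
      missedMass (fun i => ENNReal.ofReal (popularity μ q T X i * f i)) C := by
  classical
  refine limsup_le_of_le (h := ?_)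
  filter_upwards [eventually_gt_atTop 0] with t ht
  refine ENNReal.div_le_of_le_mul ?_
  have hset : ∀ n i, MeasurableSet {ω | τ n ω ∈ Set.Icc 0 t ∧ R n ω = i} := fun n i =>
    (h.poisson.measurable n measurableSet_Icc).inter (h.measurable_R n (measurableSet_singleton i))
  have hpt : ∀ n ω, (if τ n ω ∈ Set.Icc 0 t ∧
      R n ω ∉ (CachingPolicy.static C hC).content (fun k => R k ω) n
        then ENNReal.ofReal (f (R n ω)) else 0) =
      ∑' i, (if i ∈ C then 0 else ENNReal.ofReal (f i)) *
        {ω | τ n ω ∈ Set.Icc 0 t ∧ R n ω = i}.indicator 1 ω := by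
    intro n ω
    rw [tsum_eq_single (R n ω) fun i hi => by
      rw [Set.indicator_of_notMem fun h => hi h.2.symm, mul_zero]]
    by_cases h1 : τ n ω ∈ Set.Icc 0 t
    · have h3 : ω ∈ {ω' | τ n ω' ∈ Set.Icc 0 t ∧ R n ω' = R n ω} := ⟨h1, rfl⟩
      rw [Set.indicator_of_mem h3, Pi.one_apply, mul_one]
      by_cases h2 : R n ω ∈ C <;> simp [h1, h2, CachingPolicy.static]
    · rw [Set.indicator_of_notMem fun h => h1 h.1, mul_zero, if_neg fun h => h1 h.1]
  have hint : ∀ n, ∫⁻ ω, ∑' i, (if i ∈ C then 0 else ENNReal.ofReal (f i)) *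
        {ω | τ n ω ∈ Set.Icc 0 t ∧ R n ω = i}.indicator 1 ω ∂μ =
      μ {ω | τ n ω ∈ Set.Icc 0 t} *
        missedMass (fun i => ENNReal.ofReal (popularity μ q T X i * f i)) C := by
    intro n
    rw [lintegral_tsum fun i => ((measurable_one.indicator (hset n i)).const_mul _).aemeasurable,
      missedMass, ← ENNReal.tsum_mul_left]
    refine tsum_congr fun i => ?_
    rw [lintegral_const_mul _ (measurable_one.indicator (hset n i)),
      lintegral_indicator_one (hset n i), h.measure_point_mem_request n i measurableSet_Icc]
    by_cases hi : i ∈ C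
    · simp [hi]
    · simp only [hi, if_false]
      rw [ENNReal.ofReal_mul (popularity_nonneg μ q T X i)]
      ring
  have hpoints : ∑' n, μ {ω | τ n ω ∈ Set.Icc 0 t} ≤ ENNReal.ofReal t := by
    refine ENNReal.tsum_le_of_sum_range_le fun n => ?_
    refine le_trans ?_ (ENNReal.ofReal_le_ofReal (h.poisson.sum_measureReal_le ht.le n))
    rw [ENNReal.ofReal_sum_of_nonneg fun _ _ => measureReal_nonneg]
    refine Finset.sum_le_sum fun i _ => ?_
    rw [ofReal_measureReal]
    exact measure_mono fun ω hω => hω.2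
  have hmeas : ∀ n, Measurable fun ω => ∑' i, (if i ∈ C then 0 else ENNReal.ofReal (f i)) *
      {ω | τ n ω ∈ Set.Icc 0 t ∧ R n ω = i}.indicator (1 : Ω → ℝ≥0∞) ω := fun n =>
    Measurable.tsum fun i => (measurable_one.indicator (hset n i)).const_mul _
  calc _ = ∫⁻ ω, ∑' n, ∑' i, (if i ∈ C then 0 else ENNReal.ofReal (f i)) *
        {ω | τ n ω ∈ Set.Icc 0 t ∧ R n ω = i}.indicator 1 ω ∂μ := by
        refine lintegral_congr fun ω => tsum_congr fun n => ?_
        rw [← hpt n ω]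
    _ = ∑' n, μ {ω | τ n ω ∈ Set.Icc 0 t} *
        missedMass (fun i => ENNReal.ofReal (popularity μ q T X i * f i)) C := by
        rw [lintegral_tsum fun n => (hmeas n).aemeasurable]
        exact tsum_congr hint
    _ ≤ _ := by
        rw [ENNReal.tsum_mul_right, mul_comm]
        gcongr

end IsSemiMarkovModulated

theorem mainTheorem2 {Ω : Type*} [MeasurableSpace Ω] (μ : Measure Ω) [IsProbabilityMeasure μ]
    {M : ℕ} (p : Matrix (Fin M) (Fin M) ℝ) (F : Fin M → Fin M → Measure ℝ) (q : Fin M → PMF ℕ)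
    (T : ℕ → Ω → ℝ) (X : ℕ → Ω → Fin M) (τ : ℕ → Ω → ℝ) (R : ℕ → Ω → ℕ)
    (hmod : IsSemiMarkovModulated μ p F q T X τ R)
    (hπ : ∀ r, 0 < statProb μ T X r)
    (hq : ∀ i, 0 < popularity μ q T X i)
    (f : ℕ → ℝ) (K : ℝ) (hf : ∀ i, 0 < f i ∧ f i ≤ K)
    (S : ℕ → Finset ℕ) (hcard : ∀ x, (S x).card = x)
    (hS : ∀ x, ∀ i ∈ S x, ∀ j ∉ S x,
      popularity μ q T X j * f j ≤ popularity μ q T X i * f i) :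
    Tendsto (fun x : ℕ =>
        (⨅ π : CachingPolicy x, longRunCost μ τ R f π) /
          longRunCost μ τ R f (CachingPolicy.static (S x) (hcard x)))
      atTop (𝓝 1) := by
  let b : ℕ → ℝ≥0∞ := fun i => ENNReal.ofReal (popularity μ q T X i * f i)
  have hf0 : ∀ i, 0 ≤ f i := fun i => (hf i).1.le
  have hb : ∑' i, b i ≠ ∞ :=
    IsSemiMarkovModulated.tsum_popularity_mul_ne_top μ q T X fun i => (hf i).2
  have hbS : ∀ x, ∀ i ∈ S x, ∀ j ∉ S x, b j ≤ b i := fun x i hi j hj =>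
    ENNReal.ofReal_le_ofReal (hS x i hi j hj)
  have hmass0 : ∀ x, missedMass b (S x) ≠ 0 := fun x => by
    obtain ⟨i, hi⟩ := Infinite.exists_notMem_finset (S x)
    refine ((ENNReal.ofReal_pos.2 (mul_pos (hq i) (hf i).1)).trans_le (le_missedMass hi)).ne'
  have hmass : ∀ x, missedMass b (S x) ≠ ∞ := fun x => by
    refine ne_top_of_le_ne_top hb (ENNReal.tsum_le_tsum fun i => ?_)
    split_ifs <;> simp
  have hstatic : ∀ x, longRunCost μ τ R f (CachingPolicy.static (S x) (hcard x)) ≤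
      missedMass b (S x) := fun x => hmod.longRunCost_static_le (S x) (hcard x)
  -- the factor that the windows lose: `(1 - ε) ^ 2` for the states and for repeated requests,
  -- `1 - 2 * ε` for the bad events, `1 + ε` for late points
  let φ : ℝ → ℝ := fun ε => (1 - ε) ^ 2 * (1 - 2 * ε) / (1 + ε)
  have hlower : ∀ ε : ℝ, 0 < ε → ε ≤ 1 / 2 → ∀ᶠ x in atTop, ENNReal.ofReal (φ ε) ≤
      (⨅ π : CachingPolicy x, longRunCost μ τ R f π) /
        longRunCost μ τ R f (CachingPolicy.static (S x) (hcard x)) := by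
    intro ε hε0 hε
    obtain ⟨N, hN, hgood⟩ := hmod.exists_window hπ hε0
    have hN' : (0 : ℝ) < N := by exact_mod_cast hN
    -- all but finitely many documents are rare
    have hrare : {i | ¬ ∀ r, (q r i).toReal ≤ ε / N}.Finite := by
      have h1 : ∀ r, ∀ᶠ i in cofinite, (q r i).toReal ≤ ε / N := fun r => by
        have h2 : Tendsto (fun i => (q r i).toReal) cofinite (𝓝 0) :=
          (ENNReal.summable_toReal (q r).tsum_coe_ne_top).tendsto_cofinite_zero
        exact h2.eventually (Iic_mem_nhds (by positivity))
      exact eventually_cofinite.1 (eventually_all.2 h1)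
    have hev := eventually_mul_missedMass_le (b := b)
      (b' := fun i => ENNReal.ofReal (IsSemiMarkovModulated.windowWeight μ q T X f N ε i))
      (a := ENNReal.ofReal ((1 - ε) ^ 2 * N)) ENNReal.ofReal_ne_top hcard hbS hb hrare.toFinset
      (fun i hi => by
        have hi' : ∀ r, (q r i).toReal ≤ ε / N := by simpa using hi
        simp only [b, IsSemiMarkovModulated.windowWeight]
        rw [if_pos hi', ← ENNReal.ofReal_mul (by positivity)]
        exact ENNReal.ofReal_le_ofReal (le_of_eq (by ring)))
      (fun i hi => by
        have hi' : ¬ ∀ r, (q r i).toReal ≤ ε / N := by simpa using hi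
        simp only [IsSemiMarkovModulated.windowWeight]
        rw [if_neg hi']
        exact ENNReal.ofReal_pos.2 (mul_pos (mul_pos (by linarith) (hq i)) (hf i).1))
    filter_upwards [hev] with x hx
    have h1 : ∀ π : CachingPolicy x, ENNReal.ofReal (φ ε) * missedMass b (S x) ≤
        longRunCost μ τ R f π := fun π => by
      refine le_trans (le_of_eq ?_) (hmod.le_longRunCost hf0 π hN hε0 hε hgood hx)
      rw [mul_right_comm, ← ENNReal.ofReal_mul (by positivity)]
      congr 2
      simp only [φ]
      field_simp
    calc ENNReal.ofReal (φ ε) = ENNReal.ofReal (φ ε) * missedMass b (S x) / missedMass b (S x) := by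
          rw [ENNReal.mul_div_cancel_right (hmass0 x) (hmass x)]
      _ ≤ _ := ENNReal.div_le_div (le_iInf h1) (hstatic x)
  have hupper : ∀ x, (⨅ π : CachingPolicy x, longRunCost μ τ R f π) /
      longRunCost μ τ R f (CachingPolicy.static (S x) (hcard x)) ≤ 1 := fun x =>
    (ENNReal.div_le_div_right (iInf_le _ _) _).trans ENNReal.div_self_le_one
  have hφ : Tendsto (fun ε => ENNReal.ofReal (φ ε)) (𝓝[>] 0) (𝓝 1) := by
    have h1 : ContinuousAt φ 0 := by
      simp only [φ]
      exact ContinuousAt.div (by fun_prop) (by fun_prop) (by norm_num)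
    have h2 := ENNReal.tendsto_ofReal (h1.tendsto.mono_left (nhdsWithin_le_nhds (s := Set.Ioi 0)))
    simpa [φ] using h2
  refine tendsto_order.2 ⟨fun a ha => ?_, fun a ha =>
    Eventually.of_forall fun x => (hupper x).trans_lt ha⟩
  obtain ⟨ε, h1, h2⟩ := ((hφ.eventually (lt_mem_nhds ha)).and
    (Ioc_mem_nhdsGT (show (0 : ℝ) < 1 / 2 by norm_num))).exists
  filter_upwards [hlower ε h2.1 h2.2] with x hx using h1.trans_le hx
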